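/- \textbf{Conventions.} Graphs are finite and simple; vertices and edges carry labels. An \emph{embedding} of a connected graph is an oriented combinatorial embedding in the sphere, i.e. a rotation system of genus $0$ (one that satisfies Euler's formula); it induces an embedding of every connected subgraph by restricting the rotations. \textbf{Hybrid deletion sequences.} For graphs $H,G$ and $A\subseteq E(H)$, $H$ is a \emph{hybrid subgraph of $G$ with respect to $A$} if $H$ is obtained from a subgraph of $G$ by relabelling vertices and relabelling some edges outside $A$. A \emph{hybrid deletion sequence} is a sequence $(G_1,\dots,G_n)$, $n\ge 1$, with a set $S$ of \emph{strict} edge labels, such that for each $i<n$ one of $G_i,G_{i+1}$, say $H$, is a hybrid subgraph of the other with respect to $S\cap E(H)$. A \emph{simultaneous embedding} is a sequence $(\sigma_1,\dots,\sigma_n)$ of embeddings of $G_1,\dots,G_n$ such that for each $i<n$: if $G_i$ is a hybrid subgraph of $G_{i+1}$ with respect to $A=S\cap E(G_i)$, then $\sigma_i$ equals, up to an isomorphism that is the identity on the edge labels in $A$, the embedding induced by $\sigma_{i+1}$ on some subgraph of $G_{i+1}$; otherwise the same holds with the roles of $i$ and $i+1$ exchanged. The \emph{length} is $n$, and the \emph{size}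 is the total number of vertices and edges of $G_1,\dots,G_n$. \textbf{Villages.} Write $[s]=\{1,\dots,s\}$. The \emph{planet of equator $s\ge 1$} is a wheel with rim $s_1,\dots,s_{4s}$. For $I\subseteq[s]$ the \emph{village} $V(s,I)$ is obtained from it by adding for every $i\in I$ a \emph{house} $H_i$: a path $v_1\dots v_7$ with $v_1=s_{4i-3}$, $v_7=s_{4i-1}$ and otherwise new vertices, and a new vertex $w$, the \emph{inhabitant}, joined to $v_2,v_4,v_6$. The \emph{bounding cycle} of $H_i$ consists of $v_1\dots v_7$ and the rim path $s_{4i-3}s_{4i-2}s_{4i-1}$. Given an embedding $\sigma$ of $V(s,I)$, put $T_\sigma(H_i)=1$ if the inhabitant of $H_i$ and the centre of the wheel are on different sides of the bounding cycle of $H_i$, and $T_\sigma(H_i)=0$ otherwise. \textbf{Housing sequences.} An \emph{$(I,s)$-housing sequence} is a hybrid deletion sequence $(G_1,\dots,G_n)$ of $2$-connected graphs together with isomorphisms from $V(s,I)$ to $G_1$ and to $G_n$ that agree on the planet, such that: in every simultaneous embedding, $G_1$ and $G_n$ have the same embedding (as embeddings of $V(s,I)$, via the two isomorphisms); the planet of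 $G_1$ is a subgraph of every $G_i$; and in every $G_i$ every vertex other than the centre of the planet has strictly smaller degree than the centre. Its \emph{allocation set} is the set of all functions $f\colon I\to\{0,1\}$ of the form $f(i)=T_{\sigma_1}(H_i)$, where $(\sigma_1,\dots,\sigma_n)$ ranges over its simultaneous embeddings. \textbf{Lemma.} Let $m\ge 0$ and $s\ge 1$ be integers with $s\ge m^3$ and $(m,s)\ne(1,1)$, and let $J\subseteq\binom{[m]}{2}$. Then there is an $([m],s)$-housing sequence of length at most $27$ and size at most $400\,s^{4/3}$ whose allocation set is $$NEQ(J)=\{f\colon[m]\to\{0,1\}\;:\; f(i)\ne f(j)\text{ for all }\{i,j\}\in J\}.$$ -/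

import Mathlib

open scoped Graph

namespace Housing

/-! ### Rotation systems and planar embeddings

Graphs are Mathlib's `Graph α β`: vertices and edges carry labels, in `α` and in `β`. -/

section Embeddings

variable {α β α' β' : Type*}

/-- A dart of `G`: an edge together with one of its ends. -/
@[ext]
structure Dart (G : Graph α β) where
  vertex : α
  edge : β
  inc : G.Inc edge vertex

/-- The same edge, based at its other end. -/
noncomputable def Dart.rev {G : Graph α β} (d : Dart G) : Dart G where
  vertex := d.inc.other
  edge := d.edge
  inc := d.inc.inc_other

theorem Dart.rev_involutive (G : Graph α β) :
    Function.Involutive (Dart.rev : Dart G → Dart G) := by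
  intro d
  apply Dart.ext
  · exact d.rev.inc.isLink_other.right_unique d.inc.isLink_other.symm
  · rfl

/-- A rotation system: at every vertex a cyclic order of the edges incident with it. The permutation
`rot` sends a dart to the next dart around the same vertex. -/
structure RotationSystem (G : Graph α β) where
  rot : Equiv.Perm (Dart G)
  vertex_rot : ∀ d, (rot d).vertex = d.vertex
  sameCycle : ∀ d d', d.vertex = d'.vertex → rot.SameCycle d d'

/-- The face permutation; its cycles are the facial walks. -/
noncomputable def RotationSystem.face {G : Graph α β} (σ : RotationSystem G) :
    Equiv.Perm (Dart G) :=
  (Dart.rev_involutive G).toPerm.trans σ.rot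

/-- The number of facial walks. -/
noncomputable def RotationSystem.numFaces {G : Graph α β} (σ : RotationSystem G) : ℕ :=
  Nat.card (Quotient (Equiv.Perm.SameCycle.setoid σ.face))

/-- A (combinatorial, oriented) embedding of a finite connected graph with at least one edge in the
sphere: a rotation system of genus zero, that is, one satisfying Euler's formula. -/
structure PlanarEmbedding (G : Graph α β) extends RotationSystem G where
  euler : (V(G).ncard : ℤ) - (E(G).ncard : ℤ) + (toRotationSystem.numFaces : ℤ) = 2

/-- Let `C` be the edge set of a cycle of an embedded graph, and let `x`, `y` be vertices off that
cycle. They lie in the same one of the two disks bounded by the cycle: from a face at `x` one gets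
to a face at `y` by crossing only edges not in `C`. -/
def PlanarEmbedding.SameSide {G : Graph α β} (σ : PlanarEmbedding G) (C : Set β) (x y : α) : Prop :=
  ∃ d d' : Dart G, d.vertex = x ∧ d'.vertex = y ∧
    Relation.EqvGen (fun a b => b = σ.face a ∨ (a.edge ∉ C ∧ b = a.rev)) d d'

/-! ### Relabelling maps and induced embeddings -/

/-- An injective graph homomorphism, that is, an isomorphism of `H` onto a subgraph of `G`
(the values of the two functions off `H` are irrelevant). -/
structure Mono (H : Graph α β) (G : Graph α' β') where
  onV : α → α'
  onE : β → β'
  onV_mem : ∀ x ∈ V(H), onV x ∈ V(G)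
  onV_inj : Set.InjOn onV V(H)
  onE_inj : Set.InjOn onE E(H)
  isLink : ∀ e x y, H.IsLink e x y → G.IsLink (onE e) (onV x) (onV y)

/-- The map is an isomorphism onto all of `G`. -/
def Mono.IsIso {H : Graph α β} {G : Graph α' β'} (f : Mono H G) : Prop :=
  f.onV '' V(H) = V(G) ∧ f.onE '' E(H) = E(G)

/-- The induced map on darts. -/
def Mono.onDart {H : Graph α β} {G : Graph α' β'} (f : Mono H G) (d : Dart H) : Dart G where
  vertex := f.onV d.vertex
  edge := f.onE d.edge
  inc := d.inc.elim fun y h => ⟨f.onV y, f.isLink _ _ _ h⟩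

/-- `f` fixes the edge labels in `A`. -/
def Mono.Fixes {H G : Graph α β} (f : Mono H G) (A : Set β) : Prop :=
  ∀ e ∈ A, f.onE e = e

/-- Along `f`, the embedding `τ` of `H` is the embedding that `σ` induces on the subgraph `f(H)`
of `G`: the successor of a dart of `f(H)` is the next dart, in the rotation given by `σ`, that
belongs to `f(H)`. -/
def Mono.Induces {H : Graph α β} {G : Graph α' β'} (f : Mono H G)
    (σ : PlanarEmbedding G) (τ : PlanarEmbedding H) : Prop :=
  ∀ d : Dart H, ∃ k : ℕ,
    f.onDart (τ.rot d) = (σ.rot ^ (k + 1)) (f.onDart d) ∧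
      ∀ j < k, (σ.rot ^ (j + 1)) (f.onDart d) ∉ Set.range f.onDart

/-! ### Hybrid deletion sequences -/

/-- `H` is a hybrid subgraph of `G` with respect to the set `A` of strict edges: `H` arises from a
subgraph of `G` by relabelling vertices and relabelling some edges outside of `A`. -/
def IsHybridSubgraph (A : Set β) (H G : Graph α β) : Prop :=
  A ⊆ E(H) ∧ ∃ f : Mono H G, f.Fixes A

/-- Up to an isomorphism fixing `A`, the embedding `τ` of `H` is induced by `σ` on some subgraph
of `G`. -/
def InducesUpTo (A : Set β) {H G : Graph α β} (σ : PlanarEmbedding G) (τ : PlanarEmbedding H) :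
    Prop :=
  ∃ f : Mono H G, f.Fixes A ∧ f.Induces σ τ

/-- A graph is 2-connected: it has at least three vertices, it is connected, and it remains
connected when any one vertex is deleted. -/
def TwoConnected (G : Graph α β) : Prop :=
  3 ≤ V(G).ncard ∧ G.toSimpleGraph.Connected ∧
    ∀ v ∈ V(G), (G.deleteVerts {v}).toSimpleGraph.Connected

end Embeddings

/-- A hybrid deletion sequence of finite simple graphs `graph 0, …, graph n`. The set `strict` holds
the edge labels that are strict; every label is strict in all the hybrid subgraph relations in which
it appears, or in none of them. -/
structure HybridDeletionSequence where
  n : ℕ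
  graph : Fin (n + 1) → Graph ℕ ℕ
  finite_vertexSet : ∀ i, V(graph i).Finite
  finite_edgeSet : ∀ i, E(graph i).Finite
  simple : ∀ i, (graph i).Simple
  strict : Set ℕ
  step : ∀ i : Fin n,
    IsHybridSubgraph (strict ∩ E(graph i.castSucc)) (graph i.castSucc) (graph i.succ) ∨
      IsHybridSubgraph (strict ∩ E(graph i.succ)) (graph i.succ) (graph i.castSucc)

namespace HybridDeletionSequence

/-- The number of graphs in the sequence. -/
def length (𝒢 : HybridDeletionSequence) : ℕ := 𝒢.n + 1

/-- The total number of vertices and edges of the graphs in the sequence. -/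
noncomputable def size (𝒢 : HybridDeletionSequence) : ℕ :=
  ∑ i, (V(𝒢.graph i).ncard + E(𝒢.graph i).ncard)

/-- The embeddings `φ 0, …, φ n` form a hybrid simultaneous embedding. -/
def IsSimultaneousEmbedding (𝒢 : HybridDeletionSequence)
    (φ : ∀ i, PlanarEmbedding (𝒢.graph i)) : Prop :=
  ∀ i : Fin 𝒢.n,
    (IsHybridSubgraph (𝒢.strict ∩ E(𝒢.graph i.castSucc))
        (𝒢.graph i.castSucc) (𝒢.graph i.succ) →
      InducesUpTo (𝒢.strict ∩ E(𝒢.graph i.castSucc)) (φ i.succ) (φ i.castSucc)) ∧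
    (¬ IsHybridSubgraph (𝒢.strict ∩ E(𝒢.graph i.castSucc))
        (𝒢.graph i.castSucc) (𝒢.graph i.succ) →
      InducesUpTo (𝒢.strict ∩ E(𝒢.graph i.succ)) (φ i.castSucc) (φ i.succ))

end HybridDeletionSequence

/-! ### Villages -/

/-- Names for the vertices of villages: the centre of the planet, the surface vertices `s_k`, the
vertices `v_k` (with `2 ≤ k ≤ 6`) of the house `H_i`, and the vertex `w` of the house `H_i`. -/
inductive VillageVertex
  | centre
  | surface (k : ℕ)
  | wall (i k : ℕ)
  | inhabitant (i : ℕ)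

/-- Names for the edges of villages: the edge from the centre to `s_k`, the edge from `s_k` to its
successor on the surface, the edge `v_k v_{k+1}` of the house `H_i`, and the edge from the vertex
`w` of the house `H_i` to its vertex `v_k`. -/
inductive VillageEdge
  | spoke (k : ℕ)
  | rim (k : ℕ)
  | wall (i k : ℕ)
  | claw (i k : ℕ)

/-- The vertex `v_k` of the house `H_i`, for `1 ≤ k ≤ 7`; here `v_1` and `v_7` are identified with
the surface vertices `s_{4i-3}` and `s_{4i-1}`. -/
def houseVertex (i k : ℕ) : VillageVertex :=
  if k = 1 then .surface (4 * i - 3) else if k = 7 then .surface (4 * i - 1) else .wall i k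

/-- The two ends of an edge of a village on a planet of equator `m`, whose surface is the cycle
`s_1, …, s_{4m}`. -/
def villageEnds (m : ℕ) : VillageEdge → VillageVertex × VillageVertex
  | .spoke k => (.centre, .surface k)
  | .rim k => (.surface k, .surface (if k = 4 * m then 1 else k + 1))
  | .wall i k => (houseVertex i k, houseVertex i (k + 1))
  | .claw i k => (.inhabitant i, houseVertex i k)

/-- The vertex set of the village `V(m, I)`. -/
def villageVertices (m : ℕ) (I : Finset ℕ) : Set VillageVertex :=
  {x | match x with
    | .centre => True
    | .surface k => 1 ≤ k ∧ k ≤ 4 * m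
    | .wall i k => i ∈ I ∧ i ∈ Finset.Icc 1 m ∧ 2 ≤ k ∧ k ≤ 6
    | .inhabitant i => i ∈ I ∧ i ∈ Finset.Icc 1 m}

/-- The edge set of the village `V(m, I)`. -/
def villageEdges (m : ℕ) (I : Finset ℕ) : Set VillageEdge :=
  {e | match e with
    | .spoke k => 1 ≤ k ∧ k ≤ 4 * m
    | .rim k => 1 ≤ k ∧ k ≤ 4 * m
    | .wall i k => i ∈ I ∧ i ∈ Finset.Icc 1 m ∧ 1 ≤ k ∧ k ≤ 6
    | .claw i k => i ∈ I ∧ i ∈ Finset.Icc 1 m ∧ (k = 2 ∨ k = 4 ∨ k = 6)}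

theorem villageEnds_mem (m : ℕ) (I : Finset ℕ) (e : VillageEdge) (he : e ∈ villageEdges m I) :
    (villageEnds m e).1 ∈ villageVertices m I ∧ (villageEnds m e).2 ∈ villageVertices m I := by
  cases e with
  | spoke k => exact ⟨trivial, he⟩
  | rim k =>
    obtain ⟨h1, h2⟩ := he
    refine ⟨⟨h1, h2⟩, ?_⟩
    change 1 ≤ _ ∧ _ ≤ 4 * m
    split_ifs <;> omega
  | wall i k =>
    obtain ⟨hI, hi, h1, h2⟩ := he
    have hi' := Finset.mem_Icc.1 hi
    have key : ∀ j, 1 ≤ j → j ≤ 7 → houseVertex i j ∈ villageVertices m I := by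
      intro j h1 h2
      unfold houseVertex
      split_ifs
      · change 1 ≤ _ ∧ _ ≤ 4 * m
        omega
      · change 1 ≤ _ ∧ _ ≤ 4 * m
        omega
      · exact ⟨hI, hi, by omega, by omega⟩
    exact ⟨key _ (by omega) (by omega), key _ (by omega) (by omega)⟩
  | claw i k =>
    obtain ⟨hI, hi, hk⟩ := he
    refine ⟨⟨hI, hi⟩, ?_⟩
    change houseVertex i k ∈ _
    unfold houseVertex
    rw [if_neg (by omega), if_neg (by omega)]
    exact ⟨hI, hi, by omega, by omega⟩

/-- The village `V(m, I)`: a wheel of rim-length `4m` (the planet of equator `m`) with a house glued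
to it for every `i ∈ I`. -/
def village (m : ℕ) (I : Finset ℕ) : Graph VillageVertex VillageEdge where
  vertexSet := villageVertices m I
  edgeSet := villageEdges m I
  IsLink e x y := e ∈ villageEdges m I ∧ (villageEnds m e = (x, y) ∨ villageEnds m e = (y, x))
  isLink_symm _ _ := ⟨fun _ _ h => ⟨h.1, h.2.symm⟩⟩
  eq_or_eq_of_isLink_of_isLink := by
    rintro e x y v w ⟨-, h | h⟩ ⟨-, h' | h'⟩ <;> rw [h] at h' <;> simp_all
  edge_mem_iff_exists_isLink e :=
    ⟨fun he => ⟨_, _, he, Or.inl rfl⟩, fun ⟨_, _, h⟩ => h.1⟩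
  left_mem_of_isLink := by
    rintro e x y ⟨he, h | h⟩
    · have := (villageEnds_mem m I e he).1
      rwa [h] at this
    · have := (villageEnds_mem m I e he).2
      rwa [h] at this

/-- The planet of equator `m`: the wheel with rim `s_1, …, s_{4m}`. -/
def planet (m : ℕ) : Graph VillageVertex VillageEdge := village m ∅

/-- The bounding cycle of the house `H_i`: the path `v_1 … v_7` together with the path
`s_{4i-3} s_{4i-2} s_{4i-1}`. -/
def boundingCycle (i : ℕ) : Set VillageEdge :=
  {e | (∃ k, 1 ≤ k ∧ k ≤ 6 ∧ e = .wall i k) ∨ e = .rim (4 * i - 3) ∨ e = .rim (4 * i - 2)}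

/-! ### Housing sequences -/

/-- An `(I, m)`-housing sequence. The isomorphisms `first` and `last` from `V(m, I)` to the first
and to the last graph say which subgraphs of these are the planet and the `i`-th house. -/
structure HousingSequence (m : ℕ) (I : Finset ℕ) extends HybridDeletionSequence where
  index_subset : I ⊆ Finset.Icc 1 m
  twoConnected : ∀ i, TwoConnected (graph i)
  first : Mono (village m I) (graph 0)
  first_isIso : first.IsIso
  last : Mono (village m I) (graph (Fin.last n))
  last_isIso : last.IsIso
  /-- The planet of the first graph is a subgraph of all the graphs. -/
  planet_onV : ∀ i, ∀ x ∈ V(planet m), first.onV x ∈ V(graph i)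
  planet_isLink : ∀ i e x y, (planet m).IsLink e x y →
    (graph i).IsLink (first.onE e) (first.onV x) (first.onV y)
  /-- It is also the planet of the last graph. -/
  last_onV : ∀ x ∈ V(planet m), last.onV x = first.onV x
  last_onE : ∀ e ∈ E(planet m), last.onE e = first.onE e
  /-- All vertices other than the centre of the planet have smaller degree than the centre. -/
  degree_lt : ∀ i, ∀ v ∈ V(graph i), v ≠ first.onV .centre →
    ((graph i).incidenceSet v).ncard < ((graph i).incidenceSet (first.onV .centre)).ncard
  /-- In all simultaneous embeddings the first and the last graph have the same embedding. -/
  same_embedding : ∀ φ : ∀ i, PlanarEmbedding (graph i),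
    toHybridDeletionSequence.IsSimultaneousEmbedding φ →
      ∀ d d' : Dart (village m I),
        (φ 0).rot (first.onDart d) = first.onDart d' ↔
          (φ (Fin.last n)).rot (last.onDart d) = last.onDart d'

namespace HousingSequence

/-- In the embedding `σ` of the first graph, the inhabitant of the house `H_i` is embedded inside of
its house: in the disk bounded by the bounding cycle of `H_i` that avoids the centre. -/
def InhabitantInside {m : ℕ} {I : Finset ℕ} (𝒢 : HousingSequence m I)
    (σ : PlanarEmbedding (𝒢.graph 0)) (i : ℕ) : Prop :=
  ¬ σ.SameSide (𝒢.first.onE '' boundingCycle i) (𝒢.first.onV .centre) (𝒢.first.onV (.inhabitant i))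

/-- The allocation set: the functions assigning to `i ∈ I` the truth value of the house `H_i`, for
all simultaneous embeddings of the sequence. -/
def allocationSet {m : ℕ} {I : Finset ℕ} (𝒢 : HousingSequence m I) : Set (I → Bool) :=
  {f | ∃ φ : ∀ i, PlanarEmbedding (𝒢.graph i),
    𝒢.IsSimultaneousEmbedding φ ∧ ∀ i : I, f i = true ↔ 𝒢.InhabitantInside (φ 0) i}

end HousingSequence

/-- `NEQ(J)`, for a set `J` of unordered pairs of elements of the index set `I`. -/
def NEQ (I : Finset ℕ) (J : Finset (Finset ℕ)) : Set (I → Bool) :=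
  {f | ∀ i j : I, ({(i : ℕ), (j : ℕ)} : Finset ℕ) ∈ J → f i ≠ f j}

end Housing

/-! An embedding of a village is determined by the embedding of the planet together with the cyclic
order of the three edges at each inhabitant (`village_rot_eq`), and an inhabitant is inside its
house exactly if this order agrees with the orientation of the planet (`not_sameSide_iff`). If all
edge labels are strict, the cyclic orders of surviving edges are carried from each graph of the
sequence to the next. So it suffices to find a planar modification of the village that forces the
orders at two given inhabitants to be opposite, and then to undo it.

For two houses the modification is as follows. A link is added from `v_6` of the left house to `v_2`
of the right one, then the walls `v_6 v_7` of the left house and `v_1 v_2` of the right one are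
deleted, so that the two houses share one long wall. Then `v_4` of the left house is joined to the
inhabitant of the right house. The left inhabitant closes off `v_4` on its own side of the long
wall, so the right inhabitant has to be on the other side (`cycAt_coupled`); if the two are on
different sides, then the graph can be drawn (`hasPotentialsOn_coupled`). Many pairs can be coupled
at once, provided that the links do not cross (`isRegion_linkRegion`). One such round takes six
steps.

Three rounds suffice for any `J`, by `exists_matchings`. At most `m ^ 3` houses are arranged in
blocks of `m`, one block for each pair in `J`, with the order of the variables reversed in every
other block. Two matchings couple mirror images in adjacent blocks; they nest, and they force the
copies of a variable to alternate in value. The third matching couples, in each block, the two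
houses of the pair assigned to it. This gives 19 graphs of size linear in `s`.

Topology enters through linear algebra. For a connected graph, Euler's formula holds if and only if
every circulation has a potential on the faces (`euler_iff_potential`, `RotationSystem.euler_iff`),
by a count of dimensions. Potentials give the theta lemma `RotationSystem.cycAt_theta`: three
internally disjoint paths leave their two common ends in opposite cyclic orders. The forced orders
are obtained from well chosen paths. Conversely, a drawing given by explicit rotations is shown to
have genus zero by admitting more and more edges to the supports of circulations: pendant edges cost
nothing (`RotationSystem.HasPotentialsOn.pendant`), and any other edge has to be on the boundary of
a union of faces whose remaining boundary edges have been admitted already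
(`RotationSystem.HasPotentialsOn.insert`). -/

namespace Housing

section

/-! ### Functions invariant under permutations of a finite set -/

section PermInvariants

open Module

variable {D : Type*}

/-- The number of cycles of a permutation, fixed points included. -/
noncomputable def numCycles (π : Equiv.Perm D) : ℕ :=
  Nat.card (Quotient (Equiv.Perm.SameCycle.setoid π))

/-- The functions that are constant on the cycles of a permutation. -/
def invariants (π : Equiv.Perm D) : Submodule ℚ (D → ℚ) where
  carrier := {f | ∀ d, f (π d) = f d}
  add_mem' hf hg d := by simp [hf d, hg d]
  zero_mem' d := rfl
  smul_mem' c f hf d := by simp [hf d]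

theorem mem_invariants {π : Equiv.Perm D} {f : D → ℚ} :
    f ∈ invariants π ↔ ∀ d, f (π d) = f d := Iff.rfl

theorem eq_of_sameCycle {X : Type*} {π : Equiv.Perm D} {f : D → X} (hf : ∀ d, f (π d) = f d)
    {x y : D} (h : π.SameCycle x y) : f x = f y := by
  obtain ⟨i, rfl⟩ := h
  induction i using Int.induction_on with
  | zero => rfl
  | succ n ih => rw [add_comm, zpow_add, zpow_one, Equiv.Perm.mul_apply, hf, ih]
  | pred n ih =>
    rw [ih, sub_eq_add_neg, add_comm, zpow_add, Equiv.Perm.mul_apply, zpow_neg_one]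
    have := hf (π⁻¹ ((π ^ (-(n : ℤ))) x))
    rw [← Equiv.Perm.mul_apply, mul_inv_cancel, Equiv.Perm.one_apply] at this
    exact this

/-- Invariant functions are functions on the set of cycles. -/
def invariantsEquiv (π : Equiv.Perm D) :
    invariants π ≃ₗ[ℚ] (Quotient (Equiv.Perm.SameCycle.setoid π) → ℚ) where
  toFun f := Quotient.lift f.1 fun _ _ h => eq_of_sameCycle f.2 h
  map_add' f g := by ext q; induction q using Quotient.inductionOn; rfl
  map_smul' c f := by ext q; induction q using Quotient.inductionOn; rfl
  invFun g := ⟨fun d => g (Quotient.mk _ d), fun d => by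
    exact congrArg g <| Quotient.sound (s := Equiv.Perm.SameCycle.setoid π)
      (Equiv.Perm.sameCycle_apply_left.2 (Equiv.Perm.SameCycle.refl π d))⟩
  left_inv f := rfl
  right_inv g := by ext q; induction q using Quotient.inductionOn; rfl

variable [Fintype D]

theorem finrank_invariants (π : Equiv.Perm D) : finrank ℚ (invariants π) = numCycles π := by
  classical
  have := Fintype.ofFinite (Quotient (Equiv.Perm.SameCycle.setoid π))
  rw [(invariantsEquiv π).finrank_eq, Module.finrank_fintype_fun_eq_card, numCycles,
    Nat.card_eq_fintype_card]

/-- Each cycle consists of a chosen representative and its image, which are distinct. -/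
theorem card_eq_two_mul_numCycles {ι : Equiv.Perm D} (hι : ∀ d, ι (ι d) = d)
    (hfix : ∀ d, ι d ≠ d) : Fintype.card D = 2 * numCycles ι := by
  have hsc : ∀ x y, ι.SameCycle x y → y = x ∨ y = ι x := by
    rintro x y ⟨i, rfl⟩
    rcases Int.even_or_odd' i with ⟨k, rfl | rfl⟩
    · left
      have h2 : ι ^ (2 : ℤ) = 1 := by ext d; rw [zpow_two]; exact hι d
      rw [zpow_mul, h2]; simp
    · right
      have h2 : ι ^ (2 : ℤ) = 1 := by ext d; rw [zpow_two]; exact hι d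
      rw [zpow_add, zpow_mul, h2]; simp
  let F : Quotient (Equiv.Perm.SameCycle.setoid ι) × Bool → D :=
    fun q => if q.2 then ι q.1.out else q.1.out
  have hF : Function.Bijective F := by
    constructor
    · rintro ⟨q, b⟩ ⟨q', b'⟩ h
      have hq : q = q' := by
        rw [← Quotient.out_eq q, ← Quotient.out_eq q']
        apply Quotient.sound
        have key : ι.SameCycle q.out q'.out := by
          cases b <;> cases b' <;> simp only [F, if_true, Bool.false_eq_true, if_false] at h
          · rw [h]
          · rw [h]; exact Equiv.Perm.sameCycle_apply_left.2 (Equiv.Perm.SameCycle.refl ι _)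
          · rw [← h]; exact Equiv.Perm.sameCycle_apply_right.2 (Equiv.Perm.SameCycle.refl ι _)
          · rw [ι.injective h]
        exact key
      subst hq
      cases b <;> cases b' <;> simp [F] at h ⊢
      · exact hfix _ h.symm
      · exact hfix _ h
    · intro d
      have := Quotient.mk_out (s := Equiv.Perm.SameCycle.setoid ι) d
      rcases hsc _ _ this with h | h
      · exact ⟨(Quotient.mk _ d, false), by simpa [F] using h.symm⟩
      · exact ⟨(Quotient.mk _ d, true), by simpa [F] using h.symm⟩
  rw [← Nat.card_eq_fintype_card, ← Nat.card_congr (Equiv.ofBijective F hF), Nat.card_prod,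
    numCycles]
  simp [mul_comm]

/-- The pairing of functions on a finite set. -/
def pairing (D : Type*) [Fintype D] : LinearMap.BilinForm ℚ (D → ℚ) :=
  LinearMap.mk₂ ℚ (fun x y => ∑ d, x d * y d)
    (fun x x' y => by simp [add_mul, Finset.sum_add_distrib])
    (fun c x y => by simp [Finset.mul_sum, mul_assoc])
    (fun x y y' => by simp [mul_add, Finset.sum_add_distrib])
    (fun c x y => by simp [Finset.mul_sum, mul_left_comm])

theorem pairing_apply (x y : D → ℚ) : pairing D x y = ∑ d, x d * y d := rfl

theorem pairing_isRefl : (pairing D).IsRefl := fun x y h => by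
  rw [pairing_apply] at h ⊢
  simpa [mul_comm] using h

theorem pairing_nondegenerate : (pairing D).Nondegenerate := by
  classical
  refine (LinearMap.IsRefl.nondegenerate_iff_separatingLeft pairing_isRefl).2 ?_
  intro x hx
  ext d
  simpa [pairing_apply, Pi.single_apply] using hx (Pi.single d 1)

theorem sum_comp_perm (π : Equiv.Perm D) (f : D → ℚ) : ∑ d, f (π d) = ∑ d, f d :=
  Equiv.sum_comp π f

/-- Euler's formula for a pair of permutations `ρ`, `ι` generating a transitive group, where `ι` is
an involution without fixed points, holds if and only if every circulation has a potential. -/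
theorem euler_iff_potential [Nonempty D] {ρ ι : Equiv.Perm D} (hι : ∀ d, ι (ι d) = d)
    (hfix : ∀ d, ι d ≠ d)
    (htrans : ∀ f : D → ℚ, (∀ d, f (ρ d) = f d) → (∀ d, f (ι d) = f d) → ∀ a b, f a = f b) :
    numCycles ρ + numCycles (ι.trans ρ) = numCycles ι + 2 ↔
      ∀ z : D → ℚ, (∀ d, z (ι d) = -z d) →
        (∀ x : D → ℚ, (∀ d, x (ρ d) = x d) → ∑ d, x d * z d = 0) →
        ∃ p : D → ℚ, ∀ d, p (ρ d) = p d - z d ∧ p (ι d) = p d - z d := by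
  classical
  set φ := ι.trans ρ with hφ
  have hφ' : ∀ p : D → ℚ, p ∈ invariants φ ↔ ∀ d, p (ρ d) = p (ι d) := by
    intro p
    constructor
    · intro h d
      have := h (ι d)
      simpa [φ, hι] using this
    · intro h d
      simpa [φ, hι] using h (ι d)
  have hconst : finrank ℚ (Submodule.span ℚ {fun _ : D => (1 : ℚ)}) = 1 :=
    finrank_span_singleton (fun h => one_ne_zero (congrFun h (Classical.arbitrary D)))
  have hspan : ∀ f : D → ℚ, (∀ a b, f a = f b) → f ∈ Submodule.span ℚ {fun _ : D => (1 : ℚ)} := by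
    intro f hf
    rw [Submodule.mem_span_singleton]
    exact ⟨f (Classical.arbitrary D), by ext d; simp [hf d (Classical.arbitrary D)]⟩
  have hspan' : ∀ f ∈ Submodule.span ℚ {fun _ : D => (1 : ℚ)}, ∀ a b, f a = f b := by
    intro f hf a b
    obtain ⟨c, rfl⟩ := Submodule.mem_span_singleton.1 hf
    rfl
  -- `T` is the coboundary of functions on the vertices, that is, on the cycles of `ρ`. By
  -- transitivity only the constants are in its kernel there, so the image has dimension one less
  -- than the number of vertices.
  let T : (D → ℚ) →ₗ[ℚ] (D → ℚ) := LinearMap.id - LinearMap.funLeft ℚ ℚ ι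
  have hT : ∀ x d, T x d = x d - x (ι d) := fun x d => rfl
  have hTker : LinearMap.ker (T.domRestrict (invariants ρ)) =
      (Submodule.span ℚ {fun _ : D => (1 : ℚ)}).comap (invariants ρ).subtype := by
    ext x
    rw [LinearMap.mem_ker, Submodule.mem_comap]
    constructor
    · intro h
      refine hspan _ (htrans _ x.2 fun d => ?_)
      have := congrFun h d
      rw [LinearMap.domRestrict_apply, hT] at this
      exact (sub_eq_zero.1 this).symm
    · intro h
      ext d
      rw [LinearMap.domRestrict_apply, hT]
      simpa [sub_eq_zero] using hspan' _ h d (ι d)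
  have hU : finrank ℚ ((invariants ρ).map T) + 1 = numCycles ρ := by
    have h1 := LinearMap.finrank_range_add_finrank_ker (T.domRestrict (invariants ρ))
    rw [LinearMap.range_domRestrict, hTker, finrank_invariants] at h1
    have h2 : finrank ℚ ((Submodule.span ℚ {fun _ : D => (1 : ℚ)}).comap
        (invariants ρ).subtype) = 1 := by
      rw [← hconst]
      refine (Submodule.comapSubtypeEquivOfLe ?_).finrank_eq
      intro f hf d
      exact hspan' f hf _ _
    omega
  -- `K` turns out to consist of the functions `z` for which `z - z ∘ ι` obeys Kirchhoff's law.
  set K := (pairing D).orthogonal ((invariants ρ).map T) with hK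
  have hKdim := LinearMap.BilinForm.finrank_orthogonal (pairing_nondegenerate (D := D))
    ((invariants ρ).map T)
  rw [Module.finrank_fintype_fun_eq_card, card_eq_two_mul_numCycles hι hfix] at hKdim
  have hKle : finrank ℚ ((invariants ρ).map T) ≤ 2 * numCycles ι := by
    rw [← card_eq_two_mul_numCycles hι hfix, ← Module.finrank_fintype_fun_eq_card ℚ]
    exact Submodule.finrank_le _
  have hKmem : ∀ z, z ∈ K ↔ ∀ x ∈ invariants ρ, ∑ d, x d * (z d - z (ι d)) = 0 := by
    intro z
    rw [hK, LinearMap.BilinForm.mem_orthogonal_iff]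
    have : ∀ x : D → ℚ, pairing D (T x) z = ∑ d, x d * (z d - z (ι d)) := by
      intro x
      rw [pairing_apply]
      simp only [hT, sub_mul, mul_sub, Finset.sum_sub_distrib]
      congr 1
      rw [← sum_comp_perm ι]
      simp [hι]
    constructor
    · intro h x hx
      rw [← this]
      exact h _ (Submodule.mem_map_of_mem hx)
    · rintro h _ ⟨x, hx, rfl⟩
      exact (this x).trans (h x hx)
  -- Functions on the faces plus functions on the edges. They always lie in `K`, and since only the
  -- constants are of both kinds, the dimensions agree exactly if Euler's formula holds.
  set W := invariants φ ⊔ invariants ι with hW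
  have hWK : W ≤ K := by
    rw [hW, sup_le_iff]
    constructor
    · intro p hp
      rw [hKmem]
      intro x hx
      rw [hφ'] at hp
      simp only [mul_sub, Finset.sum_sub_distrib, ← hp]
      rw [sub_eq_zero, ← sum_comp_perm ρ (fun d => x d * p d)]
      simp only [mem_invariants.1 hx]
    · intro t ht
      rw [hKmem]
      intro x hx
      simp [mem_invariants.1 ht]
  have hinf : finrank ℚ (invariants φ ⊓ invariants ι : Submodule ℚ (D → ℚ)) = 1 := by
    suffices h : (invariants φ ⊓ invariants ι : Submodule ℚ (D → ℚ)) =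
        Submodule.span ℚ {fun _ : D => (1 : ℚ)} by rw [h, hconst]
    ext f
    constructor
    · rintro ⟨h1, h2⟩
      exact hspan f (htrans f (fun d => ((hφ' f).1 h1 d).trans (h2 d)) h2)
    · intro h
      exact ⟨fun d => hspan' f h _ _, fun d => hspan' f h _ _⟩
  have hWdim := Submodule.finrank_sup_add_finrank_inf_eq (invariants φ) (invariants ι)
  rw [hinf, finrank_invariants, finrank_invariants, ← hW] at hWdim
  have hiff : numCycles ρ + numCycles φ = numCycles ι + 2 ↔ finrank ℚ W = finrank ℚ K := by
    rw [hKdim]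
    omega
  rw [hiff]
  constructor
  · intro h z hz hx
    have hWK' : W = K := Submodule.eq_of_le_of_finrank_eq hWK h
    have hzK : z ∈ K := by
      rw [hKmem]
      intro x hxρ
      have := hx x hxρ
      simp only [hz]
      simp only [sub_neg_eq_add, mul_add, Finset.sum_add_distrib, this, add_zero]
    rw [← hWK', hW, Submodule.mem_sup] at hzK
    obtain ⟨p, hp, t, ht, hpt⟩ := hzK
    rw [hφ'] at hp
    have key : ∀ d, p (ι d) = p d - 2 * z d := by
      intro d
      have h1 := congrFun hpt d
      have h2 := congrFun hpt (ι d)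
      simp only [Pi.add_apply, hz, mem_invariants.1 ht] at h1 h2
      linarith
    -- The part of `z` that lives on the faces changes by `2 * z d` across `d`, as `z` is
    -- antisymmetric; hence the factor one half.
    refine ⟨fun d => p d / 2, fun d => ⟨?_, ?_⟩⟩
    · simp only [hp, key]; ring
    · simp only [key]; ring
  · intro h
    suffices W = K by rw [this]
    refine le_antisymm hWK fun z hz => ?_
    rw [hKmem] at hz
    -- The antisymmetrisation of `z` is a circulation. Subtracting its potential from `z` leaves a
    -- function on the edges.
    obtain ⟨p, hp⟩ := h (fun d => z d - z (ι d)) (fun d => by simp [hι]) (fun x hx => hz x hx)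
    rw [hW, Submodule.mem_sup]
    refine ⟨p, (hφ' p).2 fun d => (hp d).1.trans (hp d).2.symm, z - p, ?_, by simp⟩
    intro d
    have := (hp d).2
    simp only [Pi.sub_apply, this]
    ring

end PermInvariants

end

section

/-! ### Darts and potentials -/

section Potentials

variable {α β : Type*} {G H : Graph α β}

/-- The dart given by an edge with a chosen orientation. -/
def dartOf {e : β} {v u : α} (h : G.IsLink e v u) : Dart G := ⟨v, e, u, h⟩

@[simp] theorem dartOf_vertex {e : β} {v u : α} (h : G.IsLink e v u) : (dartOf h).vertex = v := rfl

@[simp] theorem dartOf_edge {e : β} {v u : α} (h : G.IsLink e v u) : (dartOf h).edge = e := rfl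

theorem dartOf_rev {e : β} {v u : α} (h : G.IsLink e v u) : (dartOf h).rev = dartOf h.symm :=
  Dart.ext ((dartOf h).inc.isLink_other.right_unique h) rfl

@[simp] theorem Dart.rev_edge (d : Dart G) : d.rev.edge = d.edge := rfl

@[simp] theorem Dart.rev_rev (d : Dart G) : d.rev.rev = d := Dart.rev_involutive G d

theorem Dart.isLink (d : Dart G) : G.IsLink d.edge d.vertex d.rev.vertex := d.inc.isLink_other

theorem Dart.rev_ne [G.Loopless] (d : Dart G) : d.rev ≠ d := fun h =>
  d.isLink.ne (congrArg Dart.vertex h).symm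

theorem Dart.eq_or_eq_rev {d d' : Dart G} (h : d.edge = d'.edge) : d = d' ∨ d = d'.rev := by
  have h1 := d.isLink
  rw [h] at h1
  rcases h1.left_eq_or_eq d'.isLink with h2 | h2
  · exact .inl (Dart.ext h2 h)
  · exact .inr (Dart.ext h2 h)

theorem Dart.finite (hV : V(G).Finite) (hE : E(G).Finite) : Finite (Dart G) := by
  have := hV.to_subtype
  have := hE.to_subtype
  refine Finite.of_injective
    (fun d : Dart G => ((⟨d.vertex, d.inc.vertex_mem⟩ : V(G)), (⟨d.edge, d.inc.edge_mem⟩ : E(G)))) ?_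
  intro d d' h
  simp only [Prod.mk.injEq, Subtype.mk.injEq] at h
  exact Dart.ext h.1 h.2

/-- Finite connected loopless graphs without isolated vertices. -/
structure IsFiniteConnected (G : Graph α β) : Prop where
  finite_vertexSet : V(G).Finite
  finite_edgeSet : E(G).Finite
  loopless : G.Loopless
  connected : G.toSimpleGraph.Connected
  exists_dart : ∀ v ∈ V(G), ∃ d : Dart G, d.vertex = v

theorem IsFiniteConnected.finite_dart (hG : IsFiniteConnected G) : Finite (Dart G) :=
  Dart.finite hG.finite_vertexSet hG.finite_edgeSet

theorem IsFiniteConnected.nonempty_dart (hG : IsFiniteConnected G) : Nonempty (Dart G) := by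
  obtain ⟨v⟩ := hG.connected.nonempty
  exact ⟨(hG.exists_dart v.1 v.2).choose⟩

/-- The permutation reversing all darts. -/
noncomputable def revPerm (G : Graph α β) : Equiv.Perm (Dart G) := (Dart.rev_involutive G).toPerm

@[simp] theorem revPerm_apply (d : Dart G) : revPerm G d = d.rev := rfl

theorem RotationSystem.face_apply (σ : RotationSystem G) (d : Dart G) :
    σ.face d = σ.rot d.rev := rfl

theorem RotationSystem.vertex_eq_of_sameCycle (σ : RotationSystem G) {d d' : Dart G}
    (h : σ.rot.SameCycle d d') : d.vertex = d'.vertex :=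
  eq_of_sameCycle (f := Dart.vertex) σ.vertex_rot h

theorem RotationSystem.vertex_pow (σ : RotationSystem G) (n : ℕ) (d : Dart G) :
    ((σ.rot ^ n) d).vertex = d.vertex :=
  (σ.vertex_eq_of_sameCycle ⟨n, by simp⟩).symm

theorem numCycles_rot (hG : IsFiniteConnected G) (σ : RotationSystem G) :
    numCycles σ.rot = V(G).ncard := by
  rw [← Nat.card_coe_set_eq, numCycles]
  refine Nat.card_congr (Equiv.ofBijective (Quotient.lift
    (fun d : Dart G => (⟨d.vertex, d.inc.vertex_mem⟩ : V(G)))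
    fun a b h => Subtype.ext (σ.vertex_eq_of_sameCycle h)) ⟨?_, ?_⟩)
  · rintro ⟨a⟩ ⟨b⟩ h
    exact Quotient.sound (s := Equiv.Perm.SameCycle.setoid σ.rot)
      (σ.sameCycle a b (congrArg Subtype.val h))
  · rintro ⟨v, hv⟩
    obtain ⟨d, rfl⟩ := hG.exists_dart v hv
    exact ⟨Quotient.mk _ d, rfl⟩

theorem numCycles_revPerm (G : Graph α β) : numCycles (revPerm G) = E(G).ncard := by
  rw [← Nat.card_coe_set_eq, numCycles]
  refine Nat.card_congr (Equiv.ofBijective (Quotient.lift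
    (fun d : Dart G => (⟨d.edge, d.inc.edge_mem⟩ : E(G)))
    fun a b h => Subtype.ext (eq_of_sameCycle (π := revPerm G) (f := Dart.edge)
      (fun d => rfl) h)) ⟨?_, ?_⟩)
  · rintro ⟨a⟩ ⟨b⟩ h
    apply Quotient.sound (s := Equiv.Perm.SameCycle.setoid (revPerm G))
    rcases Dart.eq_or_eq_rev (congrArg Subtype.val h : a.edge = b.edge) with rfl | rfl
    · exact Equiv.Perm.SameCycle.refl _ _
    · exact Equiv.Perm.sameCycle_apply_left.2 (Equiv.Perm.SameCycle.refl (revPerm G) b)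
  · rintro ⟨e, he⟩
    obtain ⟨x, y, h⟩ := Graph.exists_isLink_of_mem_edgeSet he
    exact ⟨Quotient.mk _ (dartOf h), rfl⟩

theorem eq_of_invariant (hG : IsFiniteConnected G) (σ : RotationSystem G) {X : Type*}
    {f : Dart G → X} (hrot : ∀ d, f (σ.rot d) = f d) (hrev : ∀ d, f d.rev = f d) (a b : Dart G) :
    f a = f b := by
  have hloc : ∀ d d' : Dart G, d.vertex = d'.vertex → f d = f d' := fun d d' h =>
    eq_of_sameCycle hrot (σ.sameCycle d d' h)
  have key : ∀ u v : V(G), G.toSimpleGraph.Walk u v → ∀ d d' : Dart G,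
      d.vertex = u.1 → d'.vertex = v.1 → f d = f d' := by
    intro u v w
    induction w with
    | nil => intro d d' h h'; exact hloc _ _ (h.trans h'.symm)
    | cons hadj _ ih =>
      intro d d' h h'
      obtain ⟨-, e, he⟩ := hadj
      rw [hloc d (dartOf he) h, ← hrev, dartOf_rev]
      exact ih _ _ rfl h'
  obtain ⟨w⟩ := hG.connected.preconnected ⟨a.vertex, a.inc.vertex_mem⟩ ⟨b.vertex, b.inc.vertex_mem⟩
  exact key _ _ w a b rfl rfl

/-- Antisymmetric functions on the darts that satisfy Kirchhoff's law, in weighted form. -/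
structure IsCirculation (z : Dart G → ℚ) : Prop where
  antisymm : ∀ d, z d.rev = -z d
  kirchhoff : ∀ x : α → ℚ, ∑ᶠ d : Dart G, x d.vertex * z d = 0

/-- A potential of `z`: a function on the faces, each dart standing for the face at its right, that
drops by `z d` when the dart `d` is crossed. -/
def RotationSystem.IsPotential (σ : RotationSystem G) (z p : Dart G → ℚ) : Prop :=
  ∀ d, p (σ.rot d) = p d - z d ∧ p d.rev = p d - z d

/-- Every circulation supported in `S` has a potential. -/
def RotationSystem.HasPotentialsOn (σ : RotationSystem G) (S : Set β) : Prop :=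
  ∀ z : Dart G → ℚ, IsCirculation z → (∀ d, d.edge ∉ S → z d = 0) → ∃ p, σ.IsPotential z p

/-- From here on, the sphere is used only through the existence of potentials. Connectedness
supplies the transitivity required by `euler_iff_potential`. -/
theorem RotationSystem.euler_iff (hG : IsFiniteConnected G) (σ : RotationSystem G) :
    (V(G).ncard : ℤ) - (E(G).ncard : ℤ) + (σ.numFaces : ℤ) = 2 ↔ σ.HasPotentialsOn Set.univ := by
  have := hG.finite_dart
  have := Fintype.ofFinite (Dart G)
  have := hG.nonempty_dart
  have := hG.loopless
  have h := euler_iff_potential (ρ := σ.rot) (ι := revPerm G) Dart.rev_rev Dart.rev_ne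
    (fun f h1 h2 a b => eq_of_invariant hG σ h1 h2 a b)
  rw [numCycles_rot hG, numCycles_revPerm] at h
  have hf : numCycles ((revPerm G).trans σ.rot) = σ.numFaces := rfl
  rw [hf] at h
  have h' : (V(G).ncard : ℤ) - (E(G).ncard : ℤ) + (σ.numFaces : ℤ) = 2 ↔
    V(G).ncard + σ.numFaces = E(G).ncard + 2 := by omega
  rw [h', h]
  constructor
  · intro h z hz _
    refine h z hz.antisymm fun x hx => ?_
    classical
    -- A function invariant under the rotation depends on the vertex only. The value 0 at vertices
    -- without darts is irrelevant.
    let y : α → ℚ := fun v => if hv : ∃ d : Dart G, d.vertex = v then x hv.choose else 0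
    have hy : ∀ d : Dart G, y d.vertex = x d := by
      intro d
      have hv : ∃ d' : Dart G, d'.vertex = d.vertex := ⟨d, rfl⟩
      simp only [y, dif_pos hv]
      exact eq_of_sameCycle hx (σ.sameCycle _ _ hv.choose_spec)
    have := hz.kirchhoff y
    rw [finsum_eq_sum_of_fintype] at this
    simpa only [hy] using this
  · intro h z hz hx
    refine h z ⟨hz, fun x => ?_⟩ (fun d hd => absurd trivial hd)
    rw [finsum_eq_sum_of_fintype]
    exact hx (fun d => x d.vertex) fun d => by rw [σ.vertex_rot]

theorem IsCirculation.sub {z w : Dart G → ℚ} [Finite (Dart G)] (hz : IsCirculation z)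
    (hw : IsCirculation w) : IsCirculation (z - w) := by
  have := Fintype.ofFinite (Dart G)
  refine ⟨fun d => by simp [hz.antisymm, hw.antisymm]; ring, fun x => ?_⟩
  have h1 := hz.kirchhoff x
  have h2 := hw.kirchhoff x
  rw [finsum_eq_sum_of_fintype] at *
  simp [mul_sub, Finset.sum_sub_distrib, h1, h2]

theorem IsCirculation.smul {z : Dart G → ℚ} [Finite (Dart G)] (hz : IsCirculation z)
    (c : ℚ) : IsCirculation (c • z) := by
  have := Fintype.ofFinite (Dart G)
  refine ⟨fun d => by simp [hz.antisymm], fun x => ?_⟩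
  have h1 := hz.kirchhoff x
  rw [finsum_eq_sum_of_fintype] at *
  simp only [Pi.smul_apply, smul_eq_mul, mul_left_comm _ c, ← Finset.mul_sum, h1, mul_zero]

/-- Around a vertex the sum telescopes, since the value subtracted at `d` is the value added at the
next dart. -/
theorem isCirculation_of_face [Finite (Dart G)] (σ : RotationSystem G) {p : Dart G → ℚ}
    (hp : ∀ d, p (σ.rot d) = p d.rev) : IsCirculation fun d => p d - p d.rev := by
  have := Fintype.ofFinite (Dart G)
  refine ⟨fun d => by simp, fun x => ?_⟩
  rw [finsum_eq_sum_of_fintype]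
  simp only [mul_sub, Finset.sum_sub_distrib, ← hp]
  rw [sub_eq_zero, ← sum_comp_perm σ.rot (fun d => x d.vertex * p d)]
  simp only [σ.vertex_rot]

/-- Kirchhoff's law at the vertex of `d` has only one term left. -/
theorem IsCirculation.eq_zero_of_pendant [Finite (Dart G)] {z : Dart G → ℚ} (hz : IsCirculation z)
    {d : Dart G} (hd : ∀ d', d'.vertex = d.vertex → d' ≠ d → z d' = 0) : z d = 0 := by
  classical
  have := Fintype.ofFinite (Dart G)
  have h := hz.kirchhoff fun v => if v = d.vertex then 1 else 0
  rw [finsum_eq_sum_of_fintype, Finset.sum_eq_single d] at h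
  · simpa using h
  · intro d' _ hne
    by_cases hv : d'.vertex = d.vertex
    · simp [hd d' hv hne]
    · simp [hv]
  · simp

namespace RotationSystem

theorem hasPotentialsOn_empty (σ : RotationSystem G) : σ.HasPotentialsOn ∅ := by
  intro z _ hz
  exact ⟨0, fun d => by simp [hz d]⟩

/-- A circulation supported in `S ∪ N` vanishes on `N`, because every edge there has an end at which
it is the only edge of the support. This step admits the edges of a spanning tree. -/
theorem HasPotentialsOn.pendant [Finite (Dart G)] {σ : RotationSystem G} {S : Set β}
    (h : σ.HasPotentialsOn S) (N : Set β)
    (hN : ∀ e ∈ N, ∀ d : Dart G, d.edge = e → ∃ d : Dart G, d.edge = e ∧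
      ∀ d' : Dart G, d'.vertex = d.vertex → d'.edge ∈ S ∪ N → d'.edge = e) :
    σ.HasPotentialsOn (S ∪ N) := by
  intro z hz hz0
  refine h z hz fun d hd => ?_
  by_cases hdN : d.edge ∈ N
  · obtain ⟨d₁, h1, h2⟩ := hN _ hdN d rfl
    have h3 : z d₁ = 0 := by
      refine hz.eq_zero_of_pendant fun d' hv hne => hz0 _ fun hmem => hne ?_
      exact Dart.ext hv ((h2 d' hv hmem).trans h1.symm)
    rcases Dart.eq_or_eq_rev h1 with rfl | rfl
    · exact h3
    · rw [hz.antisymm] at h3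
      simpa using h3
  · exact hz0 d fun h => h.elim hd hdN

/-- A set of darts that is a union of faces. -/
def IsFaceSet (σ : RotationSystem G) (D : Set (Dart G)) : Prop :=
  ∀ d, σ.rot d ∈ D ↔ d.rev ∈ D

/-- The boundary of `D` is a circulation with value 1 at `d₀`, supported in `S` and `e`, and the
indicator function of `D` is a potential of it. Subtracting a multiple of it moves the support of
any circulation into `S`. -/
theorem HasPotentialsOn.insert [Finite (Dart G)] {σ : RotationSystem G} {S : Set β}
    (h : σ.HasPotentialsOn S) {e : β} {D : Set (Dart G)} (hD : σ.IsFaceSet D)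
    (hbd : ∀ d : Dart G, d.edge ∉ S → d.edge ≠ e → (d ∈ D ↔ d.rev ∈ D))
    {d₀ : Dart G} (h₀ : d₀.edge = e) (h₁ : d₀ ∈ D) (h₂ : d₀.rev ∉ D) :
    σ.HasPotentialsOn (insert e S) := by
  classical
  intro z hz hz0
  let p₀ : Dart G → ℚ := fun d => if d ∈ D then 1 else 0
  have hp₀ : ∀ d, p₀ (σ.rot d) = p₀ d.rev := fun d => by simp only [p₀, hD d]
  have hc := isCirculation_of_face σ hp₀
  obtain ⟨p, hp⟩ := h (z - z d₀ • fun d => p₀ d - p₀ d.rev) (hz.sub (hc.smul _)) (by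
    intro d hd
    by_cases hde : d.edge = e
    · rcases Dart.eq_or_eq_rev (hde.trans h₀.symm) with rfl | rfl
      · simp [p₀, h₁, h₂]
      · simp [p₀, h₁, h₂, hz.antisymm]
    · have h1 : z d = 0 := hz0 d fun h => h.elim hde hd
      simp [h1, p₀, hbd d hd hde])
  refine ⟨fun d => p d + z d₀ * p₀ d, fun d => ?_⟩
  have h1 := (hp d).1
  have h2 := (hp d).2
  simp only [Pi.sub_apply, Pi.smul_apply, smul_eq_mul] at h1 h2
  refine ⟨?_, ?_⟩
  · simp only [h1, hp₀]; ring
  · simp only [h2]; ring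

theorem HasPotentialsOn.mono {σ : RotationSystem G} {S T : Set β}
    (h : σ.HasPotentialsOn T) (hST : ∀ e ∈ S, e ∈ E(G) → e ∈ T) : σ.HasPotentialsOn S :=
  fun z hz h0 => h z hz fun d hd => h0 d fun hS => hd (hST _ hS d.inc.edge_mem)

/-- The edges are inserted one by one. As the boundary of `D e` contains no edge outside of `S`
except `e`, the order does not matter. -/
theorem HasPotentialsOn.union [Finite (Dart G)] {σ : RotationSystem G} {S : Set β}
    (h : σ.HasPotentialsOn S) (N : Set β) (D : β → Set (Dart G))
    (hD : ∀ e ∈ N, e ∈ E(G) → σ.IsFaceSet (D e))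
    (hbd : ∀ e ∈ N, e ∈ E(G) → ∀ d : Dart G, d.edge ∉ S → d.edge ≠ e → (d ∈ D e ↔ d.rev ∈ D e))
    (hsep : ∀ e ∈ N, e ∈ E(G) → ∃ d : Dart G, d.edge = e ∧ d ∈ D e ∧ d.rev ∉ D e) :
    σ.HasPotentialsOn (S ∪ N) := by
  have hE : E(G).Finite := by
    have : E(G) = Set.range (Dart.edge : Dart G → β) := by
      ext e
      constructor
      · intro he
        obtain ⟨x, y, h⟩ := Graph.exists_isLink_of_mem_edgeSet he
        exact ⟨dartOf h, rfl⟩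
      · rintro ⟨d, rfl⟩
        exact d.inc.edge_mem
    rw [this]
    exact Set.finite_range _
  have key : ∀ M : Set β, M.Finite → M ⊆ N ∩ E(G) → σ.HasPotentialsOn (S ∪ M) := by
    intro M hM
    induction M, hM using Set.Finite.induction_on with
    | empty => intro _; simpa using h
    | @insert e M _ _ ih =>
      intro hsub
      have heN := hsub (Set.mem_insert e M)
      obtain ⟨d, h1, h2, h3⟩ := hsep e heN.1 heN.2
      rw [Set.union_insert]
      exact (ih ((Set.subset_insert e M).trans hsub)).insert (hD e heN.1 heN.2)
        (fun d' hd' hne => hbd e heN.1 heN.2 d' (fun h => hd' (.inl h)) hne) h1 h2 h3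
  refine (key (N ∩ E(G)) (hE.subset Set.inter_subset_right) subset_rfl).mono ?_
  rintro e (h | h) he
  · exact .inl h
  · exact .inr ⟨h, he⟩

end RotationSystem

end Potentials

end

section

/-! ### Subgraphs and induced rotation systems -/

section Induced

variable {α β : Type*} {G H : Graph α β}

/-- The inclusion of a subgraph. -/
def Mono.ofLE (h : H ≤ G) : Mono H G where
  onV := id
  onE := id
  onV_mem _ hx := h.1 hx
  onV_inj := Set.injOn_id _
  onE_inj := Set.injOn_id _
  isLink _ _ _ hl := hl.mono h

@[simp] theorem Mono.ofLE_vertex (h : H ≤ G) (d : Dart H) :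
    ((Mono.ofLE h).onDart d).vertex = d.vertex := rfl

@[simp] theorem Mono.ofLE_edge (h : H ≤ G) (d : Dart H) :
    ((Mono.ofLE h).onDart d).edge = d.edge := rfl

theorem Mono.onDart_injective {α' β' : Type*} {G : Graph α' β'} (f : Mono H G) :
    Function.Injective f.onDart := by
  intro d d' h
  have h1 := congrArg Dart.vertex h
  have h2 := congrArg Dart.edge h
  exact Dart.ext (f.onV_inj d.inc.vertex_mem d'.inc.vertex_mem h1)
    (f.onE_inj d.inc.edge_mem d'.inc.edge_mem h2)

theorem Mono.onDart_rev {α' β' : Type*} {G : Graph α' β'} (f : Mono H G) (d : Dart H) :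
    f.onDart d.rev = (f.onDart d).rev := by
  have h : G.IsLink (f.onE d.edge) (f.onV d.vertex) (f.onV d.rev.vertex) := f.isLink _ _ _ d.isLink
  have : f.onDart d = dartOf h := rfl
  rw [this, dartOf_rev]
  rfl

theorem Mono.mem_range_onDart_ofLE (h : H ≤ G) (d : Dart G) :
    d ∈ Set.range (Mono.ofLE h).onDart ↔ d.edge ∈ E(H) := by
  constructor
  · rintro ⟨d, rfl⟩
    exact d.inc.edge_mem
  · intro he
    exact ⟨⟨d.vertex, d.edge, _, (h.isLink_iff he).2 d.isLink⟩, rfl⟩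

/-- Along `f`, the rotation system `τ` is the one induced by `σ`. -/
def Mono.InducesRot {α' β' : Type*} {G : Graph α' β'} (f : Mono H G) (σ : RotationSystem G)
    (τ : RotationSystem H) : Prop :=
  ∀ d : Dart H, ∃ k : ℕ,
    f.onDart (τ.rot d) = (σ.rot ^ (k + 1)) (f.onDart d) ∧
      ∀ j < k, (σ.rot ^ (j + 1)) (f.onDart d) ∉ Set.range f.onDart

theorem isCirculation_extend [Finite (Dart G)] (h : H ≤ G) {z : Dart H → ℚ}
    (hz : IsCirculation z) :
    IsCirculation (Function.extend (Mono.ofLE h).onDart z 0 : Dart G → ℚ) := by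
  have hinj := (Mono.ofLE h).onDart_injective
  have := Finite.of_injective _ hinj
  have := Fintype.ofFinite (Dart G)
  have := Fintype.ofFinite (Dart H)
  constructor
  · intro d
    by_cases hd : d ∈ Set.range (Mono.ofLE h).onDart
    · obtain ⟨d, rfl⟩ := hd
      rw [← Mono.onDart_rev, hinj.extend_apply, hinj.extend_apply, hz.antisymm]
    · rw [Function.extend_apply' _ _ _ hd, Function.extend_apply']
      · simp
      · intro hd'
        rw [← Set.mem_range, Mono.mem_range_onDart_ofLE] at hd'
        rw [Mono.mem_range_onDart_ofLE] at hd
        exact hd hd'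
  · intro x
    have h1 := hz.kirchhoff x
    rw [finsum_eq_sum_of_fintype] at h1 ⊢
    rw [← h1]
    symm
    refine Fintype.sum_of_injective _ hinj _ _ (fun d hd => ?_) fun d => ?_
    · rw [Function.extend_apply' _ _ _ hd]; simp
    · rw [hinj.extend_apply]; rfl

theorem isCirculation_restrict [Finite (Dart G)] (h : H ≤ G) {z : Dart G → ℚ}
    (hz : IsCirculation z) (h0 : ∀ d, d.edge ∉ E(H) → z d = 0) :
    IsCirculation fun d => z ((Mono.ofLE h).onDart d) := by
  have hinj := (Mono.ofLE h).onDart_injective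
  have := Finite.of_injective _ hinj
  have := Fintype.ofFinite (Dart G)
  have := Fintype.ofFinite (Dart H)
  constructor
  · intro d
    rw [Mono.onDart_rev, hz.antisymm]
  · intro x
    have h1 := hz.kirchhoff x
    rw [finsum_eq_sum_of_fintype] at h1 ⊢
    rw [← h1]
    refine Fintype.sum_of_injective _ hinj _ _ (fun d hd => ?_) fun d => rfl
    rw [Mono.mem_range_onDart_ofLE] at hd
    rw [h0 d hd, mul_zero]

theorem RotationSystem.IsPotential.pow_apply {σ : RotationSystem G} {z p : Dart G → ℚ}
    (hp : σ.IsPotential z p) (d : Dart G) (k : ℕ)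
    (hz : ∀ j < k, z ((σ.rot ^ (j + 1)) d) = 0) :
    p ((σ.rot ^ (k + 1)) d) = p d - z d := by
  induction k with
  | zero => simpa using (hp d).1
  | succ k ih =>
    rw [pow_succ', Equiv.Perm.mul_apply, (hp _).1, ih fun j hj => hz j (by omega),
      hz k (by omega), sub_zero]

/-- A circulation extends to `G` by zero. Its potential there does not change at the darts which the
induced rotation skips, so its restriction is a potential for `τ`. -/
theorem RotationSystem.HasPotentialsOn.of_induces [Finite (Dart G)] (h : H ≤ G)
    {σ : RotationSystem G} {τ : RotationSystem H} (hσ : σ.HasPotentialsOn Set.univ)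
    (hind : (Mono.ofLE h).InducesRot σ τ) : τ.HasPotentialsOn Set.univ := by
  intro z hz _
  have hinj := (Mono.ofLE h).onDart_injective
  obtain ⟨p, hp⟩ := hσ _ (isCirculation_extend h hz) (fun d hd => absurd trivial hd)
  refine ⟨fun d => p ((Mono.ofLE h).onDart d), fun d => ?_⟩
  have hd := hp ((Mono.ofLE h).onDart d)
  rw [hinj.extend_apply, ← Mono.onDart_rev] at hd
  refine ⟨?_, hd.2⟩
  obtain ⟨k, h1, h2⟩ := hind d
  have h3 := hp.pow_apply _ k fun j hj => Function.extend_apply' _ _ _ (h2 j hj)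
  rw [hinj.extend_apply] at h3
  simp only [h1, h3]

/-- If the potentials of a connected spanning subgraph are extended along the rotations, and every
further edge bounds a union of faces meeting no other further edge, then the extension is a
potential of the whole graph. -/
theorem RotationSystem.HasPotentialsOn.of_subgraph [Finite (Dart G)] [G.Loopless] (h : H ≤ G)
    {σ : RotationSystem G} {τ : RotationSystem H} (hτ : τ.HasPotentialsOn Set.univ)
    (hind : (Mono.ofLE h).InducesRot σ τ)
    (hcover : ∀ d : Dart G, ∃ d' : Dart H, d'.vertex = d.vertex)
    (D : β → Set (Dart G)) (hD : ∀ e ∈ E(G), e ∉ E(H) → σ.IsFaceSet (D e))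
    (hbd : ∀ e ∈ E(G), e ∉ E(H) → ∀ d : Dart G, d.edge ∉ E(H) → d.edge ≠ e →
      (d ∈ D e ↔ d.rev ∈ D e))
    (hsep : ∀ e ∈ E(G), e ∉ E(H) → ∃ d : Dart G, d.edge = e ∧ d ∈ D e ∧ d.rev ∉ D e) :
    σ.HasPotentialsOn E(H) := by
  classical
  intro z hz h0
  have := Fintype.ofFinite (Dart G)
  set f := (Mono.ofLE h).onDart with hf
  have hinj : Function.Injective f := (Mono.ofLE h).onDart_injective
  obtain ⟨p, hp⟩ := hτ _ (isCirculation_restrict h hz h0) (fun d hd => absurd trivial hd)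
  have hex : ∀ d : Dart G, ∃ k : ℕ, (σ.rot ^ k) d ∈ Set.range f := by
    intro d
    obtain ⟨d', hd'⟩ := hcover d
    obtain ⟨k, hk⟩ := (σ.sameCycle d (f d') hd'.symm).exists_nat_pow_eq
    exact ⟨k, d', hk.symm⟩
  -- The value at a dart is taken from the first dart of `H` met from there on in the rotation. This
  -- makes `q` correct around every vertex, but crossing an edge outside of `H` remains to be
  -- checked.
  let q : Dart G → ℚ := fun d => p (Nat.find_spec (hex d)).choose
  have hq : ∀ (d : Dart G) (k : ℕ) (y : Dart H), (σ.rot ^ k) d = f y →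
      (∀ j < k, (σ.rot ^ j) d ∉ Set.range f) → q d = p y := by
    intro d k y hy hj
    have hk : Nat.find (hex d) = k := (Nat.find_eq_iff _).2 ⟨⟨y, hy.symm⟩, hj⟩
    have := (Nat.find_spec (hex d)).choose_spec
    simp only [q]
    congr 1
    apply hinj
    rw [this, ← hy, hk]
  have hqf : ∀ y, q (f y) = p y := fun y => hq _ 0 y rfl (by simp)
  have hqrot : ∀ d, q (σ.rot d) = q d - z d := by
    intro d
    by_cases hd : d ∈ Set.range f
    · obtain ⟨y, rfl⟩ := hd
      obtain ⟨k, h1, h2⟩ := hind y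
      rw [hqf, hq _ k (τ.rot y) _ _]
      · exact (hp y).1
      · rw [hf, h1, pow_succ, Equiv.Perm.mul_apply]
      · intro j hj
        have := h2 j hj
        rwa [pow_succ, Equiv.Perm.mul_apply] at this
    · have hz0 : z d = 0 := h0 d (by rwa [hf, Mono.mem_range_onDart_ofLE] at hd)
      rw [hz0, sub_zero]
      obtain ⟨y, hy⟩ := Nat.find_spec (hex d)
      have hpos : Nat.find (hex d) ≠ 0 := by
        intro h
        rw [h] at hy
        exact hd ⟨y, hy⟩
      obtain ⟨k, hk⟩ := Nat.exists_eq_succ_of_ne_zero hpos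
      rw [hq d _ y hy.symm fun j hj => Nat.find_min (hex d) hj]
      refine hq _ k y ?_ fun j hj => ?_
      · rw [hy, hk, Nat.succ_eq_add_one, pow_succ, Equiv.Perm.mul_apply]
      · have := Nat.find_min (hex d) (m := j + 1) (by omega)
        rwa [pow_succ, Equiv.Perm.mul_apply] at this
  -- The error of `q` in crossing an edge: it is antisymmetric and vanishes on the edges of `H`.
  let δ : Dart G → ℚ := fun d => q d - z d - q d.rev
  have hδrev : ∀ d, δ d.rev = -δ d := by
    intro d
    simp only [δ, hz.antisymm, Dart.rev_rev]
    ring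
  have hδH : ∀ d : Dart G, d.edge ∈ E(H) → δ d = 0 := by
    intro d hd
    rw [← Mono.mem_range_onDart_ofLE h] at hd
    obtain ⟨y, rfl⟩ := hd
    have h1 : ((Mono.ofLE h).onDart y).rev = f y.rev := (Mono.onDart_rev _ y).symm
    simp only [δ, h1]
    change q (f y) - _ - _ = 0
    rw [hqf, hqf, (hp y).2]
    ring
  have hδ : ∀ d, δ d = 0 := by
    -- The errors along the boundary of a union of faces sum to zero, because `q` is correct around
    -- vertices. Only the edge of `d` can contribute to the sum, and its two darts contribute the
    -- same amount.
    have main : ∀ d : Dart G, ∀ D : Set (Dart G), σ.IsFaceSet D →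
        (∀ d' : Dart G, d'.edge ∉ E(H) → d'.edge ≠ d.edge → (d' ∈ D ↔ d'.rev ∈ D)) →
        d ∈ D → d.rev ∉ D → δ d = 0 := by
      intro d D hD hbd h1 h2
      let c : Dart G → ℚ := fun x => if x ∈ D then 1 else 0
      have hc : ∀ x, c (σ.rot x) = c x.rev := fun x => by simp only [c, hD x]
      have hs : ∑ x, c x * δ x = 0 := by
        have e1 : ∑ x, c x * q x = ∑ x, c x.rev * (q x - z x) := by
          rw [← sum_comp_perm σ.rot]
          simp only [hc, hqrot]
        have e2 : ∑ x, c x.rev * (q x - z x) = ∑ x, c x * (q x.rev + z x) := by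
          rw [← sum_comp_perm (revPerm G)]
          simp only [revPerm_apply, Dart.rev_rev, hz.antisymm, sub_neg_eq_add]
        rw [e2, ← sub_eq_zero, ← Finset.sum_sub_distrib] at e1
        rw [← e1]
        refine Finset.sum_congr rfl fun x _ => ?_
        simp only [δ]; ring
      have hs2 : ∑ x, (c x - c x.rev) * δ x = 0 := by
        have e1 : ∑ x, c x.rev * δ x = - ∑ x, c x * δ x := by
          rw [← sum_comp_perm (revPerm G), ← Finset.sum_neg_distrib]
          simp only [revPerm_apply, Dart.rev_rev, hδrev, mul_neg]
        simp only [sub_mul, Finset.sum_sub_distrib, e1, hs]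
        simp
      have hne : d.rev ≠ d := d.rev_ne
      rw [← Finset.sum_subset (Finset.subset_univ {d, d.rev}), Finset.sum_pair hne.symm] at hs2
      · simp only [c, h1, h2, if_true, if_false, Dart.rev_rev, hδrev] at hs2
        linarith
      · intro x _ hx
        simp only [Finset.mem_insert, Finset.mem_singleton, not_or] at hx
        by_cases hxH : x.edge ∈ E(H)
        · rw [hδH x hxH, mul_zero]
        · have : x.edge ≠ d.edge := fun h => (Dart.eq_or_eq_rev h).elim hx.1 hx.2
          simp [c, hbd x hxH this]
    intro d
    by_cases hd : d.edge ∈ E(H)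
    · exact hδH d hd
    · obtain ⟨d₁, h1, h2, h3⟩ := hsep _ d.inc.edge_mem hd
      have := main d₁ (D d.edge) (hD _ d.inc.edge_mem hd)
        (fun d' h4 h5 => hbd _ d.inc.edge_mem hd d' h4 (h1 ▸ h5)) h2 h3
      rcases Dart.eq_or_eq_rev h1 with rfl | rfl
      · exact this
      · simpa [hδrev] using this
  refine ⟨q, fun d => ⟨hqrot d, ?_⟩⟩
  have := hδ d
  simp only [δ] at this
  linarith

end Induced

end

section

/-! ### Cyclic orders of permutations -/

section CyclicOrder

variable {D D' : Type*} {π : Equiv.Perm D}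

/-- The number of steps that a permutation takes from `a` to `b`. -/
noncomputable def steps (π : Equiv.Perm D) (a b : D) : ℕ := sInf {n | (π ^ n) a = b}

/-- On its way around a cycle, the permutation meets `a`, `b`, `c` in this order. -/
def CyclicOrd (π : Equiv.Perm D) (a b c : D) : Prop :=
  a ≠ b ∧ π.SameCycle a b ∧ π.SameCycle a c ∧ steps π a b < steps π a c

theorem pow_steps [Finite D] {a b : D} (h : π.SameCycle a b) : (π ^ steps π a b) a = b := by
  have : {n : ℕ | (π ^ n) a = b}.Nonempty := h.exists_nat_pow_eq
  exact Nat.sInf_mem this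

theorem steps_le {a b : D} {n : ℕ} (h : (π ^ n) a = b) : steps π a b ≤ n := Nat.sInf_le h

theorem steps_self (a : D) : steps π a a = 0 := Nat.le_zero.1 (steps_le rfl)

theorem pow_add_apply (a : D) (m n : ℕ) : (π ^ (m + n)) a = (π ^ m) ((π ^ n) a) := by
  rw [pow_add, Equiv.Perm.mul_apply]

theorem sameCycle_of_pow {a b : D} {n : ℕ} (h : (π ^ n) a = b) : π.SameCycle a b :=
  ⟨n, by rw [zpow_natCast]; exact h⟩

theorem pow_sub_apply {a b c : D} {m n : ℕ} (hb : (π ^ n) a = b) (hc : (π ^ m) a = c)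
    (h : n ≤ m) : (π ^ (m - n)) b = c := by
  rw [← hb, ← pow_add_apply, Nat.sub_add_cancel h, hc]

theorem CyclicOrd.asymm {a b c : D} (h : CyclicOrd π a b c) (h' : CyclicOrd π a c b) : False :=
  lt_asymm h.2.2.2 h'.2.2.2

theorem CyclicOrd.trans {a b c d : D} (h : CyclicOrd π a b c) (h' : CyclicOrd π a c d) :
    CyclicOrd π a b d := ⟨h.1, h.2.1, h'.2.2.1, h.2.2.2.trans h'.2.2.2⟩

theorem CyclicOrd.total [Finite D] {a b c : D} (hab : π.SameCycle a b) (hac : π.SameCycle a c)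
    (h1 : a ≠ b) (h2 : a ≠ c) (h3 : b ≠ c) : CyclicOrd π a b c ∨ CyclicOrd π a c b := by
  rcases lt_trichotomy (steps π a b) (steps π a c) with h | h | h
  · exact .inl ⟨h1, hab, hac, h⟩
  · refine absurd ?_ h3
    rw [← pow_steps hab, h, pow_steps hac]
  · exact .inr ⟨h2, hac, hab, h⟩

theorem CyclicOrd.rotate [Finite D] {a b c : D} (h : CyclicOrd π a b c) : CyclicOrd π b c a := by
  obtain ⟨hne, hab, hac, hlt⟩ := h
  have hb := pow_steps hab
  have hc := pow_steps hac
  have hbc : (π ^ (steps π a c - steps π a b)) b = c := pow_sub_apply hb hc hlt.le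
  refine ⟨?_, hab.symm.trans hac, hab.symm, lt_of_le_of_lt (steps_le hbc) ?_⟩
  · intro h
    rw [h] at hlt
    exact lt_irrefl _ hlt
  · by_contra! hle
    -- Otherwise the cycle would close up no later than it reaches `c`, and then `c` could be
    -- reached from `a` in fewer steps.
    have ha : (π ^ (steps π b a + steps π a b)) a = a := by
      rw [pow_add_apply, hb, pow_steps hab.symm]
    have hpos : 0 < steps π a b := Nat.pos_of_ne_zero fun h0 => hne (by simpa [h0] using hb)
    have := steps_le (pow_sub_apply ha hc (by omega))
    omega

theorem CyclicOrd.ne₁₂ {a b c : D} (h : CyclicOrd π a b c) : a ≠ b := h.1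

theorem CyclicOrd.ne₁₃ {a b c : D} (h : CyclicOrd π a b c) : a ≠ c := by
  rintro rfl
  have := h.2.2.2
  rw [steps_self] at this
  omega

theorem CyclicOrd.ne₂₃ {a b c : D} (h : CyclicOrd π a b c) : b ≠ c := by
  rintro rfl
  exact lt_irrefl _ h.2.2.2

theorem CyclicOrd.apply [Finite D] {a c : D} (hac : π.SameCycle a c) (h1 : a ≠ π a) (h2 : a ≠ c)
    (h3 : π a ≠ c) : CyclicOrd π a (π a) c := by
  refine ⟨h1, Equiv.Perm.sameCycle_apply_right.2 (Equiv.Perm.SameCycle.refl _ _), hac,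
    lt_of_le_of_lt (steps_le (n := 1) rfl) ?_⟩
  have := pow_steps hac
  by_contra! hle
  interval_cases h : steps π a c
  · exact h2 this
  · exact h3 this

/-- An injection that conjugates `ρ` to the first-return map of `π` preserves cyclic orders. -/
theorem cyclicOrd_iff_of_firstReturn [Finite D] [Finite D'] {ρ : Equiv.Perm D'} {f : D' → D}
    (hf : Function.Injective f) (h : ∀ d, ∃ k : ℕ, f (ρ d) = (π ^ (k + 1)) (f d) ∧
      ∀ j < k, (π ^ (j + 1)) (f d) ∉ Set.range f) (a b c : D')
    (hab : ρ.SameCycle a b) (hac : ρ.SameCycle a c) :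
    CyclicOrd π (f a) (f b) (f c) ↔ CyclicOrd ρ a b c := by
  choose k hk hk' using h
  -- `N n` is the time of the `n`-th return of `π` to the range of `f`, when started at `f a`. The
  -- function is strictly increasing, so comparing numbers of steps for `ρ` and for `π` is the same.
  let N : ℕ → ℕ := fun n => Nat.rec 0 (fun n m => m + (k ((ρ ^ n) a) + 1)) n
  have hN0 : N 0 = 0 := rfl
  have hNs : ∀ n, N (n + 1) = N n + (k ((ρ ^ n) a) + 1) := fun n => rfl
  have hmono : StrictMono N := strictMono_nat_of_lt_succ fun n => by rw [hNs]; omega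
  have hpow : ∀ n, (π ^ N n) (f a) = f ((ρ ^ n) a) := by
    intro n
    induction n with
    | zero => simp [hN0]
    | succ n ih => rw [hNs, add_comm, pow_add_apply, ih, ← hk, pow_succ', Equiv.Perm.mul_apply]
  have hloc : ∀ m, ∃ n, N n ≤ m ∧ m < N (n + 1) := by
    intro m
    induction m with
    | zero => exact ⟨0, by simp [hN0], by rw [hNs]; omega⟩
    | succ m ih =>
      obtain ⟨n, h1, h2⟩ := ih
      rcases Nat.lt_or_ge (m + 1) (N (n + 1)) with h3 | h3
      · exact ⟨n, by omega, h3⟩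
      · exact ⟨n + 1, h3, by rw [hNs (n + 1)]; omega⟩
  have hrange : ∀ m, (π ^ m) (f a) ∈ Set.range f → ∃ n, m = N n := by
    intro m hm
    obtain ⟨n, h1, h2⟩ := hloc m
    rcases h1.eq_or_lt with h3 | h3
    · exact ⟨n, h3.symm⟩
    · refine absurd hm ?_
      have := hk' ((ρ ^ n) a) (m - N n - 1) (by rw [hNs] at h2; omega)
      rwa [← hpow, ← pow_add_apply, show m - N n - 1 + 1 + N n = m by omega] at this
  have hsteps : ∀ x, ρ.SameCycle a x → π.SameCycle (f a) (f x) ∧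
      steps π (f a) (f x) = N (steps ρ a x) := by
    intro x hx
    have hx' := pow_steps hx
    have h1 : (π ^ N (steps ρ a x)) (f a) = f x := by rw [hpow, hx']
    have hsc : π.SameCycle (f a) (f x) := sameCycle_of_pow h1
    refine ⟨hsc, le_antisymm (steps_le h1) ?_⟩
    have h2 := pow_steps hsc
    obtain ⟨n, hn⟩ := hrange _ ⟨x, h2.symm⟩
    rw [hn, hpow] at h2
    rw [hn]
    exact hmono.monotone (steps_le (hf h2))
  obtain ⟨h1, h2⟩ := hsteps b hab
  obtain ⟨h3, h4⟩ := hsteps c hac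
  simp only [CyclicOrd, hf.ne_iff, h1, h2, h3, h4, hab, hac, hmono.lt_iff_lt]

/-- If the successors of `a` were different from each other and from `a`, then each permutation
would meet its own successor before the other one, in contradiction to the equality of cyclic
orders. -/
theorem perm_eq_of_cyclicOrd [Finite D] {π' : Equiv.Perm D}
    (hsc : ∀ a b, π.SameCycle a b → π'.SameCycle a b)
    (hsc' : ∀ a b, π'.SameCycle a b → π.SameCycle a b)
    (h : ∀ a b c, CyclicOrd π a b c → CyclicOrd π' a b c) : π = π' := by
  ext a
  have h1 : ∀ ρ : Equiv.Perm D, ρ.SameCycle a (ρ a) := fun ρ =>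
    Equiv.Perm.sameCycle_apply_right.2 (Equiv.Perm.SameCycle.refl _ _)
  have fixed : ∀ ρ : Equiv.Perm D, ρ a = a → ∀ b, ρ.SameCycle a b → b = a := by
    intro ρ hρ b hb
    obtain ⟨n, rfl⟩ := hb.exists_nat_pow_eq
    exact Equiv.Perm.pow_apply_eq_self_of_apply_eq_self hρ n
  by_contra hne
  by_cases ha : π a = a
  · exact hne (ha.trans (fixed π ha _ (hsc' _ _ (h1 π'))).symm)
  by_cases ha' : π' a = a
  · exact hne ((fixed π' ha' _ (hsc _ _ (h1 π))).trans ha'.symm)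
  · have h2 := CyclicOrd.apply (hsc' _ _ (h1 π')) (Ne.symm ha) (Ne.symm ha') hne
    have h3 := CyclicOrd.apply (hsc _ _ (h1 π)) (Ne.symm ha') (Ne.symm ha) (Ne.symm hne)
    exact (h _ _ _ h2).asymm h3

end CyclicOrder

/-! ### The theta lemma -/

section Theta

variable {α β : Type*} {G H : Graph α β}

/-- The edges `e₁`, `e₂`, `e₃` leave the vertex `v` in this cyclic order. -/
def RotationSystem.CycAt (σ : RotationSystem G) (v : α) (e₁ e₂ e₃ : β) : Prop :=
  ∃ a b c : Dart G, a.vertex = v ∧ a.edge = e₁ ∧ b.edge = e₂ ∧ c.edge = e₃ ∧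
    CyclicOrd σ.rot a b c

namespace RotationSystem

variable {σ : RotationSystem G} {v : α} {e₁ e₂ e₃ e₄ : β}

theorem CycAt.vertices {a b c : Dart G} (h : CyclicOrd σ.rot a b c) :
    b.vertex = a.vertex ∧ c.vertex = a.vertex :=
  ⟨(σ.vertex_eq_of_sameCycle h.2.1).symm, (σ.vertex_eq_of_sameCycle h.2.2.1).symm⟩

theorem cycAt_iff {a b c : Dart G} (hb : b.vertex = a.vertex) (hc : c.vertex = a.vertex) :
    σ.CycAt a.vertex a.edge b.edge c.edge ↔ CyclicOrd σ.rot a b c := by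
  constructor
  · rintro ⟨a', b', c', h1, h2, h3, h4, h5⟩
    have h6 := CycAt.vertices h5
    rwa [Dart.ext h1 h2, Dart.ext (h6.1.trans (h1.trans hb.symm)) h3,
      Dart.ext (h6.2.trans (h1.trans hc.symm)) h4] at h5
  · intro h
    exact ⟨a, b, c, rfl, rfl, rfl, rfl, h⟩

theorem CycAt.rotate [Finite (Dart G)] (h : σ.CycAt v e₁ e₂ e₃) : σ.CycAt v e₂ e₃ e₁ := by
  obtain ⟨a, b, c, h1, h2, h3, h4, h5⟩ := h
  exact ⟨b, c, a, (CycAt.vertices h5).1.trans h1, h3, h4, h2, h5.rotate⟩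

theorem cycAt_rotate [Finite (Dart G)] : σ.CycAt v e₁ e₂ e₃ ↔ σ.CycAt v e₂ e₃ e₁ :=
  ⟨CycAt.rotate, fun h => h.rotate.rotate⟩

theorem CycAt.asymm (h : σ.CycAt v e₁ e₂ e₃) (h' : σ.CycAt v e₁ e₃ e₂) : False := by
  obtain ⟨a, b, c, rfl, rfl, rfl, rfl, h5⟩ := h
  have := CycAt.vertices h5
  exact h5.asymm ((cycAt_iff this.2 this.1).1 h')

theorem CycAt.trans (h : σ.CycAt v e₁ e₂ e₃) (h' : σ.CycAt v e₁ e₃ e₄) : σ.CycAt v e₁ e₂ e₄ := by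
  obtain ⟨a, b, c, rfl, rfl, rfl, rfl, h5⟩ := h
  obtain ⟨a', c', d, h1, h2, h3, rfl, h6⟩ := h'
  obtain rfl := Dart.ext h1 h2
  have h7 := CycAt.vertices h6
  have h8 := CycAt.vertices h5
  obtain rfl : c' = c := Dart.ext (h7.1.trans h8.2.symm) h3
  exact (cycAt_iff h8.1 h7.2).2 (h5.trans h6)

theorem CycAt.inc (h : σ.CycAt v e₁ e₂ e₃) : G.Inc e₁ v ∧ G.Inc e₂ v ∧ G.Inc e₃ v := by
  obtain ⟨a, b, c, rfl, rfl, rfl, rfl, h5⟩ := h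
  have h8 := CycAt.vertices h5
  exact ⟨a.inc, h8.1 ▸ b.inc, h8.2 ▸ c.inc⟩

theorem CycAt.ne (h : σ.CycAt v e₁ e₂ e₃) : e₁ ≠ e₂ ∧ e₁ ≠ e₃ ∧ e₂ ≠ e₃ := by
  obtain ⟨a, b, c, rfl, rfl, rfl, rfl, h5⟩ := h
  have h8 := CycAt.vertices h5
  exact ⟨fun h => h5.ne₁₂ (Dart.ext h8.1.symm h), fun h => h5.ne₁₃ (Dart.ext h8.2.symm h),
    fun h => h5.ne₂₃ (Dart.ext (h8.1.trans h8.2.symm) h)⟩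

theorem CycAt.total [Finite (Dart G)] (h₁ : G.Inc e₁ v) (h₂ : G.Inc e₂ v) (h₃ : G.Inc e₃ v)
    (h₁₂ : e₁ ≠ e₂) (h₁₃ : e₁ ≠ e₃) (h₂₃ : e₂ ≠ e₃) : σ.CycAt v e₁ e₂ e₃ ∨ σ.CycAt v e₁ e₃ e₂ := by
  have := CyclicOrd.total (π := σ.rot) (a := ⟨v, e₁, h₁⟩) (b := ⟨v, e₂, h₂⟩) (c := ⟨v, e₃, h₃⟩)
    (σ.sameCycle _ _ rfl) (σ.sameCycle _ _ rfl) (fun h => h₁₂ (congrArg Dart.edge h))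
    (fun h => h₁₃ (congrArg Dart.edge h)) (fun h => h₂₃ (congrArg Dart.edge h))
  exact this.imp (fun h => ⟨_, _, _, rfl, rfl, rfl, rfl, h⟩)
    (fun h => ⟨_, _, _, rfl, rfl, rfl, rfl, h⟩)

theorem not_cycAt_iff [Finite (Dart G)] (h₁ : G.Inc e₁ v) (h₂ : G.Inc e₂ v) (h₃ : G.Inc e₃ v)
    (h₁₂ : e₁ ≠ e₂) (h₁₃ : e₁ ≠ e₃) (h₂₃ : e₂ ≠ e₃) :
    ¬ σ.CycAt v e₁ e₂ e₃ ↔ σ.CycAt v e₁ e₃ e₂ :=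
  ⟨fun h => (CycAt.total h₁ h₂ h₃ h₁₂ h₁₃ h₂₃).resolve_left h, fun h h' => h'.asymm h⟩

/-- Between two darts at a vertex where `z` does not vanish, a potential of `z` is constant. -/
theorem IsPotential.eq_of_steps_le [Finite (Dart G)] {z p : Dart G → ℚ} (hp : σ.IsPotential z p)
    {x y u : Dart G} (hxy : y.vertex = x.vertex)
    (hz : ∀ d : Dart G, d.vertex = x.vertex → d ≠ x → d ≠ y → z d = 0) (hu : u ≠ x)
    (hux : u.vertex = x.vertex) (hle : steps σ.rot x u ≤ steps σ.rot x y) : p u = p x - z x := by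
  have h1 := pow_steps (σ.sameCycle x u hux.symm)
  have h2 := pow_steps (σ.sameCycle x y hxy.symm)
  obtain ⟨k, hk⟩ : ∃ k, steps σ.rot x u = k + 1 := by
    refine Nat.exists_eq_succ_of_ne_zero fun h => hu ?_
    rw [h] at h1
    exact h1.symm
  rw [hk] at h1
  rw [← h1]
  refine hp.pow_apply x k fun j hj => hz _ (σ.vertex_pow _ _) (fun h => ?_) fun h => ?_
  · have := steps_le (pow_sub_apply h h1 (by omega))
    omega
  · have := steps_le h
    omega

end RotationSystem

/-- `l` lists the edges and the vertices, except the first one, of a walk from `a` to `b`. -/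
def IsWalk (G : Graph α β) : α → List (β × α) → α → Prop
  | a, [], b => a = b
  | a, (e, x) :: l, b => G.IsLink e a x ∧ IsWalk G x l b

open Classical in
/-- The flow of value one along a walk. -/
noncomputable def flow : α → List (β × α) → α → β → ℚ
  | _, [], _, _ => 0
  | a, (e, x) :: l, v, f =>
    (if v = a ∧ f = e then 1 else 0) - (if v = x ∧ f = e then 1 else 0) + flow x l v f

theorem flow_antisymm [G.Loopless] {a b : α} {l : List (β × α)} (hl : IsWalk G a l b)
    (d : Dart G) : flow a l d.rev.vertex d.edge = -flow a l d.vertex d.edge := by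
  induction l generalizing a with
  | nil => simp [flow]
  | cons ex l ih =>
    obtain ⟨e, x⟩ := ex
    simp only [flow, ih hl.2]
    by_cases he : d.edge = e
    · have h1 := hl.1
      rw [← he] at h1
      have hne := h1.ne
      rcases d.isLink.eq_and_eq_or_eq_and_eq h1 with ⟨h2, h3⟩ | ⟨h2, h3⟩
      · simp [h2, h3, he, hne, hne.symm]; ring
      · simp [h2, h3, he, hne, hne.symm]; ring
    · simp [he]

-- The steps of the walk telescope. Hence the flow along a closed walk, and the difference of the
-- flows along two walks with the same ends, are circulations.
open Classical in
theorem sum_flow [Fintype (Dart G)] {a b : α} {l : List (β × α)} (hl : IsWalk G a l b)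
    (x : α → ℚ) : ∑ d : Dart G, x d.vertex * flow a l d.vertex d.edge = x a - x b := by
  have single : ∀ (φ : Dart G → ℚ) (d₀ : Dart G), φ d₀ = 1 → (∀ d ≠ d₀, φ d = 0) →
      ∑ d : Dart G, x d.vertex * φ d = x d₀.vertex := by
    intro φ d₀ h1 h0
    rw [Finset.sum_eq_single d₀ (fun d _ hne => by rw [h0 d hne, mul_zero]) (by simp), h1, mul_one]
  induction l generalizing a with
  | nil => obtain rfl : a = b := hl; simp [flow]
  | cons ex l ih =>
    obtain ⟨e, y⟩ := ex
    simp only [flow, mul_add, mul_sub, Finset.sum_add_distrib, Finset.sum_sub_distrib, ih hl.2]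
    rw [single _ (dartOf hl.1) (if_pos ⟨rfl, rfl⟩) fun d hne => if_neg fun h =>
        hne (Dart.ext h.1 h.2),
      single _ (dartOf hl.1.symm) (if_pos ⟨rfl, rfl⟩) fun d hne => if_neg fun h =>
        hne (Dart.ext h.1 h.2)]
    simp only [dartOf_vertex]
    ring

theorem flow_eq_zero {a : α} {l : List (β × α)} {v : α} {f : β} (hv : v ∉ a :: l.map Prod.snd) :
    flow a l v f = 0 := by
  induction l generalizing a with
  | nil => rfl
  | cons ex l ih =>
    obtain ⟨e, x⟩ := ex
    simp only [List.map_cons, List.mem_cons, not_or] at hv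
    simp [flow, hv.1, hv.2.1, ih (a := x) (by simp [hv.2])]

open Classical in
theorem flow_start {a x : α} {e : β} {l : List (β × α)}
    (hn : (a :: ((e, x) :: l).map Prod.snd).Nodup) (f : β) :
    flow a ((e, x) :: l) a f = if f = e then 1 else 0 := by
  simp only [List.map_cons, List.nodup_cons, List.mem_cons, not_or] at hn
  simp [flow, hn.1.1, flow_eq_zero (a := x) (l := l) (v := a) (f := f) (by simp [hn.1])]

open Classical in
theorem flow_finish {a b : α} {e : β} {l : List (β × α)} (hl : IsWalk G a l b)
    (hn : (a :: l.map Prod.snd).Nodup) (he : (l.map Prod.fst).getLast? = some e) (f : β) :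
    flow a l b f = - if f = e then 1 else 0 := by
  induction l generalizing a with
  | nil => simp at he
  | cons ex l ih =>
    obtain ⟨e', x⟩ := ex
    have hmem : ∀ (x : α) (l : List (β × α)), IsWalk G x l b → b ∈ x :: l.map Prod.snd := by
      intro x l
      induction l generalizing x with
      | nil => intro h; simp [show x = b from h]
      | cons ex l ih => intro h; exact List.mem_cons_of_mem _ (ih _ h.2)
    have hba : b ≠ a := by
      rintro rfl
      exact (List.nodup_cons.1 hn).1 (hmem _ _ hl.2)
    cases l with
    | nil =>
      obtain rfl : x = b := hl.2
      simp only [List.map_cons, List.map_nil, List.getLast?_singleton, Option.some.injEq] at he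
      simp [flow, hba, he]
    | cons ex l =>
      obtain ⟨e'', x'⟩ := ex
      have hbx : b ≠ x := by
        rintro rfl
        exact (List.nodup_cons.1 (List.nodup_cons.1 hn).2).1 (hmem _ _ hl.2.2)
      have := ih hl.2 (List.nodup_cons.1 hn).2 (by simpa using he)
      rw [flow, this]
      simp [hba, hbx]

/-- The inner vertices of a walk. -/
def inner (l : List (β × α)) : List α := (l.map Prod.snd).dropLast

/-- Along a path carrying a flow of value one, the potential at its left is constant. -/
theorem potential_path [Finite (Dart G)] {σ : RotationSystem G} {z p : Dart G → ℚ}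
    (hp : σ.IsPotential z p) {a b x : α} {e e' : β} {l : List (β × α)}
    (hl : IsWalk G a ((e, x) :: l) b) (hn : (a :: ((e, x) :: l).map Prod.snd).Nodup)
    (hz : ∀ d : Dart G, d.vertex ∈ inner ((e, x) :: l) →
      z d = flow a ((e, x) :: l) d.vertex d.edge)
    (he' : (((e, x) :: l).map Prod.fst).getLast? = some e')
    {d d' : Dart G} (hd : d.vertex = x ∧ d.edge = e) (hd' : d'.vertex = b ∧ d'.edge = e') :
    p d = p d' := by
  classical
  induction l generalizing a e x d with
  | nil =>
    obtain rfl : x = b := hl.2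
    simp only [List.map_cons, List.map_nil, List.getLast?_singleton, Option.some.injEq] at he'
    rw [Dart.ext (hd.1.trans hd'.1.symm) (hd.2.trans (he'.trans hd'.2.symm))]
  | cons ex l ih =>
    obtain ⟨f, y⟩ := ex
    have hn' := (List.nodup_cons.1 hn).2
    have hnm := hn
    simp only [List.map_cons, List.nodup_cons, List.mem_cons, not_or] at hnm
    have hinner : ∀ v, v = x ∨ v ∈ inner ((f, y) :: l) ↔ v ∈ inner ((e, x) :: (f, y) :: l) := by
      intro v; simp [inner]
    have hyx : ∀ v ∈ inner ((f, y) :: l), v ≠ a ∧ v ≠ x := by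
      intro v hv
      have hv' := List.dropLast_subset _ hv
      constructor
      · rintro rfl
        exact (List.nodup_cons.1 hn).1 (List.mem_cons_of_mem _ hv')
      · rintro rfl
        exact (List.nodup_cons.1 hn').1 hv'
    have step := ih hl.2 hn' (fun d hdv => by
      rw [hz d ((hinner _).1 (.inr hdv)), flow]
      simp [hyx _ hdv]) (by simpa using he') (d := dartOf hl.2.1.symm) ⟨rfl, rfl⟩
    rw [← step]
    have hzx : ∀ u : Dart G, u.vertex = x →
        z u = (if u.edge = f then 1 else 0) - (if u.edge = e then 1 else 0) := by
      intro u hu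
      rw [hz u ((hinner _).1 (.inl hu)), hu, flow, flow_start hn']
      have : x ≠ a := Ne.symm hnm.1.1
      simp [this]
      ring
    have hef : f ≠ e := by
      rintro rfl
      have := hl.1.symm.right_unique hl.2.1
      exact hnm.1.2.1 this
    set u : Dart G := dartOf hl.2.1
    have hu : z u = 1 := by rw [hzx u rfl]; simp [u, hef]
    have hdu : d.vertex = u.vertex := hd.1
    -- Rotating from `u` to `d`, no dart with nonzero value is passed except `u`, so the potential
    -- drops by `z u`. Reversing `u` makes it drop by the same amount.
    have h1 : p d = p u - z u := by
      refine hp.eq_of_steps_le hdu (fun w hw h1 h2 => ?_) ?_ hdu le_rfl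
      · rw [hzx w hw, if_neg, if_neg, sub_self]
        · intro h; exact h2 (Dart.ext (hw.trans hdu.symm) (h.trans hd.2.symm))
        · intro h; exact h1 (Dart.ext hw h)
      · intro h
        exact hef ((congrArg Dart.edge h).symm.trans hd.2)
    rw [h1, ← (hp u).2, dartOf_rev]

/-- Off the support of `z`, a potential of `z` is constant along walks. -/
theorem potential_walk {σ : RotationSystem G} {z p : Dart G → ℚ}
    (hp : σ.IsPotential z p) {a b : α} {e e' : β} {l : List (β × α)} (hl : IsWalk G a l b)
    (hz : ∀ d : Dart G, d.vertex ∈ inner l → z d = 0)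
    (he : (l.map Prod.fst).head? = some e) (he' : (l.map Prod.fst).getLast? = some e')
    {d d' : Dart G} (hd : d.vertex = a ∧ d.edge = e) (hzd : z d = 0)
    (hd' : d'.vertex = b ∧ d'.edge = e') : p d = p d' := by
  induction l generalizing a e d with
  | nil => simp at he
  | cons ex l ih =>
    obtain ⟨f, x⟩ := ex
    simp only [List.map_cons, List.head?_cons, Option.some.injEq] at he
    subst he
    have hdl : d = dartOf hl.1 := Dart.ext (by exact hd.1) (by exact hd.2)
    have hrev : p d = p (dartOf hl.1.symm) := by
      rw [← dartOf_rev hl.1, ← hdl, (hp d).2, hzd, sub_zero]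
    cases l with
    | nil =>
      obtain rfl : x = b := hl.2
      simp only [List.map_cons, List.map_nil, List.getLast?_singleton, Option.some.injEq] at he'
      rw [hrev]
      congr 1
      exact Dart.ext hd'.1.symm (he'.trans hd'.2.symm)
    | cons ex l =>
      obtain ⟨g, y⟩ := ex
      have hx : ∀ d : Dart G, d.vertex = x → z d = 0 := fun d h => hz d (by simp [inner, h])
      rw [← ih hl.2 (fun d h => hz d (by simp only [inner, List.map_cons] at h ⊢; simp [h])) rfl
        (by simpa using he') (d := dartOf hl.2.1) ⟨rfl, rfl⟩ (hx _ rfl), hrev]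
      obtain ⟨n, hn⟩ := σ.sameCycle (dartOf hl.1.symm) (dartOf hl.2.1) rfl
      have : ∀ d d' : Dart G, σ.rot.SameCycle d d' → d.vertex = x → p d = p d' := by
        intro d d' h hdx
        classical
        -- The potential is cut off away from `x`, because it is known to be invariant under the
        -- rotation only at `x`, where `z` vanishes.
        let F : Dart G → ℚ := fun u => if u.vertex = x then p u else 0
        have hF : ∀ u, F (σ.rot u) = F u := by
          intro u
          by_cases hu : u.vertex = x
          · simp [F, σ.vertex_rot, hu, (hp u).1, hx u hu]
          · simp [F, σ.vertex_rot, hu]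
        have h2 := eq_of_sameCycle hF h
        have hdx' := (σ.vertex_eq_of_sameCycle h).symm.trans hdx
        simpa only [F, if_pos hdx, if_pos hdx'] using h2
      exact this _ _ ⟨n, hn⟩ rfl

theorem IsWalk.inc_head {a b : α} {l : List (β × α)} (hl : IsWalk G a l b) {e : β}
    (he : (l.map Prod.fst).head? = some e) : G.Inc e a := by
  cases l with
  | nil => simp at he
  | cons ex l =>
    simp only [List.map_cons, List.head?_cons, Option.some.injEq] at he
    exact he ▸ hl.1.inc_left

theorem IsWalk.inc_getLast {a b : α} {l : List (β × α)} (hl : IsWalk G a l b) {e : β}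
    (he : (l.map Prod.fst).getLast? = some e) : G.Inc e b := by
  induction l generalizing a with
  | nil => simp at he
  | cons ex l ih =>
    cases l with
    | nil =>
      obtain rfl : ex.2 = b := hl.2
      simp only [List.map_cons, List.map_nil, List.getLast?_singleton, Option.some.injEq] at he
      exact he ▸ hl.1.inc_right
    | cons ex' l => exact ih hl.2 (by simpa using he)

theorem IsWalk.eq_of_mem {a b : α} {l : List (β × α)} (hl : IsWalk G a l b) {v : α}
    (hv : v ∈ l.map Prod.snd) : v = b ∨ v ∈ inner l := by
  induction l generalizing a with
  | nil => simp at hv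
  | cons ex l ih =>
    cases l with
    | nil => left; obtain rfl : ex.2 = b := hl.2; simpa using hv
    | cons ex' l =>
      simp only [List.map_cons, List.mem_cons] at hv
      rcases hv with rfl | hv
      · right; simp [inner]
      · rcases ih hl.2 (by simpa using hv) with h | h
        · exact .inl h
        · right
          simp only [inner, List.map_cons] at h ⊢
          simp [h]

theorem IsWalk.not_mem_inner {a b : α} {l : List (β × α)} (hl : IsWalk G a l b)
    (hn : (a :: l.map Prod.snd).Nodup) {v : α} (hv : v ∈ inner l) : v ≠ a ∧ v ≠ b := by
  refine ⟨fun h => (List.nodup_cons.1 hn).1 (h ▸ List.dropLast_subset _ hv), ?_⟩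
  induction l generalizing a with
  | nil => simp [inner] at hv
  | cons ex l ih =>
    cases l with
    | nil => simp [inner] at hv
    | cons ex' l =>
      simp only [inner, List.map_cons, List.dropLast_cons_cons, List.mem_cons] at hv
      rcases hv with rfl | hv
      · rintro h
        have : ∀ (x : α) (l : List (β × α)), l ≠ [] → IsWalk G x l b → b ∈ l.map Prod.snd := by
          intro x l
          induction l generalizing x with
          | nil => simp
          | cons ex l ih =>
            intro _ h
            cases l with
            | nil => simp [show ex.2 = b from h.2]
            | cons ex' l => exact List.mem_cons_of_mem _ (ih _ (by simp) h.2)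
        exact (List.nodup_cons.1 (List.nodup_cons.1 hn).2).1 (h ▸ this _ _ (by simp) hl.2)
      · exact ih hl.2 (List.nodup_cons.1 hn).2 (by simpa [inner] using hv)

/-- In an embedding in the sphere, three internally disjoint paths between two vertices leave these
vertices in opposite cyclic orders. -/
theorem RotationSystem.CycAt.theta [Finite (Dart G)] [G.Loopless] {σ : RotationSystem G}
    (hσ : σ.HasPotentialsOn Set.univ) {a b : α} {P Q R : List (β × α)} {p q r p' q' r' : β}
    (hP : IsWalk G a P b) (hQ : IsWalk G a Q b) (hR : IsWalk G a R b)
    (hPn : (a :: P.map Prod.snd).Nodup) (hQn : (a :: Q.map Prod.snd).Nodup)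
    (hPQ : ∀ v ∈ inner P, v ∉ inner Q)
    (hRP : ∀ v ∈ inner R, v ≠ a ∧ v ≠ b ∧ v ∉ inner P ∧ v ∉ inner Q)
    (hp : (P.map Prod.fst).head? = some p) (hp' : (P.map Prod.fst).getLast? = some p')
    (hq : (Q.map Prod.fst).head? = some q) (hq' : (Q.map Prod.fst).getLast? = some q')
    (hr : (R.map Prod.fst).head? = some r) (hr' : (R.map Prod.fst).getLast? = some r')
    (hpq' : p' ≠ q') (hpr' : p' ≠ r') (hqr' : q' ≠ r')
    (h : σ.CycAt a p q r) : σ.CycAt b p' r' q' := by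
  classical
  have := Fintype.ofFinite (Dart G)
  refine (CycAt.total (hP.inc_getLast hp') (hR.inc_getLast hr') (hQ.inc_getLast hq') hpr' hpq'
    hqr'.symm).resolve_right fun hbad => ?_
  obtain ⟨_, rfl⟩ | ⟨⟨p₀, x⟩, P', rfl⟩ : (∃ _ : Unit, P = []) ∨ ∃ ex P', P = ex :: P' := by
    cases P with
    | nil => exact .inl ⟨(), rfl⟩
    | cons ex P => exact .inr ⟨ex, P, rfl⟩
  · simp at hp
  obtain ⟨_, rfl⟩ | ⟨⟨q₀, y⟩, Q', rfl⟩ : (∃ _ : Unit, Q = []) ∨ ∃ ex Q', Q = ex :: Q' := by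
    cases Q with
    | nil => exact .inl ⟨(), rfl⟩
    | cons ex Q => exact .inr ⟨ex, Q, rfl⟩
  · simp at hq
  obtain rfl : p₀ = p := by simpa using hp
  obtain rfl : q₀ = q := by simpa using hq
  -- The flow around the cycle formed by `P` and the reverse of `Q`. Its potential distinguishes the
  -- two sides of the cycle.
  let z : Dart G → ℚ := fun d => flow a ((p₀, x) :: P') d.vertex d.edge -
    flow a ((q₀, y) :: Q') d.vertex d.edge
  have hz : IsCirculation z := by
    constructor
    · intro d
      simp only [z, Dart.rev_edge, flow_antisymm hP, flow_antisymm hQ]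
      ring
    · intro w
      rw [finsum_eq_sum_of_fintype]
      simp only [z, mul_sub, Finset.sum_sub_distrib, sum_flow hP, sum_flow hQ, sub_self]
  obtain ⟨pot, hpot⟩ := hσ z hz fun d hd => absurd trivial hd
  have notP : ∀ v ∈ inner ((q₀, y) :: Q'), v ∉ a :: ((p₀, x) :: P').map Prod.snd := by
    intro v hv hmem
    have h1 := hQ.not_mem_inner hQn hv
    rcases List.mem_cons.1 hmem with h2 | h2
    · exact h1.1 h2
    · rcases hP.eq_of_mem h2 with h3 | h3
      · exact h1.2 h3
      · exact hPQ v h3 hv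
  have notQ : ∀ v ∈ inner ((p₀, x) :: P'), v ∉ a :: ((q₀, y) :: Q').map Prod.snd := by
    intro v hv hmem
    have h1 := hP.not_mem_inner hPn hv
    rcases List.mem_cons.1 hmem with h2 | h2
    · exact h1.1 h2
    · rcases hQ.eq_of_mem h2 with h3 | h3
      · exact h1.2 h3
      · exact hPQ v hv h3
  have hza : ∀ d : Dart G, d.vertex = a →
      z d = (if d.edge = p₀ then 1 else 0) - if d.edge = q₀ then 1 else 0 := by
    intro d hd
    simp only [z, hd, flow_start hPn, flow_start hQn]
  have hzb : ∀ d : Dart G, d.vertex = b →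
      z d = (if d.edge = q' then 1 else 0) - if d.edge = p' then 1 else 0 := by
    intro d hd
    simp only [z, hd, flow_finish hP hPn hp', flow_finish hQ hQn hq']
    ring
  obtain ⟨dp, dq, dr, h1, h2, h3, h4, h5⟩ := h
  obtain ⟨bp, bq, br, g1, g2, g3, g4, g5⟩ := hbad
  have h6 := CycAt.vertices h5
  have g6 := CycAt.vertices g5
  have hpq : p₀ ≠ q₀ := fun h => h5.ne₁₂ (Dart.ext h6.1.symm (h2.trans (h.trans h3.symm)))
  have hpr : p₀ ≠ r := fun h => h5.ne₁₃ (Dart.ext h6.2.symm (h2.trans (h.trans h4.symm)))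
  have hqr : q₀ ≠ r := fun h =>
    h5.ne₂₃ (Dart.ext (h6.1.trans h6.2.symm) (h3.trans (h.trans h4.symm)))
  have hzdp : z dp = 1 := by rw [hza dp h1, h2]; simp [hpq]
  have hzdq : z dq = -1 := by rw [hza dq (h6.1.trans h1), h3]; simp [hpq.symm]
  have hzdr : z dr = 0 := by rw [hza dr (h6.2.trans h1), h4]; simp [hpr.symm, hqr.symm]
  have hzbq : z bq = 1 := by rw [hzb bq (g6.1.trans g1), g3]; simp [hpq'.symm]
  -- the values at `a`
  have a1 : pot dq = pot dp - 1 := by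
    rw [← hzdp]
    refine hpot.eq_of_steps_le h6.1 (fun d hd hd1 hd2 => ?_) h5.ne₁₂.symm h6.1 le_rfl
    rw [hza d (hd.trans h1), if_neg fun h => hd1 (Dart.ext hd (h.trans h2.symm)),
      if_neg fun h => hd2 (Dart.ext (hd.trans h6.1.symm) (h.trans h3.symm)), sub_self]
  have a2 : pot dr = pot dq + 1 := by
    rw [← sub_neg_eq_add, ← hzdq]
    have h7 := h5.rotate
    refine hpot.eq_of_steps_le h6.1.symm (fun d hd hd1 hd2 => ?_) h7.ne₁₂.symm
      (h6.2.trans h6.1.symm) h7.2.2.2.le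
    rw [hza d (hd.trans (h6.1.trans h1)),
      if_neg fun h => hd2 (Dart.ext (hd.trans h6.1) (h.trans h2.symm)),
      if_neg fun h => hd1 (Dart.ext hd (h.trans h3.symm)), sub_self]
  -- the values at `b`
  have b1 : pot br = pot bp := by
    have g7 := g5.rotate
    have zb : ∀ d : Dart G, d.vertex = bq.vertex → d ≠ bq → d ≠ bp → z d = 0 := by
      intro d hd hd1 hd2
      rw [hzb d (hd.trans (g6.1.trans g1)), if_neg fun h => hd1 (Dart.ext hd (h.trans g3.symm)),
        if_neg fun h => hd2 (Dart.ext (hd.trans g6.1) (h.trans g2.symm)), sub_self]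
    rw [hpot.eq_of_steps_le g6.1.symm zb g7.ne₁₂.symm (g6.2.trans g6.1.symm) g7.2.2.2.le,
      hpot.eq_of_steps_le g6.1.symm zb g7.ne₁₃.symm g6.1.symm le_rfl]
  -- along the paths
  have c1 : pot dp.rev = pot bp := by
    refine potential_path hpot hP hPn (fun d hd => ?_) hp' ⟨?_, h2⟩ ⟨g1, g2⟩
    · simp only [z, flow_eq_zero (notQ _ hd), sub_zero]
    · have h7 := dp.isLink
      rw [h1, h2] at h7
      exact h7.right_unique hP.1
  have c2 : pot dr = pot br := by
    refine potential_walk hpot hR (fun d hd => ?_) hr hr' ⟨h6.2.trans h1, h4⟩ hzdr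
      ⟨g6.2.trans g1, g4⟩
    obtain ⟨i1, i2, i3, i4⟩ := hRP _ hd
    have n1 : d.vertex ∉ a :: ((p₀, x) :: P').map Prod.snd := fun hm =>
      (List.mem_cons.1 hm).elim i1 fun hm => (hP.eq_of_mem hm).elim i2 i3
    have n2 : d.vertex ∉ a :: ((q₀, y) :: Q').map Prod.snd := fun hm =>
      (List.mem_cons.1 hm).elim i1 fun hm => (hQ.eq_of_mem hm).elim i2 i4
    simp only [z, flow_eq_zero n1, flow_eq_zero n2, sub_zero]
  -- The equalities lead from `dp` to `dr`, along `R` to `br`, on to `bp`, and back along `P` to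
  -- `dp.rev`. So the potential is the same at `dp` and at `dp.rev`, although crossing `dp` lowers
  -- it by one.
  have c3 := (hpot dp).2
  rw [hzdp] at c3
  linarith

/-- For the converse, the other order at `a` is the order of the same paths with `Q` and `R`
interchanged, and `CycAt.theta` carries it to the other order at `b`. -/
theorem RotationSystem.cycAt_theta [Finite (Dart G)] [G.Loopless] {σ : RotationSystem G}
    (hσ : σ.HasPotentialsOn Set.univ) {a b : α} {P Q R : List (β × α)} {p q r p' q' r' : β}
    (hP : IsWalk G a P b) (hQ : IsWalk G a Q b) (hR : IsWalk G a R b)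
    (hPn : (a :: P.map Prod.snd).Nodup) (hQn : (a :: Q.map Prod.snd).Nodup)
    (hRn : (a :: R.map Prod.snd).Nodup)
    (hPQ : ∀ v ∈ inner P, v ∉ inner Q ∧ v ∉ inner R) (hQR : ∀ v ∈ inner Q, v ∉ inner R)
    (hp : (P.map Prod.fst).head? = some p) (hp' : (P.map Prod.fst).getLast? = some p')
    (hq : (Q.map Prod.fst).head? = some q) (hq' : (Q.map Prod.fst).getLast? = some q')
    (hr : (R.map Prod.fst).head? = some r) (hr' : (R.map Prod.fst).getLast? = some r')
    (hpq : p ≠ q) (hpr : p ≠ r) (hqr : q ≠ r)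
    (hpq' : p' ≠ q') (hpr' : p' ≠ r') (hqr' : q' ≠ r') :
    σ.CycAt a p q r ↔ σ.CycAt b p' r' q' := by
  constructor
  · refine CycAt.theta hσ hP hQ hR hPn hQn (fun v hv => (hPQ v hv).1) (fun v hv => ?_) hp hp' hq
      hq' hr hr' hpq' hpr' hqr'
    exact ⟨(hR.not_mem_inner hRn hv).1, (hR.not_mem_inner hRn hv).2,
      fun h => (hPQ v h).2 hv, fun h => hQR v h hv⟩
  · intro h
    by_contra h'
    rw [not_cycAt_iff (hP.inc_head hp) (hQ.inc_head hq) (hR.inc_head hr) hpq hpr hqr] at h'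
    refine CycAt.asymm h (CycAt.theta hσ hP hR hQ hPn hRn (fun v hv => (hPQ v hv).2)
      (fun v hv => ?_) hp hp' hr hr' hq hq' hpr' hpq' hqr'.symm h')
    exact ⟨(hQ.not_mem_inner hQn hv).1, (hQ.not_mem_inner hQn hv).2,
      fun h => (hPQ v h).1 hv, hQR v hv⟩

end Theta

end

section

/-! ### Embeddings of villages -/

section Village

variable {s : ℕ} {I : Finset ℕ}

theorem village_isLink {e : VillageEdge} {x y : VillageVertex} :
    (village s I).IsLink e x y ↔
      e ∈ villageEdges s I ∧ (villageEnds s e = (x, y) ∨ villageEnds s e = (y, x)) := Iff.rfl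

@[simp] theorem spoke_mem {k : ℕ} : VillageEdge.spoke k ∈ villageEdges s I ↔ 1 ≤ k ∧ k ≤ 4 * s :=
  Iff.rfl

@[simp] theorem rim_mem {k : ℕ} : VillageEdge.rim k ∈ villageEdges s I ↔ 1 ≤ k ∧ k ≤ 4 * s :=
  Iff.rfl

@[simp] theorem wall_mem {i k : ℕ} : VillageEdge.wall i k ∈ villageEdges s I ↔
    i ∈ I ∧ i ∈ Finset.Icc 1 s ∧ 1 ≤ k ∧ k ≤ 6 := Iff.rfl

@[simp] theorem claw_mem {i k : ℕ} : VillageEdge.claw i k ∈ villageEdges s I ↔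
    i ∈ I ∧ i ∈ Finset.Icc 1 s ∧ (k = 2 ∨ k = 4 ∨ k = 6) := Iff.rfl

variable {σ : RotationSystem (village s I)} {i : ℕ}

/-- The three edges at the inhabitant continue to disjoint paths to `v_2`; the one through `v_6`
leaves the house and returns by way of the centre. The same is done below for `v_4`, with all paths
inside of the house, and for `v_6`. Thus the order at the inhabitant fixes the rotations at its
neighbours. -/
theorem cycAt_inhabitant_wall_two [Finite (Dart (village s I))] [(village s I).Loopless]
    (hσ : σ.HasPotentialsOn Set.univ) (hi : i ∈ I) (hs : i ∈ Finset.Icc 1 s) :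
    σ.CycAt (.inhabitant i) (.claw i 2) (.claw i 4) (.claw i 6) ↔
      σ.CycAt (.wall i 2) (.claw i 2) (.wall i 1) (.wall i 2) := by
  have hs' := Finset.mem_Icc.1 hs
  refine RotationSystem.cycAt_theta hσ (P := [(.claw i 2, .wall i 2)])
    (Q := [(.claw i 4, .wall i 4), (.wall i 3, .wall i 3), (.wall i 2, .wall i 2)])
    (R := [(.claw i 6, .wall i 6), (.wall i 6, .surface (4 * i - 1)),
      (.spoke (4 * i - 1), .centre), (.spoke (4 * i - 3), .surface (4 * i - 3)),
      (.wall i 1, .wall i 2)]) ?_ ?_ ?_ ?_ ?_ ?_ ?_ ?_ rfl rfl rfl rfl rfl rfl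
      ?_ ?_ ?_ ?_ ?_ ?_
  all_goals simp [IsWalk, inner, village_isLink, villageEnds, houseVertex, hi, hs]
  all_goals omega

theorem cycAt_inhabitant_wall_four [Finite (Dart (village s I))] [(village s I).Loopless]
    (hσ : σ.HasPotentialsOn Set.univ) (hi : i ∈ I) (hs : i ∈ Finset.Icc 1 s) :
    σ.CycAt (.inhabitant i) (.claw i 2) (.claw i 4) (.claw i 6) ↔
      σ.CycAt (.wall i 4) (.wall i 3) (.wall i 4) (.claw i 4) := by
  have hs' := Finset.mem_Icc.1 hs
  refine RotationSystem.cycAt_theta hσ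
    (P := [(.claw i 2, .wall i 2), (.wall i 2, .wall i 3), (.wall i 3, .wall i 4)])
    (Q := [(.claw i 4, .wall i 4)])
    (R := [(.claw i 6, .wall i 6), (.wall i 5, .wall i 5), (.wall i 4, .wall i 4)])
    ?_ ?_ ?_ ?_ ?_ ?_ ?_ ?_ rfl rfl rfl rfl rfl rfl ?_ ?_ ?_ ?_ ?_ ?_
  all_goals simp [IsWalk, inner, village_isLink, villageEnds, houseVertex, hi, hs]


theorem cycAt_inhabitant_wall_six [Finite (Dart (village s I))] [(village s I).Loopless]
    (hσ : σ.HasPotentialsOn Set.univ) (hi : i ∈ I) (hs : i ∈ Finset.Icc 1 s) :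
    σ.CycAt (.inhabitant i) (.claw i 2) (.claw i 4) (.claw i 6) ↔
      σ.CycAt (.wall i 6) (.wall i 6) (.claw i 6) (.wall i 5) := by
  have hs' := Finset.mem_Icc.1 hs
  refine RotationSystem.cycAt_theta hσ
    (P := [(.claw i 2, .wall i 2), (.wall i 1, .surface (4 * i - 3)),
      (.spoke (4 * i - 3), .centre), (.spoke (4 * i - 1), .surface (4 * i - 1)),
      (.wall i 6, .wall i 6)])
    (Q := [(.claw i 4, .wall i 4), (.wall i 4, .wall i 5), (.wall i 5, .wall i 6)])
    (R := [(.claw i 6, .wall i 6)]) ?_ ?_ ?_ ?_ ?_ ?_ ?_ ?_ rfl rfl rfl rfl rfl rfl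
    ?_ ?_ ?_ ?_ ?_ ?_
  all_goals simp [IsWalk, inner, village_isLink, villageEnds, houseVertex, hi, hs]
  all_goals omega

/-- Three paths run to the centre, one of them along the whole wall of the house and the spoke at
`s_{4i-1}`. So the place of the wall at the surface can be read off from three spokes at the centre,
which belong to the planet. The next three lemmas treat the other rim edges at the ends of the wall
in the same way. -/
theorem cycAt_first_surface_next [Finite (Dart (village s I))] [(village s I).Loopless]
    (hσ : σ.HasPotentialsOn Set.univ) (hi : i ∈ I) (hs : i ∈ Finset.Icc 1 s) :
    σ.CycAt (.surface (4 * i - 3)) (.spoke (4 * i - 3)) (.rim (4 * i - 3)) (.wall i 1) ↔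
      σ.CycAt .centre (.spoke (4 * i - 3)) (.spoke (4 * i - 1)) (.spoke (4 * i - 2)) := by
  have hs' := Finset.mem_Icc.1 hs
  refine RotationSystem.cycAt_theta hσ (P := [(.spoke (4 * i - 3), .centre)])
    (Q := [(.rim (4 * i - 3), .surface (4 * i - 2)), (.spoke (4 * i - 2), .centre)])
    (R := [(.wall i 1, .wall i 2), (.wall i 2, .wall i 3), (.wall i 3, .wall i 4),
      (.wall i 4, .wall i 5), (.wall i 5, .wall i 6), (.wall i 6, .surface (4 * i - 1)),
      (.spoke (4 * i - 1), .centre)]) ?_ ?_ ?_ ?_ ?_ ?_ ?_ ?_ rfl rfl rfl rfl rfl rfl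
    ?_ ?_ ?_ ?_ ?_ ?_
  all_goals simp [IsWalk, inner, village_isLink, villageEnds, houseVertex, hi, hs]
  all_goals grind

theorem cycAt_first_surface_prev [Finite (Dart (village s I))] [(village s I).Loopless]
    (hσ : σ.HasPotentialsOn Set.univ) (hi : i ∈ I) (hs : i ∈ Finset.Icc 1 s) {l : ℕ}
    (hl : l = 4 * i - 4 ∧ 1 < i ∨ l = 4 * s ∧ i = 1) :
    σ.CycAt (.surface (4 * i - 3)) (.spoke (4 * i - 3)) (.rim l) (.wall i 1) ↔
      σ.CycAt .centre (.spoke (4 * i - 3)) (.spoke (4 * i - 1)) (.spoke l) := by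
  have hs' := Finset.mem_Icc.1 hs
  have h1 : 1 ≤ l := by omega
  have h2 : l ≤ 4 * s := by omega
  have h3 : l ≠ 4 * i - 3 := by omega
  have h4 : l ≠ 4 * i - 1 := by omega
  have h5 : (if l = 4 * s then 1 else l + 1) = 4 * i - 3 := by split_ifs <;> omega
  refine RotationSystem.cycAt_theta hσ (P := [(.spoke (4 * i - 3), .centre)])
    (Q := [(.rim l, .surface l), (.spoke l, .centre)])
    (R := [(.wall i 1, .wall i 2), (.wall i 2, .wall i 3), (.wall i 3, .wall i 4),
      (.wall i 4, .wall i 5), (.wall i 5, .wall i 6), (.wall i 6, .surface (4 * i - 1)),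
      (.spoke (4 * i - 1), .centre)]) ?_ ?_ ?_ ?_ ?_ ?_ ?_ ?_ rfl rfl rfl rfl rfl rfl
    ?_ ?_ ?_ ?_ ?_ ?_
  all_goals simp [IsWalk, inner, village_isLink, villageEnds, houseVertex, hi, hs, h1, h2, h3, h4,
    h5, h3.symm]
  all_goals omega

theorem cycAt_last_surface_prev [Finite (Dart (village s I))] [(village s I).Loopless]
    (hσ : σ.HasPotentialsOn Set.univ) (hi : i ∈ I) (hs : i ∈ Finset.Icc 1 s) :
    σ.CycAt (.surface (4 * i - 1)) (.spoke (4 * i - 1)) (.rim (4 * i - 2)) (.wall i 6) ↔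
      σ.CycAt .centre (.spoke (4 * i - 1)) (.spoke (4 * i - 3)) (.spoke (4 * i - 2)) := by
  have hs' := Finset.mem_Icc.1 hs
  refine RotationSystem.cycAt_theta hσ (P := [(.spoke (4 * i - 1), .centre)])
    (Q := [(.rim (4 * i - 2), .surface (4 * i - 2)), (.spoke (4 * i - 2), .centre)])
    (R := [(.wall i 6, .wall i 6), (.wall i 5, .wall i 5), (.wall i 4, .wall i 4),
      (.wall i 3, .wall i 3), (.wall i 2, .wall i 2), (.wall i 1, .surface (4 * i - 3)),
      (.spoke (4 * i - 3), .centre)]) ?_ ?_ ?_ ?_ ?_ ?_ ?_ ?_ rfl rfl rfl rfl rfl rfl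
    ?_ ?_ ?_ ?_ ?_ ?_
  all_goals simp [IsWalk, inner, village_isLink, villageEnds, houseVertex, hi, hs]
  all_goals grind

theorem cycAt_last_surface_next [Finite (Dart (village s I))] [(village s I).Loopless]
    (hσ : σ.HasPotentialsOn Set.univ) (hi : i ∈ I) (hs : i ∈ Finset.Icc 1 s) :
    σ.CycAt (.surface (4 * i - 1)) (.spoke (4 * i - 1)) (.rim (4 * i - 1)) (.wall i 6) ↔
      σ.CycAt .centre (.spoke (4 * i - 1)) (.spoke (4 * i - 3)) (.spoke (4 * i)) := by
  have hs' := Finset.mem_Icc.1 hs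
  refine RotationSystem.cycAt_theta hσ (P := [(.spoke (4 * i - 1), .centre)])
    (Q := [(.rim (4 * i - 1), .surface (4 * i)), (.spoke (4 * i), .centre)])
    (R := [(.wall i 6, .wall i 6), (.wall i 5, .wall i 5), (.wall i 4, .wall i 4),
      (.wall i 3, .wall i 3), (.wall i 2, .wall i 2), (.wall i 1, .surface (4 * i - 3)),
      (.spoke (4 * i - 3), .centre)]) ?_ ?_ ?_ ?_ ?_ ?_ ?_ ?_ rfl rfl rfl rfl rfl rfl
    ?_ ?_ ?_ ?_ ?_ ?_
  all_goals simp [IsWalk, inner, village_isLink, villageEnds, houseVertex, hi, hs]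
  all_goals grind

/-- The walk along the rim from `s_a` down to `s_{a-n}`. -/
def rimWalk (a n : ℕ) : List (VillageEdge × VillageVertex) :=
  (List.range n).map fun j => (.rim (a - j - 1), .surface (a - j - 1))

theorem IsWalk.append {α β : Type*} {G : Graph α β} {a b c : α} {l l' : List (β × α)}
    (h : IsWalk G a l b) (h' : IsWalk G b l' c) : IsWalk G a (l ++ l') c := by
  induction l generalizing a with
  | nil => obtain rfl : a = b := h; exact h'
  | cons ex l ih => exact ⟨h.1, ih h.2⟩

theorem isWalk_rimWalk {a n : ℕ} (h : n < a) (ha : a ≤ 4 * s) :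
    IsWalk (village s I) (.surface a) (rimWalk a n) (.surface (a - n)) := by
  induction n generalizing a with
  | zero => rfl
  | succ n ih =>
    have h1 : rimWalk a (n + 1) = (.rim (a - 1), .surface (a - 1)) :: rimWalk (a - 1) n := by
      simp only [rimWalk, List.range_succ_eq_map, List.map_cons, List.map_map]
      congr 1
      refine List.map_congr_left fun j _ => ?_
      simp only [Function.comp_apply, Nat.succ_eq_add_one]
      rw [show a - (j + 1) - 1 = a - 1 - j - 1 by omega]
    rw [h1]
    refine ⟨⟨?_, .inr ?_⟩, ?_⟩
    · simp; omega
    · simp only [villageEnds]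
      rw [if_neg (by omega), Nat.sub_add_cancel (by omega)]
    · have := ih (a := a - 1) (by omega) (by omega)
      rwa [Nat.sub_sub, add_comm 1 n] at this

theorem mem_rimWalk_snd {a n : ℕ} {v : VillageVertex} :
    v ∈ (rimWalk a n).map Prod.snd ↔ ∃ j < n, v = .surface (a - j - 1) := by
  simp only [rimWalk, List.map_map, List.mem_map, List.mem_range, Function.comp_apply]
  exact exists_congr fun j => and_congr_right fun _ => eq_comm

theorem nodup_rimWalk {a n : ℕ} (h : n < a) : ((rimWalk a n).map Prod.snd).Nodup := by
  simp only [rimWalk, List.map_map]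
  refine List.Nodup.map_on ?_ List.nodup_range
  intro x hx y hy hxy
  simp only [List.mem_range, Function.comp_apply, VillageVertex.surface.injEq] at hx hy hxy
  omega

/-- The theta consists of a rim edge, the two spokes at its ends and the rest of the rim. The theta
lemma reverses the order, but the common rim edge is the later one at `s_k` and the earlier one at
`s_{k+1}`, so the orientation is the same. -/
theorem cycAt_surface_succ [Finite (Dart (village s I))] [(village s I).Loopless]
    (hσ : σ.HasPotentialsOn Set.univ) {k : ℕ} (h1 : 2 ≤ k) (h2 : k + 2 ≤ 4 * s) :
    σ.CycAt (.surface k) (.spoke k) (.rim (k - 1)) (.rim k) ↔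
      σ.CycAt (.surface (k + 1)) (.spoke (k + 1)) (.rim k) (.rim (k + 1)) := by
  rw [← RotationSystem.cycAt_rotate (e₁ := VillageEdge.rim k),
    RotationSystem.cycAt_rotate (v := VillageVertex.surface (k + 1))]
  -- The rest of the rim is traversed downwards from `s_k` to `s_1`, over the closing edge to
  -- `s_{4s}`, and downwards to `s_{k+1}`.
  have hR : IsWalk (village s I) (.surface k)
      (rimWalk k (k - 1) ++ (.rim (4 * s), .surface (4 * s)) :: rimWalk (4 * s) (4 * s - k - 1))
      (.surface (k + 1)) := by
    refine (isWalk_rimWalk (by omega) (by omega)).append ⟨⟨?_, .inr ?_⟩, ?_⟩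
    · simp; omega
    · simp [villageEnds]; omega
    · have := isWalk_rimWalk (s := s) (I := I) (a := 4 * s) (n := 4 * s - k - 1) (by omega) le_rfl
      rwa [show 4 * s - (4 * s - k - 1) = k + 1 by omega] at this
  have hRn : (VillageVertex.surface k :: (rimWalk k (k - 1) ++
      (VillageEdge.rim (4 * s), VillageVertex.surface (4 * s)) ::
        rimWalk (4 * s) (4 * s - k - 1)).map Prod.snd).Nodup := by
    rw [List.map_append, List.map_cons, List.nodup_cons, List.mem_append, List.mem_cons,
      List.nodup_append, List.nodup_cons]
    simp only [mem_rimWalk_snd, List.mem_cons]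
    refine ⟨?_, nodup_rimWalk (by omega), ⟨?_, nodup_rimWalk (by omega)⟩, ?_⟩
    · rintro (⟨j, hj, h⟩ | h | ⟨j, hj, h⟩) <;> simp only [VillageVertex.surface.injEq] at h <;> omega
    · rintro ⟨j, hj, h⟩
      simp only [VillageVertex.surface.injEq] at h
      omega
    · rintro _ ⟨j, hj, rfl⟩ _ (rfl | ⟨l, hl, rfl⟩) h <;>
        simp only [VillageVertex.surface.injEq] at h <;> omega
  have hRin : VillageVertex.centre ∉ inner (rimWalk k (k - 1) ++
      (.rim (4 * s), .surface (4 * s)) :: rimWalk (4 * s) (4 * s - k - 1)) := by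
    intro h
    have := List.dropLast_subset _ h
    rw [List.map_append, List.map_cons, List.mem_append, List.mem_cons, mem_rimWalk_snd,
      mem_rimWalk_snd] at this
    simp at this
  refine RotationSystem.cycAt_theta hσ (P := [(.rim k, .surface (k + 1))])
    (Q := [(.spoke k, .centre), (.spoke (k + 1), .surface (k + 1))])
    (R := rimWalk k (k - 1) ++ (.rim (4 * s), .surface (4 * s)) ::
      rimWalk (4 * s) (4 * s - k - 1)) ?_ ?_ hR ?_ ?_ hRn ?_ ?_ rfl rfl rfl rfl ?_ ?_
      ?_ ?_ ?_ ?_ ?_ ?_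
  · simp [IsWalk, village_isLink, villageEnds]
    omega
  · simp [IsWalk, village_isLink, villageEnds]
    omega
  · simp
  · simp
  · simp [inner]
  · intro v hv
    obtain rfl : v = .centre := by simpa [inner] using hv
    exact hRin
  · obtain ⟨n, hn⟩ : ∃ n, k - 1 = n + 1 := ⟨k - 2, by omega⟩
    simp [rimWalk, hn, List.range_succ_eq_map]
  · rcases Nat.eq_zero_or_pos (4 * s - k - 1) with h | h
    · omega
    · obtain ⟨n, hn⟩ : ∃ n, 4 * s - k - 1 = n + 1 := ⟨4 * s - k - 2, by omega⟩
      simp only [rimWalk, hn, List.map_append, List.map_cons, List.range_succ, List.map_append,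
        List.map_nil]
      simp only [← List.cons_append, ← List.append_assoc, List.getLast?_concat]
      rw [show 4 * s - n - 1 = k + 1 by omega]
  all_goals simp
  all_goals omega

/-- The planet has one orientation, which is recorded at `s_2`. The vertices `s_1` and `s_{4s}`,
where the indices wrap around, are not needed: the lemma is applied at the middles `s_{4i-2}` of the
houses. -/
theorem cycAt_surface [Finite (Dart (village s I))] [(village s I).Loopless]
    (hσ : σ.HasPotentialsOn Set.univ) {k : ℕ} (h1 : 2 ≤ k) (h2 : k + 1 ≤ 4 * s) :
    σ.CycAt (.surface k) (.spoke k) (.rim (k - 1)) (.rim k) ↔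
      σ.CycAt (.surface 2) (.spoke 2) (.rim 1) (.rim 2) := by
  induction k, h1 using Nat.le_induction with
  | base => rfl
  | succ k hk ih =>
    rw [← ih (by omega), cycAt_surface_succ hσ hk (by omega)]
    rfl

end Village

end

/-! ### Embeddings determined by few cyclic orders -/

section

section Determined

variable {α β : Type*} {G : Graph α β}

namespace RotationSystem

variable {σ τ : RotationSystem G}

/-- Cutting the cycle open at `a` turns a cyclic order of `b`, `c`, `d` into one of the three linear
orders `bcd`, `cdb`, `dbc`. -/
theorem cycAt_iff_of_base [Finite (Dart G)] {v : α} {a b c d : β} (ha : G.Inc a v)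
    (hab : a ≠ b) (hac : a ≠ c) (had : a ≠ d) (hbc : b ≠ c) (hbd : b ≠ d) (hcd : c ≠ d)
    (hb : G.Inc b v) (hc : G.Inc c v) (hd : G.Inc d v) :
    σ.CycAt v b c d ↔ (σ.CycAt v a b c ∧ σ.CycAt v a c d) ∨ (σ.CycAt v a c d ∧ σ.CycAt v a d b) ∨
      (σ.CycAt v a d b ∧ σ.CycAt v a b c) := by
  have back : ∀ {x y w : β}, σ.CycAt v a x y → σ.CycAt v a y w → σ.CycAt v x y w := by
    intro x y w h h'
    exact (h'.rotate.trans h.rotate.rotate).rotate.rotate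
  constructor
  · intro h
    have n : ∀ {x y w : β}, σ.CycAt v a y x → σ.CycAt v a w y → ¬ σ.CycAt v x y w := by
      intro x y w h1 h2 h3
      exact CycAt.asymm (back h2 h1) h3.rotate.rotate
    by_cases h1 : σ.CycAt v a b c
    · by_cases h2 : σ.CycAt v a c d
      · exact .inl ⟨h1, h2⟩
      · rw [not_cycAt_iff ha hc hd hac had hcd] at h2
        by_cases h3 : σ.CycAt v a d b
        · exact .inr (.inr ⟨h3, h1⟩)
        · rw [not_cycAt_iff ha hd hb had hab hbd.symm] at h3
          exact absurd h.rotate (n h2 h3)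
    · rw [not_cycAt_iff ha hb hc hab hac hbc] at h1
      by_cases h2 : σ.CycAt v a c d
      · by_cases h3 : σ.CycAt v a d b
        · exact .inr (.inl ⟨h2, h3⟩)
        · rw [not_cycAt_iff ha hd hb had hab hbd.symm] at h3
          exact absurd h.rotate.rotate (n h3 h1)
      · rw [not_cycAt_iff ha hc hd hac had hcd] at h2
        exact absurd h (n h1 h2)
  · rintro (⟨h1, h2⟩ | ⟨h1, h2⟩ | ⟨h1, h2⟩)
    · exact back h1 h2
    · exact (back h1 h2).rotate.rotate
    · exact (back h1 h2).rotate

theorem cycAt_of_base [Finite (Dart G)] {v : α} {a : β} (ha : G.Inc a v)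
    (h : ∀ x y, x ≠ a → y ≠ a → σ.CycAt v a x y → τ.CycAt v a x y) {b c d : β}
    (hσ : σ.CycAt v b c d) : τ.CycAt v b c d := by
  obtain ⟨hb, hc, hd⟩ := hσ.inc
  obtain ⟨hbc, hbd, hcd⟩ := hσ.ne
  by_cases hab : a = b
  · subst hab
    exact h _ _ hbc.symm hbd.symm hσ
  by_cases hac : a = c
  · subst hac
    exact (h _ _ hcd.symm hbc hσ.rotate).rotate.rotate
  by_cases had : a = d
  · subst had
    exact (h _ _ hbd hcd hσ.rotate.rotate).rotate
  rw [cycAt_iff_of_base ha hab hac had hbc hbd hcd hb hc hd] at hσ ⊢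
  rcases hσ with ⟨h1, h2⟩ | ⟨h1, h2⟩ | ⟨h1, h2⟩
  · exact .inl ⟨h _ _ (Ne.symm hab) (Ne.symm hac) h1, h _ _ (Ne.symm hac) (Ne.symm had) h2⟩
  · exact .inr (.inl ⟨h _ _ (Ne.symm hac) (Ne.symm had) h1, h _ _ (Ne.symm had) (Ne.symm hab) h2⟩)
  · exact .inr (.inr ⟨h _ _ (Ne.symm had) (Ne.symm hab) h1, h _ _ (Ne.symm hab) (Ne.symm hac) h2⟩)

/-- At a vertex of degree three, one triple determines the rotation. -/
theorem cycAt_of_three [Finite (Dart G)] {v : α} {a b c : β} (ha : G.Inc a v) (hb : G.Inc b v)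
    (hc : G.Inc c v) (hab : a ≠ b) (hac : a ≠ c) (hbc : b ≠ c)
    (hall : ∀ e, G.Inc e v → e = a ∨ e = b ∨ e = c)
    (h : σ.CycAt v a b c ↔ τ.CycAt v a b c) {x y w : β}
    (hσ : σ.CycAt v x y w) : τ.CycAt v x y w := by
  refine cycAt_of_base ha (fun x y hx hy hxy => ?_) hσ
  obtain ⟨-, h2, h3⟩ := hxy.inc
  obtain ⟨-, -, hne⟩ := hxy.ne
  rcases hall x h2 with rfl | rfl | rfl
  · exact absurd rfl hx
  · rcases hall y h3 with rfl | rfl | rfl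
    · exact absurd rfl hy
    · exact absurd rfl hne
    · exact h.1 hxy
  · rcases hall y h3 with rfl | rfl | rfl
    · exact absurd rfl hy
    · rw [← not_cycAt_iff ha hb hc hab hac hbc] at hxy ⊢
      exact fun h' => hxy (h.2 h')
    · exact absurd rfl hne

theorem not_cycAt_of_two [Finite (Dart G)] {v : α} {a b : β}
    (hall : ∀ e, G.Inc e v → e = a ∨ e = b) {x y w : β} : ¬ σ.CycAt v x y w := by
  intro h
  obtain ⟨h1, h2, h3⟩ := h.inc
  obtain ⟨n1, n2, n3⟩ := h.ne
  rcases hall x h1 with rfl | rfl <;> rcases hall y h2 with rfl | rfl <;>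
    rcases hall w h3 with rfl | rfl <;> simp_all

theorem rot_eq_of_cycAt [Finite (Dart G)]
    (h : ∀ v a b c, σ.CycAt v a b c → τ.CycAt v a b c) : σ.rot = τ.rot := by
  refine perm_eq_of_cyclicOrd (fun a b hab => τ.sameCycle _ _ (σ.vertex_eq_of_sameCycle hab))
    (fun a b hab => σ.sameCycle _ _ (τ.vertex_eq_of_sameCycle hab)) fun a b c habc => ?_
  have hv := CycAt.vertices habc
  exact (cycAt_iff hv.1 hv.2).1 (h _ _ _ _ ((cycAt_iff hv.1 hv.2).2 habc))

end RotationSystem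

end Determined

section Village

variable {s : ℕ} {I : Finset ℕ}

theorem village_inc {e : VillageEdge} {x : VillageVertex} : (village s I).Inc e x ↔
    e ∈ villageEdges s I ∧ (x = (villageEnds s e).1 ∨ x = (villageEnds s e).2) := by
  constructor
  · rintro ⟨y, he, h | h⟩ <;> rw [h] <;> simp [he]
  · rintro ⟨he, rfl | rfl⟩
    · exact ⟨_, he, .inl rfl⟩
    · exact ⟨_, he, .inr rfl⟩

theorem village_inc_centre {e : VillageEdge} (h : (village s I).Inc e .centre) :
    ∃ k, e = .spoke k := by
  rw [village_inc] at h
  rcases h with ⟨-, h⟩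
  cases e with
  | spoke k => exact ⟨k, rfl⟩
  | rim k => simp [villageEnds] at h
  | wall i k => simp [villageEnds, houseVertex] at h; grind
  | claw i k => simp [villageEnds, houseVertex] at h; grind

theorem village_inc_inhabitant {e : VillageEdge} {i : ℕ}
    (h : (village s I).Inc e (.inhabitant i)) :
    e = .claw i 2 ∨ e = .claw i 4 ∨ e = .claw i 6 := by
  rw [village_inc] at h
  rcases h with ⟨he, h⟩
  cases e with
  | spoke k => simp [villageEnds] at h
  | rim k => simp [villageEnds] at h
  | wall i k => simp [villageEnds, houseVertex] at h; grind
  | claw j k =>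
    have := claw_mem.1 he
    simp [villageEnds, houseVertex] at h
    grind

theorem village_inc_surface {e : VillageEdge} {k : ℕ}
    (h : (village s I).Inc e (.surface k)) :
    e = .spoke k ∨ e = .rim k ∨ (e = .rim (k - 1) ∧ 1 < k) ∨ (e = .rim (4 * s) ∧ k = 1) ∨
      (∃ i, i ∈ I ∧ i ∈ Finset.Icc 1 s ∧
        (e = .wall i 1 ∧ k = 4 * i - 3 ∨ e = .wall i 6 ∧ k = 4 * i - 1)) := by
  rw [village_inc] at h
  rcases h with ⟨he, h⟩
  cases e with
  | spoke k => simp [villageEnds] at h; simp [h]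
  | rim k => simp only [rim_mem] at he; simp [villageEnds] at h; grind
  | wall i k =>
    have := wall_mem.1 he
    simp only [villageEnds, houseVertex] at h
    grind
  | claw i k =>
    have := claw_mem.1 he
    simp [villageEnds, houseVertex] at h
    grind

theorem village_inc_wall {e : VillageEdge} {i k : ℕ}
    (h : (village s I).Inc e (.wall i k)) :
    i ∈ I ∧ i ∈ Finset.Icc 1 s ∧ 2 ≤ k ∧ k ≤ 6 ∧
    ((e = .wall i k) ∨ e = .wall i (k - 1) ∨ (e = .claw i k ∧ (k = 2 ∨ k = 4 ∨ k = 6))) := by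
  rw [village_inc] at h
  rcases h with ⟨he, h⟩
  cases e with
  | spoke k => simp [villageEnds] at h
  | rim k => simp [villageEnds] at h
  | wall j l =>
    have h1 := wall_mem.1 he
    have h2 : j = i ∧ (l = k ∨ k = l + 1) ∧ 2 ≤ k ∧ k ≤ 6 := by
      simp only [villageEnds, houseVertex] at h
      grind
    obtain ⟨rfl, rfl | rfl, h3, h4⟩ := h2
    · exact ⟨h1.1, h1.2.1, h3, h4, .inl rfl⟩
    · exact ⟨h1.1, h1.2.1, h3, h4, .inr (.inl (by simp))⟩
  | claw i k =>
    have := claw_mem.1 he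
    simp [villageEnds, houseVertex] at h
    grind

/-- An embedding of a village is determined by the embedding of the planet and by the rotations at
the inhabitants. -/
theorem village_rot_eq [Finite (Dart (village s I))] [(village s I).Loopless]
    {σ τ : RotationSystem (village s I)}
    (hσ : σ.HasPotentialsOn Set.univ) (hτ : τ.HasPotentialsOn Set.univ)
    (hplanet : ∀ v e₁ e₂ e₃, e₁ ∈ E(planet s) → e₂ ∈ E(planet s) → e₃ ∈ E(planet s) →
      (σ.CycAt v e₁ e₂ e₃ ↔ τ.CycAt v e₁ e₂ e₃))
    (hinh : ∀ i ∈ I, i ∈ Finset.Icc 1 s →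
      (σ.CycAt (.inhabitant i) (.claw i 2) (.claw i 4) (.claw i 6) ↔
        τ.CycAt (.inhabitant i) (.claw i 2) (.claw i 4) (.claw i 6))) : σ.rot = τ.rot := by
  have hp_spoke : ∀ {k}, 1 ≤ k → k ≤ 4 * s → VillageEdge.spoke k ∈ E(planet s) :=
    fun h1 h2 => ⟨h1, h2⟩
  have hp_rim : ∀ {k}, 1 ≤ k → k ≤ 4 * s → VillageEdge.rim k ∈ E(planet s) :=
    fun h1 h2 => ⟨h1, h2⟩
  refine RotationSystem.rot_eq_of_cycAt fun v a b c h => ?_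
  obtain ⟨ha, hb, hc⟩ := h.inc
  cases v with
  | centre =>
    obtain ⟨k1, rfl⟩ := village_inc_centre ha
    obtain ⟨k2, rfl⟩ := village_inc_centre hb
    obtain ⟨k3, rfl⟩ := village_inc_centre hc
    exact (hplanet _ _ _ _ ha.edge_mem hb.edge_mem hc.edge_mem).1 h
  | inhabitant i =>
    have hi : i ∈ I ∧ i ∈ Finset.Icc 1 s := by
      rcases village_inc_inhabitant ha with rfl | rfl | rfl <;>
        exact ⟨(claw_mem.1 ha.edge_mem).1, (claw_mem.1 ha.edge_mem).2.1⟩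
    refine RotationSystem.cycAt_of_three (a := .claw i 2) (b := .claw i 4) (c := .claw i 6)
      ?_ ?_ ?_ ?_ ?_ ?_ (fun e => village_inc_inhabitant) (hinh i hi.1 hi.2) h
    all_goals simp [village_inc, hi, villageEnds]
  | surface k =>
    have hk : 1 ≤ k ∧ k ≤ 4 * s := ha.vertex_mem
    -- With the spoke as base, a pair of further edges either belongs to the planet or consists of a
    -- rim edge and a wall. In the latter case its order is read off from spokes at the centre.
    refine RotationSystem.cycAt_of_base (a := .spoke k) ?_ (fun x y hx hy hxy => ?_) h
    · simp [village_inc, hk, villageEnds]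
    obtain ⟨hsp, hx', hy'⟩ := hxy.inc
    have hne := hxy.ne
    -- the pairs of a rim edge and a wall edge
    have main : ∀ {x y : VillageEdge}, (village s I).Inc x (.surface k) →
        (village s I).Inc y (.surface k) → x ≠ .spoke k → y ≠ .spoke k → x ≠ y →
        (∃ l, x = .rim l) →
        (σ.CycAt (.surface k) (.spoke k) x y ↔ τ.CycAt (.surface k) (.spoke k) x y) := by
      intro x y hx hy hxs hys hxy hl
      have h1 := village_inc_surface hx
      have h2 := village_inc_surface hy
      obtain ⟨l, rfl⟩ := hl
      have hl' := rim_mem.1 hx.edge_mem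
      by_cases hyp : y ∈ E(planet s)
      · exact hplanet _ _ _ _ (hp_spoke hk.1 hk.2) (hp_rim hl'.1 hl'.2) hyp
      have hrim : ∀ k, y ≠ .rim k := by
        rintro k rfl
        exact hyp hy.edge_mem
      simp only [hys, hrim, false_and, false_or] at h2
      obtain ⟨i, hi, hs, ⟨rfl, rfl⟩ | ⟨rfl, rfl⟩⟩ := h2
      · have hs' := Finset.mem_Icc.1 hs
        by_cases hll : l = 4 * i - 3
        · subst hll
          rw [cycAt_first_surface_next hσ hi hs, cycAt_first_surface_next hτ hi hs]
          exact hplanet _ _ _ _ (hp_spoke (by omega) (by omega)) (hp_spoke (by omega) (by omega))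
            (hp_spoke (by omega) (by omega))
        · have hll' : l = 4 * i - 4 ∧ 1 < i ∨ l = 4 * s ∧ i = 1 := by
            rcases h1 with h | h | ⟨h, h'⟩ | ⟨h, h'⟩ | ⟨j, -, -, ⟨h, -⟩ | ⟨h, -⟩⟩ <;>
              simp only [VillageEdge.rim.injEq, reduceCtorEq] at h
            · omega
            · omega
            · omega
          rw [cycAt_first_surface_prev hσ hi hs hll', cycAt_first_surface_prev hτ hi hs hll']
          exact hplanet _ _ _ _ (hp_spoke (by omega) (by omega)) (hp_spoke (by omega) (by omega))
            (hp_spoke (by omega) (by omega))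
      · have hs' := Finset.mem_Icc.1 hs
        by_cases hll : l = 4 * i - 1
        · subst hll
          rw [cycAt_last_surface_next hσ hi hs, cycAt_last_surface_next hτ hi hs]
          exact hplanet _ _ _ _ (hp_spoke (by omega) (by omega)) (hp_spoke (by omega) (by omega))
            (hp_spoke (by omega) (by omega))
        · have hll' : l = 4 * i - 2 := by
            rcases h1 with h | h | ⟨h, h'⟩ | ⟨h, h'⟩ | ⟨j, -, -, ⟨h, -⟩ | ⟨h, -⟩⟩ <;>
              simp only [VillageEdge.rim.injEq, reduceCtorEq] at h
            · omega
            · omega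
            · omega
          subst hll'
          rw [cycAt_last_surface_prev hσ hi hs, cycAt_last_surface_prev hτ hi hs]
          exact hplanet _ _ _ _ (hp_spoke (by omega) (by omega)) (hp_spoke (by omega) (by omega))
            (hp_spoke (by omega) (by omega))
    by_cases hxr : ∃ l, x = .rim l
    · exact (main hx' hy' hx hy hne.2.2 hxr).1 hxy
    by_cases hyr : ∃ l, y = .rim l
    · have := main hy' hx' hy hx hne.2.2.symm hyr
      rw [← RotationSystem.not_cycAt_iff hsp hy' hx' hne.2.1 hne.1 hne.2.2.symm] at hxy ⊢
      rwa [← this]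
    -- Two different walls never end at the same surface vertex, as `4 * i - 3` and `4 * j - 1` are
    -- different modulo 4.
    · exfalso
      have h1 := village_inc_surface hx'
      have h2 := village_inc_surface hy'
      simp only [not_exists] at hxr hyr
      simp only [hx, hy, hxr, hyr, false_and, false_or] at h1 h2
      obtain ⟨i, -, hs, h1⟩ := h1
      obtain ⟨j, -, hs', h2⟩ := h2
      have := Finset.mem_Icc.1 hs
      have := Finset.mem_Icc.1 hs'
      rcases h1 with ⟨rfl, h1⟩ | ⟨rfl, h1⟩ <;> rcases h2 with ⟨rfl, h2⟩ | ⟨rfl, h2⟩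
      · exact hne.2.2 (by rw [show i = j by omega])
      · omega
      · omega
      · exact hne.2.2 (by rw [show i = j by omega])
  | wall i k =>
    obtain ⟨hi, hs, hk1, hk2, -⟩ := village_inc_wall ha
    have hall : ∀ e, (village s I).Inc e (.wall i k) →
        (e = .wall i k) ∨ e = .wall i (k - 1) ∨ (e = .claw i k ∧ (k = 2 ∨ k = 4 ∨ k = 6)) :=
      fun e he => (village_inc_wall he).2.2.2.2
    have h2 := (cycAt_inhabitant_wall_two hσ hi hs).symm.trans
      ((hinh i hi hs).trans (cycAt_inhabitant_wall_two hτ hi hs))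
    have h4 := (cycAt_inhabitant_wall_four hσ hi hs).symm.trans
      ((hinh i hi hs).trans (cycAt_inhabitant_wall_four hτ hi hs))
    have h6 := (cycAt_inhabitant_wall_six hσ hi hs).symm.trans
      ((hinh i hi hs).trans (cycAt_inhabitant_wall_six hτ hi hs))
    -- The vertices `v_2`, `v_4`, `v_6` have degree three, so a single triple decides, and it is
    -- given by the order at the inhabitant. At `v_3` and `v_5` there is nothing to decide.
    interval_cases k
    · refine RotationSystem.cycAt_of_three (a := .claw i 2) (b := .wall i 1) (c := .wall i 2)
        ?_ ?_ ?_ ?_ ?_ ?_ (fun e he => ?_) h2 h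
      case refine_7 => have := hall e he; grind
      all_goals simp [village_inc, hi, Finset.mem_Icc.1 hs, villageEnds, houseVertex]
    · refine absurd h (RotationSystem.not_cycAt_of_two (a := .wall i 3) (b := .wall i 2) ?_)
      intro e he
      have := hall e he
      grind
    · refine RotationSystem.cycAt_of_three (a := .wall i 3) (b := .wall i 4) (c := .claw i 4)
        ?_ ?_ ?_ ?_ ?_ ?_ (fun e he => ?_) h4 h
      case refine_7 => have := hall e he; grind
      all_goals simp [village_inc, hi, Finset.mem_Icc.1 hs, villageEnds, houseVertex]
    · refine absurd h (RotationSystem.not_cycAt_of_two (a := .wall i 5) (b := .wall i 4) ?_)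
      intro e he
      have := hall e he
      grind
    · refine RotationSystem.cycAt_of_three (a := .wall i 6) (b := .claw i 6) (c := .wall i 5)
        ?_ ?_ ?_ ?_ ?_ ?_ (fun e he => ?_) h6 h
      case refine_7 => have := hall e he; grind
      all_goals simp [village_inc, hi, Finset.mem_Icc.1 hs, villageEnds, houseVertex]

end Village

end

/-! ### The two sides of the bounding cycle of a house -/

section

section Sides

variable {α β : Type*} {G : Graph α β}

/-- The adjacency relation of darts whose equivalence classes are the sides of `C`. -/
def SideStep (σ : RotationSystem G) (C : Set β) (a b : Dart G) : Prop :=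
  b = σ.face a ∨ (a.edge ∉ C ∧ b = a.rev)

open Relation

/-- Turning past a dart that is not in `C` amounts to crossing its edge and taking one step along a
face. So everything between two consecutive darts of the cycle at a vertex is on one side. -/
theorem eqvGen_sideStep_of_steps_le [Finite (Dart G)] {σ : RotationSystem G} {C : Set β}
    {x y u : Dart G}
    (hC : ∀ d : Dart G, d.vertex = x.vertex → d ≠ x → d ≠ y → d.edge ∉ C) (hu : u ≠ x)
    (hux : u.vertex = x.vertex) (hle : steps σ.rot x u ≤ steps σ.rot x y) :
    EqvGen (SideStep σ C) x.rev u := by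
  have h1 := pow_steps (σ.sameCycle x u hux.symm)
  obtain ⟨k, hk⟩ : ∃ k, steps σ.rot x u = k + 1 := by
    refine Nat.exists_eq_succ_of_ne_zero fun h => hu ?_
    rw [h] at h1
    exact h1.symm
  have key : ∀ j, j + 1 ≤ steps σ.rot x u →
      EqvGen (SideStep σ C) x.rev ((σ.rot ^ (j + 1)) x) := by
    intro j
    induction j with
    | zero =>
      intro _
      refine .rel _ _ (.inl ?_)
      rw [σ.face_apply, Dart.rev_rev]
      rfl
    | succ j ih =>
      intro hj
      refine (ih (by omega)).trans _ _ _ ?_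
      set d := (σ.rot ^ (j + 1)) x with hd
      have hdx : d ≠ x := by
        intro h
        have h2 : (σ.rot ^ (steps σ.rot x u - (j + 1))) d = u := by
          rw [hd, ← pow_add_apply, Nat.sub_add_cancel (by omega), h1]
        rw [h] at h2
        have := steps_le h2
        omega
      have hdy : d ≠ y := by
        intro h
        have := steps_le (hd.symm.trans h)
        omega
      have hdC := hC d (σ.vertex_pow _ _) hdx hdy
      refine (EqvGen.rel _ _ (.inr ⟨hdC, rfl⟩)).trans _ _ _ (.rel _ _ (.inl ?_))
      rw [σ.face_apply, Dart.rev_rev, pow_succ', Equiv.Perm.mul_apply]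
  rw [← h1, hk]
  exact key k hk.ge

/-- A potential is constant along faces, and it does not change across the edges on which `z`
vanishes. Hence it is an invariant of the sides of `C`. -/
theorem RotationSystem.IsPotential.eq_of_eqvGen {σ : RotationSystem G} {C : Set β}
    {z p : Dart G → ℚ} (hp : σ.IsPotential z p) (hz : ∀ d, z d.rev = - z d)
    (hC : ∀ d, d.edge ∉ C → z d = 0)
    {a b : Dart G} (h : EqvGen (SideStep σ C) a b) : p a = p b := by
  induction h with
  | rel a b h =>
    rcases h with rfl | ⟨h, rfl⟩
    · rw [σ.face_apply, (hp _).1, (hp a).2, hz]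
      ring
    · rw [(hp a).2, hC a h, sub_zero]
  | refl => rfl
  | symm _ _ _ ih => exact ih.symm
  | trans _ _ _ _ _ ih1 ih2 => exact ih1.trans ih2

theorem RotationSystem.CycAt.steps_le [Finite (Dart G)] {σ : RotationSystem G} {x u y : Dart G}
    (hu : u.vertex = x.vertex) (hy : y.vertex = x.vertex)
    (h : σ.CycAt x.vertex x.edge u.edge y.edge) : steps σ.rot x u ≤ steps σ.rot x y :=
  ((cycAt_iff hu hy).1 h).2.2.2.le

end Sides

section Village

variable {s : ℕ} {I : Finset ℕ} {i : ℕ}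

/-- The potential of the flow around the bounding cycle takes different values on the two sides, so
being on the same side forces the orders at `v_2` and at `s_{4i-2}` to match. If they match, then an
explicit chain leads along the cycle from the spoke at `s_{4i-2}` past `s_{4i-3}` to the edge
between `v_2` and the inhabitant. -/
theorem sideStep_iff_cycAt [Finite (Dart (village s I))] [(village s I).Loopless]
    {σ : RotationSystem (village s I)}
    (hσ : σ.HasPotentialsOn Set.univ) (hi : i ∈ I) (hs : i ∈ Finset.Icc 1 s) :
    (∃ d d' : Dart (village s I), d.vertex = .centre ∧ d'.vertex = .inhabitant i ∧
      Relation.EqvGen (SideStep σ (boundingCycle i)) d d') ↔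
    (σ.CycAt (.wall i 2) (.claw i 2) (.wall i 1) (.wall i 2) ↔
      σ.CycAt (.surface (4 * i - 2)) (.spoke (4 * i - 2)) (.rim (4 * i - 2)) (.rim (4 * i - 3))) := by
  have hs' := Finset.mem_Icc.1 hs
  have n1 : 4 * i - 3 ≠ 4 * i - 2 := by omega
  have n2 : 4 * i - 2 ≠ 4 * i - 1 := by omega
  have n3 : 4 * i - 3 ≠ 4 * i - 1 := by omega
  have e1 : 4 * i - 3 + 1 = 4 * i - 2 := by omega
  have e2 : 4 * i - 2 + 1 = 4 * i - 1 := by omega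
  have m1 : 4 * i - 3 ≠ 4 * s := by omega
  have m2 : 4 * i - 2 ≠ 4 * s := by omega
  set C := boundingCycle i with hC
  set l : List (VillageEdge × VillageVertex) :=
    [(.wall i 1, .surface (4 * i - 3)), (.rim (4 * i - 3), .surface (4 * i - 2)),
      (.rim (4 * i - 2), .surface (4 * i - 1)), (.wall i 6, .wall i 6), (.wall i 5, .wall i 5),
      (.wall i 4, .wall i 4), (.wall i 3, .wall i 3), (.wall i 2, .wall i 2)] with hl
  have hw : IsWalk (village s I) (.wall i 2) l (.wall i 2) := by
    simp [IsWalk, village_isLink, villageEnds, houseVertex, *]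
    omega
  let z : Dart (village s I) → ℚ := fun d => flow (.wall i 2) l d.vertex d.edge
  have hz : IsCirculation z := by
    have := Fintype.ofFinite (Dart (village s I))
    refine ⟨fun d => flow_antisymm hw d, fun x => ?_⟩
    rw [finsum_eq_sum_of_fintype, sum_flow hw, sub_self]
  obtain ⟨p, hp⟩ := hσ z hz (fun d hd => absurd trivial hd)
  have hzC : ∀ d : Dart (village s I), d.edge ∉ C → z d = 0 := by
    intro d hd
    have h1 : ∀ k, 1 ≤ k → k ≤ 6 → d.edge ≠ .wall i k := fun k h1 h2 h =>
      hd (.inl ⟨k, h1, h2, h⟩)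
    have h2 : d.edge ≠ .rim (4 * i - 3) := fun h => hd (.inr (.inl h))
    have h3 : d.edge ≠ .rim (4 * i - 2) := fun h => hd (.inr (.inr h))
    simp [z, hl, flow, h1, h2, h3]
  have link : ∀ {e x y}, e ∈ villageEdges s I → villageEnds s e = (x, y) →
      (village s I).IsLink e x y := fun h1 h2 => ⟨h1, .inl h2⟩
  have lw1 : (village s I).IsLink (.wall i 1) (.surface (4 * i - 3)) (.wall i 2) :=
    link (by simp [hi, hs'.1, hs'.2]) (by simp [villageEnds, houseVertex])
  have lw2 : (village s I).IsLink (.wall i 2) (.wall i 2) (.wall i 3) :=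
    link (by simp [hi, hs'.1, hs'.2]) (by simp [villageEnds, houseVertex])
  have lc : (village s I).IsLink (.claw i 2) (.inhabitant i) (.wall i 2) :=
    link (by simp [hi, hs'.1, hs'.2]) (by simp [villageEnds, houseVertex])
  have ls : (village s I).IsLink (.spoke (4 * i - 2)) .centre (.surface (4 * i - 2)) :=
    link (by simp; omega) (by simp [villageEnds])
  have lr1 : (village s I).IsLink (.rim (4 * i - 3)) (.surface (4 * i - 3))
      (.surface (4 * i - 2)) :=
    link (by simp; omega) (by simp [villageEnds, m1, e1])
  have lr2 : (village s I).IsLink (.rim (4 * i - 2)) (.surface (4 * i - 2))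
      (.surface (4 * i - 1)) :=
    link (by simp; omega) (by simp [villageEnds, m2, e2])
  -- the edges of the cycle at three of its vertices
  have cv2 : ∀ d : Dart (village s I), d.vertex = .wall i 2 → d ≠ dartOf lw1.symm → d ≠ dartOf lw2 →
      d.edge ∉ C := by
    intro d hd h1 h2 h3
    have hinc := d.inc
    rw [hd] at hinc
    rcases (village_inc_wall hinc).2.2.2.2 with h | h | ⟨h, -⟩
    · exact h2 (Dart.ext hd h)
    · exact h1 (Dart.ext hd h)
    · simp [C, boundingCycle, h] at h3
  have cv1 : ∀ d : Dart (village s I), d.vertex = .surface (4 * i - 3) → d ≠ dartOf lw1 →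
      d ≠ dartOf lr1 → d.edge ∉ C := by
    intro d hd h1 h2 h3
    have hinc := d.inc
    rw [hd] at hinc
    rcases h3 with ⟨k, hk1, hk2, hk⟩ | h3 | h3
    · rcases village_inc_surface hinc with h | h | ⟨h, -⟩ | ⟨h, -⟩ | ⟨j, -, -, ⟨h, h'⟩ | ⟨h, h'⟩⟩ <;>
        rw [h] at hk <;> simp only [reduceCtorEq, VillageEdge.wall.injEq] at hk
      · exact h1 (Dart.ext hd (by rw [h, hk.1]; rfl))
      · omega
    · exact h2 (Dart.ext hd h3)
    · rw [h3, village_inc] at hinc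
      simp [villageEnds] at hinc
      grind
  have cm : ∀ d : Dart (village s I), d.vertex = .surface (4 * i - 2) → d ≠ dartOf lr1.symm →
      d ≠ dartOf lr2 → d.edge ∉ C := by
    intro d hd h1 h2 h3
    have hinc := d.inc
    rw [hd] at hinc
    rcases h3 with ⟨k, hk1, hk2, hk⟩ | h3 | h3
    · rcases village_inc_surface hinc with h | h | ⟨h, -⟩ | ⟨h, -⟩ | ⟨j, -, -, ⟨h, h'⟩ | ⟨h, h'⟩⟩ <;>
        rw [h] at hk <;> simp only [reduceCtorEq, VillageEdge.wall.injEq] at hk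
      · omega
      · omega
    · exact h1 (Dart.ext hd h3)
    · exact h2 (Dart.ext hd h3)
  have ne : ∀ {e e' x y x' y'} {h : (village s I).IsLink e x y} {h' : (village s I).IsLink e' x' y'},
      e ≠ e' → dartOf h ≠ dartOf h' := fun hne h => hne (congrArg Dart.edge h)
  have tot2 := RotationSystem.not_cycAt_iff (σ := σ) lc.inc_right lw1.inc_right lw2.inc_left
    (by simp) (by simp) (by simp)
  have totm := RotationSystem.not_cycAt_iff (σ := σ) ls.inc_right lr2.inc_left lr1.inc_right
    (by simp) (by simp) (by simp [n1.symm])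
  -- orders as inequalities
  have A1 : σ.CycAt (.wall i 2) (.claw i 2) (.wall i 1) (.wall i 2) →
      steps σ.rot (dartOf lw2) (dartOf lc.symm) ≤ steps σ.rot (dartOf lw2) (dartOf lw1.symm) :=
    fun h => RotationSystem.CycAt.steps_le rfl rfl h.rotate.rotate
  have A2 : σ.CycAt (.wall i 2) (.claw i 2) (.wall i 2) (.wall i 1) →
      steps σ.rot (dartOf lw1.symm) (dartOf lc.symm) ≤
        steps σ.rot (dartOf lw1.symm) (dartOf lw2) :=
    fun h => RotationSystem.CycAt.steps_le rfl rfl h.rotate.rotate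
  have B1 : σ.CycAt (.surface (4 * i - 2)) (.spoke (4 * i - 2)) (.rim (4 * i - 2))
      (.rim (4 * i - 3)) →
      steps σ.rot (dartOf lr1.symm) (dartOf ls.symm) ≤
        steps σ.rot (dartOf lr1.symm) (dartOf lr2) :=
    fun h => RotationSystem.CycAt.steps_le rfl rfl h.rotate.rotate
  have B2 : σ.CycAt (.surface (4 * i - 2)) (.spoke (4 * i - 2)) (.rim (4 * i - 3))
      (.rim (4 * i - 2)) →
      steps σ.rot (dartOf lr2) (dartOf ls.symm) ≤
        steps σ.rot (dartOf lr2) (dartOf lr1.symm) :=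
    fun h => RotationSystem.CycAt.steps_le rfl rfl h.rotate.rotate
  constructor
  · rintro ⟨d, d', hd, hd', h⟩
    have h1 := hp.eq_of_eqvGen hz.antisymm hzC h
    have zc : ∀ d : Dart (village s I), d.vertex = .centre → z d = 0 := by
      intro d h
      simp [z, hl, flow, h]
    have zi : ∀ d : Dart (village s I), d.vertex = .inhabitant i → z d = 0 := by
      intro d h
      simp [z, hl, flow, h]
    have hd1 : p d = p (dartOf ls.symm) := by
      have h2 : p (dartOf ls) = p (dartOf ls.symm) := by
        rw [← dartOf_rev ls, (hp _).2, zc (dartOf ls) rfl, sub_zero]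
      rw [← h2]
      by_cases hdd : d = dartOf ls
      · rw [hdd]
      · rw [hp.eq_of_steps_le (x := dartOf ls) (y := d) (u := d) hd
          (fun d h _ _ => zc d h) hdd hd le_rfl, zc _ rfl, sub_zero]
    have hd2 : p d' = p (dartOf lc.symm) := by
      have h2 : p (dartOf lc) = p (dartOf lc.symm) := by
        rw [← dartOf_rev lc, (hp _).2, zi (dartOf lc) rfl, sub_zero]
      rw [← h2]
      by_cases hdd : d' = dartOf lc
      · rw [hdd]
      · rw [hp.eq_of_steps_le (x := dartOf lc) (y := d') (u := d') hd'
          (fun d h _ _ => zi d h) hdd hd' le_rfl, zi _ rfl, sub_zero]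
    rw [hd1, hd2] at h1
    have z1 : z (dartOf lw1.symm) = 1 := by simp [z, hl, flow]
    have z2 : z (dartOf lw2) = -1 := by simp [z, hl, flow]
    have z3 : z (dartOf lw1) = -1 := by simp [z, hl, flow]
    have z4 : z (dartOf lr1) = 1 := by simp [z, hl, flow, n1, n3]
    have z5 : z (dartOf lr1.symm) = -1 := by simp [z, hl, flow, n1, n1.symm, n2]
    have z6 : z (dartOf lr2) = 1 := by simp [z, hl, flow, n1.symm, n2]
    have p1 := (hp (dartOf lw1.symm)).2
    rw [dartOf_rev, z1] at p1
    have p2 := hp.eq_of_steps_le (x := dartOf lw1) (y := dartOf lr1) (u := dartOf lr1) rfl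
      (fun d h h1 h2 => hzC _ (cv1 d h h1 h2)) (ne (by simp)) rfl le_rfl
    have p3 := (hp (dartOf lr1)).2
    rw [dartOf_rev, z4] at p3
    have p4 := hp.eq_of_steps_le (x := dartOf lr1.symm) (y := dartOf lr2) (u := dartOf lr2) rfl
      (fun d h h1 h2 => hzC _ (cm d h h1 h2)) (ne (by simp [n1.symm])) rfl le_rfl
    have p5 := hp.eq_of_steps_le (x := dartOf lw1.symm) (y := dartOf lw2) (u := dartOf lw2) rfl
      (fun d h h1 h2 => hzC _ (cv2 d h h1 h2)) (ne (by simp)) rfl le_rfl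
    have qA1 := fun h => hp.eq_of_steps_le (x := dartOf lw2) (y := dartOf lw1.symm)
      (u := dartOf lc.symm) rfl (fun d h h1 h2 => hzC _ (cv2 d h h2 h1)) (ne (by simp)) rfl (A1 h)
    have qA2 := fun h => hp.eq_of_steps_le (x := dartOf lw1.symm) (y := dartOf lw2)
      (u := dartOf lc.symm) rfl (fun d h h1 h2 => hzC _ (cv2 d h h1 h2)) (ne (by simp)) rfl (A2 h)
    have qB1 := fun h => hp.eq_of_steps_le (x := dartOf lr1.symm) (y := dartOf lr2)
      (u := dartOf ls.symm) rfl (fun d h h1 h2 => hzC _ (cm d h h1 h2)) (ne (by simp)) rfl (B1 h)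
    have qB2 := fun h => hp.eq_of_steps_le (x := dartOf lr2) (y := dartOf lr1.symm)
      (u := dartOf ls.symm) rfl (fun d h h1 h2 => hzC _ (cm d h h2 h1)) (ne (by simp)) rfl (B2 h)
    rw [z3] at p2
    rw [z5] at p4 qB1
    rw [z1] at p5 qA2
    rw [z2] at qA1
    rw [z6] at qB2
    -- In the mixed cases the potential at the spoke and at the edge of the inhabitant would differ
    -- by one.
    constructor
    · intro hA
      by_contra hB
      have := qA1 hA
      have := qB2 (totm.1 hB)
      linarith
    · intro hB
      by_contra hA
      have := qB1 hB
      have := qA2 (tot2.1 hA)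
      linarith
  · intro h
    refine ⟨dartOf ls, dartOf lc, rfl, rfl, ?_⟩
    have hs0 : Relation.EqvGen (SideStep σ C) (dartOf ls) (dartOf ls.symm) :=
      .rel _ _ (.inr ⟨by simp [C, boundingCycle], (dartOf_rev ls).symm⟩)
    have hc0 : Relation.EqvGen (SideStep σ C) (dartOf lc.symm) (dartOf lc) :=
      .rel _ _ (.inr ⟨by simp [C, boundingCycle], (dartOf_rev lc.symm).symm⟩)
    refine hs0.trans _ _ _ (.trans _ _ _ ?_ hc0)
    by_cases hA : σ.CycAt (.wall i 2) (.claw i 2) (.wall i 1) (.wall i 2)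
    · have hB := h.1 hA
      have r1 := eqvGen_sideStep_of_steps_le (σ := σ) (C := C) (x := dartOf lr1.symm) (y := dartOf lr2)
        (u := dartOf ls.symm) cm (ne (by simp)) rfl (B1 hB)
      have r2 := eqvGen_sideStep_of_steps_le (σ := σ) (C := C) (x := dartOf lw1) (y := dartOf lr1)
        (u := dartOf lr1) cv1 (ne (by simp)) rfl le_rfl
      have r3 := eqvGen_sideStep_of_steps_le (σ := σ) (C := C) (x := dartOf lw2)
        (y := dartOf lw1.symm) (u := dartOf lw1.symm) (fun d h h1 h2 => cv2 d h h2 h1)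
        (ne (by simp)) rfl le_rfl
      have r4 := eqvGen_sideStep_of_steps_le (σ := σ) (C := C) (x := dartOf lw2)
        (y := dartOf lw1.symm) (u := dartOf lc.symm) (fun d h h1 h2 => cv2 d h h2 h1)
        (ne (by simp)) rfl (A1 hA)
      rw [dartOf_rev] at r1 r2 r3 r4
      exact (r1.symm _ _).trans _ _ _ ((r2.symm _ _).trans _ _ _ ((r3.symm _ _).trans _ _ _ r4))
    · have hB := totm.1 fun hB => hA (h.2 hB)
      have r1 := eqvGen_sideStep_of_steps_le (σ := σ) (C := C) (x := dartOf lr2) (y := dartOf lr1.symm)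
        (u := dartOf ls.symm) (fun d h h1 h2 => cm d h h2 h1) (ne (by simp)) rfl (B2 hB)
      have r2 := eqvGen_sideStep_of_steps_le (σ := σ) (C := C) (x := dartOf lr2)
        (y := dartOf lr1.symm) (u := dartOf lr1.symm) (fun d h h1 h2 => cm d h h2 h1)
        (ne (by simp [n1])) rfl le_rfl
      have r3 := eqvGen_sideStep_of_steps_le (σ := σ) (C := C) (x := dartOf lr1) (y := dartOf lw1)
        (u := dartOf lw1) (fun d h h1 h2 => cv1 d h h2 h1) (ne (by simp)) rfl le_rfl
      have r4 := eqvGen_sideStep_of_steps_le (σ := σ) (C := C) (x := dartOf lw1.symm)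
        (y := dartOf lw2) (u := dartOf lc.symm) cv2 (ne (by simp)) rfl (A2 (tot2.1 hA))
      rw [dartOf_rev] at r1 r2 r3 r4
      exact (r1.symm _ _).trans _ _ _ (r2.trans _ _ _ (r3.trans _ _ _ r4))

/-- The house `H_i` has its inhabitant inside if and only if the rotation at the inhabitant
disagrees with the orientation of the planet. -/
theorem not_sameSide_iff [Finite (Dart (village s I))] [(village s I).Loopless]
    {σ : PlanarEmbedding (village s I)}
    (hσ : σ.HasPotentialsOn Set.univ) (hi : i ∈ I) (hs : i ∈ Finset.Icc 1 s) :
    ¬ σ.SameSide (boundingCycle i) .centre (.inhabitant i) ↔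
      (σ.CycAt (.inhabitant i) (.claw i 2) (.claw i 4) (.claw i 6) ↔
        σ.CycAt (.surface 2) (.spoke 2) (.rim 1) (.rim 2)) := by
  have hs' := Finset.mem_Icc.1 hs
  have h1 : σ.SameSide (boundingCycle i) .centre (.inhabitant i) ↔ _ := sideStep_iff_cycAt hσ hi hs
  have h2 := cycAt_surface hσ (k := 4 * i - 2) (by omega) (by omega)
  rw [show 4 * i - 2 - 1 = 4 * i - 3 by omega] at h2
  have h3 : ¬ σ.CycAt (.surface (4 * i - 2)) (.spoke (4 * i - 2)) (.rim (4 * i - 3))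
      (.rim (4 * i - 2)) ↔ σ.CycAt (.surface (4 * i - 2)) (.spoke (4 * i - 2)) (.rim (4 * i - 2))
      (.rim (4 * i - 3)) := by
    refine RotationSystem.not_cycAt_iff ?_ ?_ ?_ (by simp) (by simp) (by simp; omega)
    all_goals simp [village_inc, villageEnds]
    all_goals grind
  -- The orientation at `s_{4i-2}` is that at `s_2`, but it appears with the two rim edges
  -- exchanged. This negation cancels the one in the claim.
  rw [h1, ← cycAt_inhabitant_wall_two hσ hi hs, ← h3, h2]
  tauto

end Village

end

/-! ### Rotation systems given by lists of edges -/

section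

section Lists

variable {α β : Type*} {G H : Graph α β}

/-- Cyclically consecutive entries of the list are related. -/
def CycChain (R : β → β → Prop) : List β → Prop
  | [] => True
  | a :: l => (a :: (l ++ [a])).IsChain R

theorem CycChain.apply [DecidableEq β] {R : β → β → Prop} {l : List β} (h : CycChain R l)
    (hl : l.Nodup) {x : β} (hx : x ∈ l) : R x (l.formPerm x) := by
  obtain ⟨i, hi, rfl⟩ := List.getElem_of_mem hx
  rw [List.formPerm_apply_getElem _ hl]
  cases l with
  | nil => simp at hi
  | cons a l =>
    have h1 := List.isChain_iff_getElem.1 h i (by simpa using hi)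
    simp only [List.length_cons] at hi
    have h2 : (a :: (l ++ [a]))[i]'(by simp; omega) = (a :: l)[i] := by
      grind
    have h3 : (a :: (l ++ [a]))[i + 1]'(by simpa using hi) =
        (a :: l)[(i + 1) % (a :: l).length]'(Nat.mod_lt _ (by simp)) := by
      by_cases hil : i < l.length
      · simp only [List.length_cons, Nat.mod_eq_of_lt (show i + 1 < l.length + 1 by omega)]
        grind
      · have : i = l.length := by omega
        subst this
        simp
    rwa [h2, h3] at h1

/-- After rotating the list to begin with `x`, the next entry kept is the first one in the tail that
satisfies `p`; if there is none, the permutation comes back to `x`. So deleting entries from a list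
corresponds to passing to the first-return map, which is how induced embeddings are defined. -/
theorem formPerm_filter [DecidableEq β] (l : List β) (hl : l.Nodup) (p : β → Bool) {x : β}
    (hx : x ∈ l) (hp : p x) : ∃ k : ℕ, (l.filter p).formPerm x = (l.formPerm ^ (k + 1)) x ∧
      ∀ j < k, p ((l.formPerm ^ (j + 1)) x) = false := by
  obtain ⟨l₁, l₂, rfl⟩ := List.append_of_mem hx
  have hr : (l₁ ++ x :: l₂) ~r (x :: (l₂ ++ l₁)) := by
    rw [← List.cons_append]
    exact List.isRotated_append
  have hr' : (l₁ ++ x :: l₂).filter p ~r (x :: (l₂ ++ l₁).filter p) := by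
    have : x :: (l₂ ++ l₁).filter p = (x :: l₂).filter p ++ l₁.filter p := by
      simp [List.filter_append, hp]
    rw [this, List.filter_append]
    exact List.isRotated_append
  have hn : (x :: (l₂ ++ l₁)).Nodup := hr.nodup_iff.1 hl
  have hn' : (x :: (l₂ ++ l₁).filter p).Nodup := hr'.nodup_iff.1 (hl.filter _)
  rw [List.formPerm_eq_of_isRotated hl hr, List.formPerm_eq_of_isRotated (hl.filter _) hr']
  generalize l₂ ++ l₁ = m at hn hn'
  clear hr hr' hl hx
  have hpow := List.formPerm_pow_apply_head x m hn
  by_cases hm : ∃ y ∈ m, p y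
  · obtain ⟨m₁, y, m₂, rfl, h1, h2⟩ : ∃ m₁ y m₂, m = m₁ ++ y :: m₂ ∧ p y ∧
        ∀ z ∈ m₁, p z = false := by
      obtain ⟨y, hy, hpy⟩ := hm
      clear hpow hn hn'
      induction m with
      | nil => simp at hy
      | cons a m ih =>
        by_cases ha : p a
        · exact ⟨[], a, m, rfl, ha, by simp⟩
        · have hne : y ≠ a := by rintro rfl; exact ha hpy
          obtain ⟨m₁, y', m₂, rfl, h1, h2⟩ := ih ((List.mem_cons.1 hy).resolve_left hne)
          exact ⟨a :: m₁, y', m₂, rfl, h1, by simpa [ha] using h2⟩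
    refine ⟨m₁.length, ?_, fun j hj => ?_⟩
    · have hf : (m₁ ++ y :: m₂).filter p = y :: m₂.filter p := by
        rw [List.filter_append, List.filter_eq_nil_iff.2 (by simpa using h2), List.nil_append,
          List.filter_cons, if_pos h1]
      rw [hf] at hn' ⊢
      rw [List.formPerm_apply_head _ _ _ hn', hpow]
      simp only [List.length_append, List.length_cons]
      simp only [Nat.mod_eq_of_lt (show m₁.length + 1 < m₁.length + (m₂.length + 1) + 1 by omega)]
      simp
    · rw [hpow]
      simp only [List.length_append, List.length_cons]
      simp only [Nat.mod_eq_of_lt (show j + 1 < m₁.length + (m₂.length + 1) + 1 by omega)]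
      rw [List.getElem_cons_succ, List.getElem_append_left hj]
      exact h2 _ (List.getElem_mem _)
  · simp only [not_exists, not_and, Bool.not_eq_true] at hm
    refine ⟨m.length, ?_, fun j hj => ?_⟩
    · rw [List.filter_eq_nil_iff.2 (by simpa using hm), hpow]
      simp
    · rw [hpow]
      simp only [List.length_cons, Nat.mod_eq_of_lt (show j + 1 < m.length + 1 by omega)]
      rw [List.getElem_cons_succ]
      exact hm _ (List.getElem_mem _)

/-- The lists `L v` list, without repetition, the edges at the vertices `v` of `G`. -/
structure IsListing (L : α → List β) (G : Graph α β) : Prop where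
  nodup : ∀ v ∈ V(G), (L v).Nodup
  mem_iff : ∀ v ∈ V(G), ∀ e, e ∈ L v ↔ G.Inc e v

open Classical in
/-- The rotation system in which the darts at a vertex are ordered as in a list. -/
noncomputable def IsListing.rotationSystem {L : α → List β} (hL : IsListing L G) :
    RotationSystem G where
  rot :=
    { toFun := fun d => ⟨d.vertex, (L d.vertex).formPerm d.edge,
        (hL.mem_iff _ d.inc.vertex_mem _).1 (List.formPerm_apply_mem_of_mem ((hL.mem_iff _ d.inc.vertex_mem _).2 d.inc))⟩
      invFun := fun d => ⟨d.vertex, (L d.vertex).formPerm.symm d.edge, (hL.mem_iff _ d.inc.vertex_mem _).1 <| by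
        rw [← List.formPerm_mem_iff_mem, Equiv.apply_symm_apply]
        exact (hL.mem_iff _ d.inc.vertex_mem _).2 d.inc⟩
      left_inv := fun d => Dart.ext rfl (by simp)
      right_inv := fun d => Dart.ext rfl (by simp) }
  vertex_rot _ := rfl
  sameCycle d d' h := by
    obtain ⟨n, hn⟩ := (hL.nodup _ d.inc.vertex_mem).isCycleOn_formPerm.exists_pow_eq'
      (List.finite_toSet _) ((hL.mem_iff _ d.inc.vertex_mem _).2 d.inc) ((hL.mem_iff _ d.inc.vertex_mem _).2 (h ▸ d'.inc))
    refine sameCycle_of_pow (n := n) ?_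
    have key : ∀ e : Dart G, ∀ m, ((fun d : Dart G => (⟨d.vertex, (L d.vertex).formPerm d.edge,
        (hL.mem_iff _ d.inc.vertex_mem _).1 (List.formPerm_apply_mem_of_mem ((hL.mem_iff _ d.inc.vertex_mem _).2 d.inc))⟩ :
          Dart G))^[m] e).vertex = e.vertex ∧ ((fun d : Dart G => (⟨d.vertex,
        (L d.vertex).formPerm d.edge,
        (hL.mem_iff _ d.inc.vertex_mem _).1 (List.formPerm_apply_mem_of_mem ((hL.mem_iff _ d.inc.vertex_mem _).2 d.inc))⟩ :
          Dart G))^[m] e).edge = ((L e.vertex).formPerm ^ m) e.edge := by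
      intro e m
      induction m with
      | zero => exact ⟨rfl, rfl⟩
      | succ m ih =>
        rw [Function.iterate_succ_apply']
        refine ⟨ih.1, ?_⟩
        simp only [ih.1, ih.2, pow_succ', Equiv.Perm.mul_apply]
    rw [← Equiv.Perm.iterate_eq_pow]
    exact Dart.ext ((key d n).1.trans h) ((key d n).2.trans hn)

theorem IsListing.rot_edge [inst : DecidableEq β] {L : α → List β} (hL : IsListing L G) (d : Dart G) :
    (hL.rotationSystem.rot d).edge = (L d.vertex).formPerm d.edge := by
  obtain rfl : inst = fun a b => Classical.propDecidable (a = b) := Subsingleton.elim _ _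
  rfl

theorem IsListing.pow_rot_edge [DecidableEq β] {L : α → List β} (hL : IsListing L G) (d : Dart G)
    (n : ℕ) : ((hL.rotationSystem.rot ^ n) d).edge = ((L d.vertex).formPerm ^ n) d.edge := by
  induction n with
  | zero => rfl
  | succ n ih =>
    rw [pow_succ', Equiv.Perm.mul_apply, hL.rot_edge, RotationSystem.vertex_pow, ih, pow_succ',
      Equiv.Perm.mul_apply]

open Classical in
theorem IsListing.of_forall {L : α → List β} (hn : ∀ v ∈ V(G), (L v).Nodup)
    (hL : ∀ v ∈ V(G), ∀ e ∈ E(G), e ∈ L v ↔ G.Inc e v) :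
    IsListing (fun v => (L v).filter (· ∈ E(G))) G := by
  refine ⟨fun v hv => (hn v hv).filter _, fun v hv e => ?_⟩
  simp only [List.mem_filter, decide_eq_true_eq]
  constructor
  · rintro ⟨h1, h2⟩
    exact (hL v hv e h2).1 h1
  · intro h
    exact ⟨(hL v hv e h.edge_mem).2 h, h.edge_mem⟩

theorem IsListing.inducesRot {L L' : α → List β} (hL : IsListing L G) (hL' : IsListing L' H)
    (h : H ≤ G) (p : β → Bool) (hp : ∀ v e, G.Inc e v → (p e = true ↔ e ∈ E(H)))
    (hLL' : ∀ v ∈ V(H), L' v = (L v).filter p) :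
    (Mono.ofLE h).InducesRot hL.rotationSystem hL'.rotationSystem := by
  classical
  intro d
  have hd : G.Inc d.edge d.vertex := ⟨_, d.isLink.mono h⟩
  obtain ⟨k, h1, h2⟩ := formPerm_filter (L d.vertex) (hL.nodup _ (h.1 d.inc.vertex_mem)) p ((hL.mem_iff _ (h.1 d.inc.vertex_mem) _).2 hd)
    ((hp _ _ hd).2 d.inc.edge_mem)
  refine ⟨k, Dart.ext ?_ ?_, fun j hj hr => ?_⟩
  · rw [RotationSystem.vertex_pow]
    exact hL'.rotationSystem.vertex_rot d
  · rw [hL.pow_rot_edge]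
    refine Eq.trans ?_ h1
    rw [← hLL' _ d.inc.vertex_mem]
    exact hL'.rot_edge d
  · rw [Mono.mem_range_onDart_ofLE, hL.pow_rot_edge] at hr
    have h3 := h2 j hj
    have h4 : G.Inc (((L d.vertex).formPerm ^ (j + 1)) d.edge) d.vertex := by
      have h5 := ((hL.rotationSystem.rot ^ (j + 1)) ((Mono.ofLE h).onDart d)).inc
      rwa [hL.pow_rot_edge, RotationSystem.vertex_pow] at h5
    rw [Bool.eq_false_iff] at h3
    exact h3 ((hp _ _ h4).2 hr)

open Classical in
theorem IsListing.inducesRot_filter {L : α → List β} (h : H ≤ G)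
    (hG : IsListing (fun v => (L v).filter (· ∈ E(G))) G)
    (hH : IsListing (fun v => (L v).filter (· ∈ E(H))) H) :
    (Mono.ofLE h).InducesRot hG.rotationSystem hH.rotationSystem := by
  refine hG.inducesRot hH h (fun e => decide (e ∈ E(H))) (by simp) fun v _ => ?_
  simp only [List.filter_filter]
  refine List.filter_congr fun e _ => ?_
  have := h.edgeSet_mono
  by_cases he : e ∈ E(H) <;> simp [he]
  exact this he

/-- Being a union of faces is a condition on consecutive entries of each list, so for explicit lists
it can be checked entry by entry. -/
theorem IsListing.isFaceSet {L : α → List β} (hL : IsListing L G) {D : α → β → Prop}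
    (h : ∀ v ∈ V(G), CycChain (fun a b => ∀ u, G.IsLink a v u → (D v b ↔ D u a)) (L v)) :
    hL.rotationSystem.IsFaceSet {d | D d.vertex d.edge} := by
  classical
  intro d
  have h1 := (h d.vertex d.inc.vertex_mem).apply (hL.nodup _ d.inc.vertex_mem)
    ((hL.mem_iff _ d.inc.vertex_mem _).2 d.inc) _ d.isLink
  rw [← hL.rot_edge] at h1
  exact h1

end Lists

end

/-! ### Villages with coupled houses -/

section

/-- Edges of villages, with the edges used to couple the houses: `link i` joins the last inner wall
vertex of the house `H_i` to the first one of its partner, and `couple i` joins the middle of the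
walls of `H_i` to the inhabitant of its partner. -/
inductive XEdge
  | base (e : VillageEdge)
  | link (i : ℕ)
  | couple (i : ℕ)

variable {s K : ℕ} {μ : ℕ → ℕ}

/-- An involution of `{1, …, K}` without crossings. -/
structure IsNoncrossing (K : ℕ) (μ : ℕ → ℕ) : Prop where
  invol : ∀ i, μ (μ i) = i
  mem : ∀ i, μ i ≠ i → 1 ≤ i ∧ i ≤ K
  noncrossing : ∀ i x, i < x → x < μ i → i < μ x ∧ μ x < μ i

theorem IsNoncrossing.mem' (h : IsNoncrossing K μ) {i : ℕ} (hi : μ i ≠ i) :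
    1 ≤ μ i ∧ μ i ≤ K :=
  h.mem _ (by rw [h.invol]; exact hi.symm)

/-- The ends of the edges, when the partner of the house `H_i` is `H_{μ i}`. -/
def XEdge.ends (s : ℕ) (μ : ℕ → ℕ) : XEdge → VillageVertex × VillageVertex
  | base e => villageEnds s e
  | link i => (.wall i 6, .wall (μ i) 2)
  | couple i => (.wall i 4, .inhabitant (μ i))

/-- All the edges on the village with houses `H_1, …, H_K`. -/
def xEdges (s K : ℕ) (μ : ℕ → ℕ) : Set XEdge
  | .base e => e ∈ villageEdges s (Finset.Icc 1 K)
  | .link i => 1 ≤ i ∧ i < μ i ∧ μ i ≤ K ∧ μ i ≤ s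
  | .couple i => 1 ≤ i ∧ i < μ i ∧ μ i ≤ K ∧ μ i ≤ s

@[simp] theorem base_mem_xEdges {e : VillageEdge} :
    XEdge.base e ∈ xEdges s K μ ↔ e ∈ villageEdges s (Finset.Icc 1 K) := Iff.rfl

@[simp] theorem link_mem_xEdges {i : ℕ} :
    XEdge.link i ∈ xEdges s K μ ↔ 1 ≤ i ∧ i < μ i ∧ μ i ≤ K ∧ μ i ≤ s := Iff.rfl

@[simp] theorem couple_mem_xEdges {i : ℕ} :
    XEdge.couple i ∈ xEdges s K μ ↔ 1 ≤ i ∧ i < μ i ∧ μ i ≤ K ∧ μ i ≤ s := Iff.rfl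

section VertexMem

variable {I : Finset ℕ}

@[simp] theorem centre_mem : VillageVertex.centre ∈ villageVertices s I := trivial

@[simp] theorem surface_mem {k : ℕ} :
    VillageVertex.surface k ∈ villageVertices s I ↔ 1 ≤ k ∧ k ≤ 4 * s := Iff.rfl

@[simp] theorem wall_vertex_mem {i k : ℕ} : VillageVertex.wall i k ∈ villageVertices s I ↔
    i ∈ I ∧ i ∈ Finset.Icc 1 s ∧ 2 ≤ k ∧ k ≤ 6 := Iff.rfl

@[simp] theorem inhabitant_mem {i : ℕ} : VillageVertex.inhabitant i ∈ villageVertices s I ↔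
    i ∈ I ∧ i ∈ Finset.Icc 1 s := Iff.rfl

end VertexMem

theorem XEdge.ends_mem {e : XEdge} (he : e ∈ xEdges s K μ) :
    (e.ends s μ).1 ∈ villageVertices s (Finset.Icc 1 K) ∧
      (e.ends s μ).2 ∈ villageVertices s (Finset.Icc 1 K) := by
  cases e with
  | base e => exact villageEnds_mem s _ e he
  | link i =>
    rw [link_mem_xEdges] at he
    simp [XEdge.ends]
    omega
  | couple i =>
    rw [couple_mem_xEdges] at he
    simp [XEdge.ends]
    omega

/-- The village with houses `H_1, …, H_K`, with additional edges between partners: the edges in `F`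
of all these. -/
def coupledVillage (s K : ℕ) (μ : ℕ → ℕ) (F : Set XEdge) : Graph VillageVertex XEdge where
  vertexSet := villageVertices s (Finset.Icc 1 K)
  edgeSet := F ∩ xEdges s K μ
  IsLink e x y := e ∈ F ∩ xEdges s K μ ∧ (e.ends s μ = (x, y) ∨ e.ends s μ = (y, x))
  isLink_symm _ _ := ⟨fun _ _ h => ⟨h.1, h.2.symm⟩⟩
  eq_or_eq_of_isLink_of_isLink := by
    rintro e x y v w ⟨-, h | h⟩ ⟨-, h' | h'⟩ <;> rw [h] at h' <;> simp_all
  edge_mem_iff_exists_isLink e :=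
    ⟨fun he => ⟨_, _, he, Or.inl rfl⟩, fun ⟨_, _, h⟩ => h.1⟩
  left_mem_of_isLink := by
    rintro e x y ⟨he, h | h⟩
    · have := (XEdge.ends_mem he.2).1
      rwa [h] at this
    · have := (XEdge.ends_mem he.2).2
      rwa [h] at this

variable {F F' : Set XEdge}

@[simp] theorem vertexSet_coupledVillage :
    V(coupledVillage s K μ F) = villageVertices s (Finset.Icc 1 K) := rfl

@[simp] theorem edgeSet_coupledVillage : E(coupledVillage s K μ F) = F ∩ xEdges s K μ := rfl

theorem coupledVillage_isLink {e : XEdge} {x y : VillageVertex} :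
    (coupledVillage s K μ F).IsLink e x y ↔
      e ∈ F ∩ xEdges s K μ ∧ (e.ends s μ = (x, y) ∨ e.ends s μ = (y, x)) := Iff.rfl

theorem coupledVillage_inc {e : XEdge} {x : VillageVertex} : (coupledVillage s K μ F).Inc e x ↔
    e ∈ F ∩ xEdges s K μ ∧ (x = (e.ends s μ).1 ∨ x = (e.ends s μ).2) := by
  constructor
  · rintro ⟨y, he, h | h⟩ <;> rw [h] <;> simp [he]
  · rintro ⟨he, rfl | rfl⟩
    · exact ⟨_, he, .inl rfl⟩
    · exact ⟨_, he, .inr rfl⟩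

theorem xEdges_mono {M : ℕ} (h : M ≤ K) : xEdges s M μ ⊆ xEdges s K μ := by
  rintro (e | i | i) he
  · rw [base_mem_xEdges] at he ⊢
    cases e <;> simp at he ⊢ <;> omega
  · rw [link_mem_xEdges] at he ⊢
    omega
  · rw [couple_mem_xEdges] at he ⊢
    omega

theorem coupledVillage_mono {M : ℕ} (h : M ≤ K) (hF : F ⊆ F') :
    coupledVillage s M μ F ≤ coupledVillage s K μ F' := by
  refine ⟨?_, fun e x y he => ⟨⟨hF he.1.1, xEdges_mono h he.1.2⟩, he.2⟩⟩
  intro x hx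
  cases x <;> simp at hx ⊢ <;> omega

theorem coupledVillage_ends_ne {e : XEdge} (he : e ∈ xEdges s K μ) :
    (e.ends s μ).1 ≠ (e.ends s μ).2 := by
  rcases e with (l | l | ⟨j, l⟩ | ⟨j, l⟩) | j | j <;> simp at he <;>
    simp [XEdge.ends, villageEnds, houseVertex] <;> grind

theorem coupledVillage_ends_injOn {e f : XEdge} (he : e ∈ xEdges s K μ) (hf : f ∈ xEdges s K μ)
    (h : e.ends s μ = f.ends s μ ∨ e.ends s μ = (f.ends s μ).swap) : e = f := by
  rcases e with (l | l | ⟨j, l⟩ | ⟨j, l⟩) | j | j <;> simp at he <;>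
  rcases f with (l' | l' | ⟨j', l'⟩ | ⟨j', l'⟩) | j' | j' <;> simp at hf <;>
    simp [XEdge.ends, villageEnds, houseVertex] at h ⊢ <;>
    first | grind | (split_ifs at h <;> simp at h <;> omega)

instance : (coupledVillage s K μ F).Simple where
  not_isLoopAt e x h := by
    have h1 : (coupledVillage s K μ F).IsLink e x x := h
    rcases h1 with ⟨he, h | h⟩ <;> exact coupledVillage_ends_ne he.2 (by rw [h])
  eq_of_isLink e f x y h h' := by
    refine coupledVillage_ends_injOn h.1.2 h'.1.2 ?_
    rcases h.2 with h1 | h1 <;> rcases h'.2 with h2 | h2 <;> rw [h1, h2] <;> simp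

/-- The edges at the surface vertex `s_k` that belong to a house. -/
def surfaceWalls (k : ℕ) : List XEdge :=
  if k % 4 = 1 then [.base (.wall ((k + 3) / 4) 1)]
  else if k % 4 = 3 then [.base (.wall ((k + 1) / 4) 6)] else []

/-- The predecessor of `s_k` on the surface. -/
def predSurface (s k : ℕ) : ℕ := if k = 1 then 4 * s else k - 1

/-- The edges around the vertices of coupled villages, in counterclockwise order. The inhabitant of
the house `H_i` is inside if `g i` is true. -/
def ring (s : ℕ) (μ : ℕ → ℕ) (g : ℕ → Bool) : VillageVertex → List XEdge
  | .centre => (List.range (4 * s)).map fun k => .base (.spoke (k + 1))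
  | .surface k => [.base (.spoke k), .base (.rim (predSurface s k))] ++ surfaceWalls k ++
      [.base (.rim k)]
  | .wall i k =>
    if k = 2 then
      if g i then [.base (.wall i 1), .link (μ i), .base (.wall i 2), .base (.claw i 2)]
      else [.base (.wall i 1), .link (μ i), .base (.claw i 2), .base (.wall i 2)]
    else if k = 4 then
      if g i then [.base (.wall i 3), .couple i, .base (.wall i 4), .base (.claw i 4)]
      else [.base (.wall i 3), .base (.claw i 4), .base (.wall i 4), .couple i]
    else if k = 6 then
      if g i then [.base (.wall i 5), .link i, .base (.wall i 6), .base (.claw i 6)]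
      else [.base (.wall i 5), .base (.claw i 6), .link i, .base (.wall i 6)]
    else [.base (.wall i (k - 1)), .base (.wall i k)]
  | .inhabitant i =>
    if g i then [.base (.claw i 2), .base (.claw i 4), .base (.claw i 6), .couple (μ i)]
    else [.base (.claw i 6), .base (.claw i 4), .base (.claw i 2), .couple (μ i)]

variable {g : ℕ → Bool}

theorem surface_cases (k : ℕ) (hk : 1 ≤ k) : ∃ x, 1 ≤ x ∧
    (k = 4 * x - 3 ∧ surfaceWalls k = [.base (.wall x 1)] ∨ k = 4 * x - 2 ∧ surfaceWalls k = [] ∨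
      k = 4 * x - 1 ∧ surfaceWalls k = [.base (.wall x 6)] ∨ k = 4 * x ∧ surfaceWalls k = []) := by
  refine ⟨(k + 3) / 4, by omega, ?_⟩
  unfold surfaceWalls
  have h : k % 4 = 0 ∨ k % 4 = 1 ∨ k % 4 = 2 ∨ k % 4 = 3 := by omega
  rcases h with h | h | h | h
  · simp [h]; omega
  · simp [h]; omega
  · simp [h]; omega
  · simp [h, show (k + 1) / 4 = (k + 3) / 4 by omega]; omega

theorem nodup_ring {v : VillageVertex} (hv : v ∈ villageVertices s (Finset.Icc 1 K)) :
    (ring s μ g v).Nodup := by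
  cases v with
  | centre => 
    refine List.Nodup.map (fun a b h => ?_) List.nodup_range
    simpa using h
  | surface k =>
    rw [surface_mem] at hv
    obtain ⟨x, -, h⟩ := surface_cases k hv.1
    rcases h with ⟨h, h'⟩ | ⟨h, h'⟩ | ⟨h, h'⟩ | ⟨h, h'⟩ <;> simp [ring, h', predSurface] <;> grind
  | wall i k => 
    rw [wall_vertex_mem] at hv
    simp only [ring]
    split_ifs <;> simp
    grind
  | inhabitant i =>
    simp only [ring]
    split_ifs <;> simp

/-- The lists also contain names that are no edges, such as the link of a house without a partner.
They are filtered out in `isListing_ring`, hence the hypothesis on `e`. -/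
theorem mem_ring (hμ : ∀ i, μ (μ i) = i) {v : VillageVertex}
    (hv : v ∈ villageVertices s (Finset.Icc 1 K)) {e : XEdge} (he : e ∈ xEdges s K μ) :
    e ∈ ring s μ g v ↔ v = (e.ends s μ).1 ∨ v = (e.ends s μ).2 := by
  cases v with
  | centre =>
    rcases e with (k | k | ⟨i, k⟩ | ⟨i, k⟩) | i | i
    · simp at he
      simp only [ring, List.mem_map, List.mem_range, XEdge.ends, villageEnds]
      simp
      exact ⟨k - 1, by omega, by omega⟩
    all_goals simp [ring, XEdge.ends, villageEnds, houseVertex]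
    all_goals grind
  | surface k =>
    rw [surface_mem] at hv
    obtain ⟨x, hx, h⟩ := surface_cases k hv.1
    rcases h with ⟨h, h'⟩ | ⟨h, h'⟩ | ⟨h, h'⟩ | ⟨h, h'⟩ <;>
    · rcases e with (l | l | ⟨i, l⟩ | ⟨i, l⟩) | i | i <;> simp at he <;>
      simp [ring, h', predSurface, XEdge.ends, villageEnds, houseVertex] <;> grind
  | wall i k =>
    rw [wall_vertex_mem] at hv
    obtain ⟨-, -, hk1, hk2⟩ := hv
    rcases e with (l | l | ⟨j, l⟩ | ⟨j, l⟩) | j | j <;> simp at he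
    · interval_cases k <;> simp [ring, XEdge.ends, villageEnds] <;> grind
    · interval_cases k <;> simp [ring, XEdge.ends, villageEnds] <;> grind
    · obtain ⟨-, -, hl1, hl2⟩ := he
      interval_cases k <;> interval_cases l <;>
        simp [ring, XEdge.ends, villageEnds, houseVertex] <;> grind
    · obtain ⟨-, -, rfl | rfl | rfl⟩ := he <;> interval_cases k <;>
        simp [ring, XEdge.ends, villageEnds, houseVertex] <;> grind
    · have := hμ i
      have := hμ j
      interval_cases k <;> simp [ring, XEdge.ends] <;> grind
    · interval_cases k <;> simp [ring, XEdge.ends] <;> grind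
  | inhabitant i =>
    rcases e with (l | l | ⟨j, l⟩ | ⟨j, l⟩) | j | j <;> simp at he
    · simp [ring, XEdge.ends, villageEnds]; grind
    · simp [ring, XEdge.ends, villageEnds]; grind
    · simp only [ring, XEdge.ends, villageEnds, houseVertex]; grind
    · simp only [ring, XEdge.ends, villageEnds, houseVertex]; grind
    · simp [ring, XEdge.ends]; grind
    · have := hμ i
      have := hμ j
      simp only [ring, XEdge.ends]
      grind

open Classical in
theorem isListing_ring (hμ : ∀ i, μ (μ i) = i) :
    IsListing (fun v => (ring s μ g v).filter (· ∈ E(coupledVillage s K μ F)))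
      (coupledVillage s K μ F) := by
  refine .of_forall (fun v hv => nodup_ring hv) fun v hv e he => ?_
  rw [mem_ring hμ hv he.2, coupledVillage_inc]
  exact ⟨fun h => ⟨he, h⟩, fun h => h.2⟩

end

/-! ### Size of coupled villages, and unions of faces -/

section

variable {s K : ℕ} {μ : ℕ → ℕ} {F : Set XEdge} {g : ℕ → Bool}

section Size

theorem villageVertices_bound (s K : ℕ) : (villageVertices s (Finset.Icc 1 K)).Finite ∧
    (villageVertices s (Finset.Icc 1 K)).ncard ≤ 1 + 4 * s + 6 * K := by
  classical
  let T : Finset VillageVertex := {.centre} ∪ (Finset.Icc 1 (4 * s)).image .surface ∪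
    (Finset.Icc 1 K ×ˢ Finset.Icc 2 6).image (fun p => .wall p.1 p.2) ∪
    (Finset.Icc 1 K).image .inhabitant
  have hT : villageVertices s (Finset.Icc 1 K) ⊆ T := by
    rintro (_ | k | ⟨i, k⟩ | i) h <;> simp at h <;> simp [T] <;> omega
  refine ⟨T.finite_toSet.subset hT, (Set.ncard_le_ncard hT T.finite_toSet).trans ?_⟩
  rw [Set.ncard_coe_finset]
  refine (Finset.card_union_le _ _).trans ?_
  have h1 := Finset.card_union_le ({VillageVertex.centre} ∪ (Finset.Icc 1 (4 * s)).image .surface)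
    ((Finset.Icc 1 K ×ˢ Finset.Icc 2 6).image (fun p => VillageVertex.wall p.1 p.2))
  have h2 := Finset.card_union_le {VillageVertex.centre} ((Finset.Icc 1 (4 * s)).image .surface)
  have h3 := Finset.card_image_le (s := Finset.Icc 1 (4 * s)) (f := VillageVertex.surface)
  have h4 := Finset.card_image_le (s := Finset.Icc 1 K ×ˢ Finset.Icc 2 6)
    (f := fun p => VillageVertex.wall p.1 p.2)
  have h5 := Finset.card_image_le (s := Finset.Icc 1 K) (f := VillageVertex.inhabitant)
  simp only [Finset.card_product, Nat.card_Icc, Finset.card_singleton] at *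
  omega

theorem xEdges_bound (s K : ℕ) (μ : ℕ → ℕ) : (xEdges s K μ).Finite ∧
    (xEdges s K μ).ncard ≤ 8 * s + 11 * K := by
  classical
  let T : Finset XEdge := (Finset.Icc 1 (4 * s)).image (fun k => .base (.spoke k)) ∪
    (Finset.Icc 1 (4 * s)).image (fun k => .base (.rim k)) ∪
    (Finset.Icc 1 K ×ˢ Finset.Icc 1 6).image (fun p => .base (.wall p.1 p.2)) ∪
    (Finset.Icc 1 K ×ˢ {2, 4, 6}).image (fun p => .base (.claw p.1 p.2)) ∪
    (Finset.Icc 1 K).image .link ∪ (Finset.Icc 1 K).image .couple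
  have hT : xEdges s K μ ⊆ T := by
    rintro ((k | k | ⟨i, k⟩ | ⟨i, k⟩) | i | i) h <;> simp at h <;> simp [T] <;> omega
  refine ⟨T.finite_toSet.subset hT, (Set.ncard_le_ncard hT T.finite_toSet).trans ?_⟩
  rw [Set.ncard_coe_finset]
  have h1 := Finset.card_image_le (s := Finset.Icc 1 (4 * s)) (f := fun k => XEdge.base (.spoke k))
  have h2 := Finset.card_image_le (s := Finset.Icc 1 (4 * s)) (f := fun k => XEdge.base (.rim k))
  have h3 := Finset.card_image_le (s := Finset.Icc 1 K ×ˢ Finset.Icc 1 6)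
    (f := fun p => XEdge.base (.wall p.1 p.2))
  have h4 := Finset.card_image_le (s := Finset.Icc 1 K ×ˢ {2, 4, 6})
    (f := fun p => XEdge.base (.claw p.1 p.2))
  have h5 := Finset.card_image_le (s := Finset.Icc 1 K) (f := XEdge.link)
  have h6 := Finset.card_image_le (s := Finset.Icc 1 K) (f := XEdge.couple)
  simp only [Finset.card_product, Nat.card_Icc] at *
  have h7 : ({2, 4, 6} : Finset ℕ).card = 3 := rfl
  rw [h7] at h4
  refine (Finset.card_union_le _ _).trans ?_
  refine (add_le_add_left (Finset.card_union_le _ _) _).trans ?_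
  refine (add_le_add_left (add_le_add_left (Finset.card_union_le _ _) _) _).trans ?_
  refine (add_le_add_left (add_le_add_left (add_le_add_left (Finset.card_union_le _ _) _) _)
    _).trans ?_
  refine (add_le_add_left (add_le_add_left (add_le_add_left (add_le_add_left
    (Finset.card_union_le _ _) _) _) _) _).trans ?_
  omega

theorem finite_vertexSet_coupledVillage : V(coupledVillage s K μ F).Finite :=
  (villageVertices_bound s K).1

theorem finite_edgeSet_coupledVillage : E(coupledVillage s K μ F).Finite :=
  (xEdges_bound s K μ).1.subset Set.inter_subset_right

/-- The planet has `4 * s + 1` vertices and `8 * s` edges. Each house adds 6 vertices and 9 edges,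
and one link and one coupling edge are allowed for per house. -/
theorem size_coupledVillage_le :
    V(coupledVillage s K μ F).ncard + E(coupledVillage s K μ F).ncard ≤ 12 * s + 1 + 17 * K := by
  have h1 := (villageVertices_bound s K).2
  have h2 := (Set.ncard_le_ncard (Set.inter_subset_right (s := F)) (xEdges_bound s K μ).1).trans
    (xEdges_bound s K μ).2
  rw [vertexSet_coupledVillage, edgeSet_coupledVillage]
  omega

instance : Finite (Dart (coupledVillage s K μ F)) :=
  Dart.finite finite_vertexSet_coupledVillage finite_edgeSet_coupledVillage

end Size

/-- The edges of villages. -/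
def baseEdges : Set XEdge := {e | ∃ b, e = .base b}

/-- The edges of villages and the links. -/
def linkedEdges : Set XEdge := {e | ∀ i, e ≠ .couple i}

open Classical in
/-- The rotation system on a coupled village in which the inhabitants inside of their houses are
given by `g`. -/
noncomputable def ringSystem (s K : ℕ) {μ : ℕ → ℕ} (hμ : ∀ i, μ (μ i) = i) (F : Set XEdge)
    (g : ℕ → Bool) : RotationSystem (coupledVillage s K μ F) :=
  (isListing_ring (s := s) (K := K) (F := F) (g := g) hμ).rotationSystem

theorem ringSystem_inducesRot {M : ℕ} (hμ : ∀ i, μ (μ i) = i) {F' : Set XEdge} (h : M ≤ K)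
    (hF : F ⊆ F') : (Mono.ofLE (coupledVillage_mono h hF)).InducesRot (ringSystem s K hμ F' g)
      (ringSystem s M hμ F g) := by
  classical
  exact IsListing.inducesRot_filter _ (isListing_ring hμ) (isListing_ring hμ)

/-- Whether a vertex `v` is the first end of an edge at `v`. -/
def dirAt : VillageVertex → XEdge → Bool
  | .centre, _ => true
  | .surface k, .base (.rim l) => l == k
  | .surface _, .base (.wall _ l) => l == 1
  | .surface _, _ => false
  | .wall _ k, .base (.wall _ l) => l == k
  | .wall _ _, .base _ => false
  | .wall _ k, .link _ => k == 6
  | .wall _ _, .couple _ => true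
  | .inhabitant _, .base _ => true
  | .inhabitant _, _ => false

theorem dirAt_ends_fst {e : XEdge} (he : e ∈ xEdges s K μ) : dirAt (e.ends s μ).1 e = true := by
  rcases e with (l | l | ⟨j, l⟩ | ⟨j, l⟩) | j | j <;> simp at he <;>
    simp [XEdge.ends, villageEnds, houseVertex, dirAt]
  split_ifs <;> grind

theorem dirAt_ends_snd {e : XEdge} (he : e ∈ xEdges s K μ) : dirAt (e.ends s μ).2 e = false := by
  rcases e with (l | l | ⟨j, l⟩ | ⟨j, l⟩) | j | j <;> simp at he <;>
    simp [XEdge.ends, villageEnds, houseVertex, dirAt] <;> split_ifs <;> grind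

/-- The set of darts described by a predicate on edges with a marked end. -/
def dartSet (D : XEdge → Bool → Prop) : Set (Dart (coupledVillage s K μ F)) :=
  {d | D d.edge (dirAt d.vertex d.edge)}

theorem dirAt_rev (d : Dart (coupledVillage s K μ F)) :
    dirAt d.rev.vertex d.edge = !dirAt d.vertex d.edge := by
  obtain ⟨he, h | h⟩ := d.isLink
  · have h1 := dirAt_ends_fst he.2
    have h2 := dirAt_ends_snd he.2
    rw [h] at h1 h2
    simp [h1, h2]
  · have h1 := dirAt_ends_fst he.2
    have h2 := dirAt_ends_snd he.2
    rw [h] at h1 h2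
    simp [h1, h2]

theorem mem_dartSet {D : XEdge → Bool → Prop} {d : Dart (coupledVillage s K μ F)} :
    d ∈ dartSet D ↔ D d.edge (dirAt d.vertex d.edge) := Iff.rfl

theorem rev_mem_dartSet {D : XEdge → Bool → Prop} {d : Dart (coupledVillage s K μ F)} :
    d.rev ∈ dartSet D ↔ D d.edge (!dirAt d.vertex d.edge) := by
  rw [mem_dartSet, ← dirAt_rev]
  rfl

theorem exists_dart_dirAt {e : XEdge} (he : e ∈ F ∩ xEdges s K μ) (b : Bool) :
    ∃ d : Dart (coupledVillage s K μ F), d.edge = e ∧ dirAt d.vertex d.edge = b := by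
  cases b
  · exact ⟨⟨(e.ends s μ).2, e, _, he, .inr rfl⟩, rfl, dirAt_ends_snd he.2⟩
  · exact ⟨⟨(e.ends s μ).1, e, _, he, .inl rfl⟩, rfl, dirAt_ends_fst he.2⟩

/-- The relation of consecutive edges `a`, `b` at `v` that has to hold for a union `D` of faces. -/
def dartRel (D : XEdge → Bool → Prop) (v : VillageVertex) (a b : XEdge) : Prop :=
  D b (dirAt v b) ↔ D a (!dirAt v a)

theorem ringSystem_isFaceSet (hμ : ∀ i, μ (μ i) = i) {D : XEdge → Bool → Prop}
    (h : ∀ v ∈ villageVertices s (Finset.Icc 1 K), ∀ p : XEdge → Bool,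
      (∀ e, p e = true ↔ e ∈ F ∩ xEdges s K μ) →
        CycChain (dartRel D v) ((ring s μ g v).filter p)) :
    (ringSystem s K hμ F g).IsFaceSet (dartSet D) := by
  classical
  refine IsListing.isFaceSet (D := fun v e => D e (dirAt v e)) _ fun v hv => ?_
  have h1 := h v hv (fun e => decide (e ∈ E(coupledVillage s K μ F))) (by simp)
  revert h1
  generalize List.filter (fun e => decide (e ∈ E(coupledVillage s K μ F))) (ring s μ g v) = l
  intro h1
  cases l with
  | nil => trivial
  | cons a l =>
    refine List.IsChain.imp (fun a b hab u hu => ?_) h1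
    have h2 := dirAt_rev (dartOf hu)
    rw [dartOf_rev] at h2
    simp only [dartOf_vertex, dartOf_edge] at h2
    rw [h2]
    exact hab

theorem cycChain_map_range {β : Type*} {R : β → β → Prop} {n : ℕ} {f : ℕ → β}
    (h : ∀ i < n, R (f i) (f (if i + 1 = n then 0 else i + 1))) :
    CycChain R ((List.range n).map f) := by
  cases n with
  | zero => trivial
  | succ n =>
    rw [List.range_succ_eq_map, List.map_cons, List.map_map]
    refine List.isChain_iff_getElem.2 fun i hi => ?_
    simp only [List.length_cons, List.length_append, List.length_map, List.length_range,
      List.length_nil] at hi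
    have := h i (by omega)
    grind

/-- The conditions for a set of darts to be a union of faces of a village with links. -/
structure IsRegion (s K : ℕ) (μ : ℕ → ℕ) (g : ℕ → Bool) (D : XEdge → Bool → Prop) : Prop where
  centre : ∀ k, 1 ≤ k → k ≤ 4 * s → (D (.base (.spoke (if k = 4 * s then 1 else k + 1))) true ↔
    D (.base (.spoke k)) false)
  prev : ∀ k, 1 ≤ k → k ≤ 4 * s →
    (D (.base (.rim (predSurface s k))) false ↔ D (.base (.spoke k)) true)
  next : ∀ k, 1 ≤ k → k ≤ 4 * s → (D (.base (.spoke k)) false ↔ D (.base (.rim k)) false)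
  plain : ∀ k, 1 ≤ k → k ≤ 4 * s → (∀ x, 1 ≤ x → x ≤ K → k ≠ 4 * x - 3 ∧ k ≠ 4 * x - 1) →
    (D (.base (.rim k)) true ↔ D (.base (.rim (predSurface s k))) true)
  first : ∀ x, 1 ≤ x → x ≤ K →
    (D (.base (.wall x 1)) true ↔ D (.base (.rim (predSurface s (4 * x - 3)))) true) ∧
      (D (.base (.rim (4 * x - 3))) true ↔ D (.base (.wall x 1)) false)
  last : ∀ x, 1 ≤ x → x ≤ K →
    (D (.base (.wall x 6)) false ↔ D (.base (.rim (4 * x - 2))) true) ∧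
      (D (.base (.rim (4 * x - 1))) true ↔ D (.base (.wall x 6)) true)
  wall : ∀ x, 1 ≤ x → x ≤ K → ∀ k, k = 2 ∨ k = 4 →
    (D (.base (.wall x (k + 1))) true ↔ D (.base (.wall x k)) true) ∧
      (D (.base (.wall x k)) false ↔ D (.base (.wall x (k + 1))) false)
  wall_two : ∀ x, 1 ≤ x → x ≤ K → CycChain (dartRel D (.wall x 2))
    ([.base (.wall x 1)] ++ (if μ x < x then [.link (μ x)] else []) ++
      if g x then [.base (.wall x 2), .base (.claw x 2)]
      else [.base (.claw x 2), .base (.wall x 2)])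
  wall_four : ∀ x, 1 ≤ x → x ≤ K → CycChain (dartRel D (.wall x 4))
    (if g x then [.base (.wall x 3), .base (.wall x 4), .base (.claw x 4)]
      else [.base (.wall x 3), .base (.claw x 4), .base (.wall x 4)])
  wall_six : ∀ x, 1 ≤ x → x ≤ K → CycChain (dartRel D (.wall x 6))
    (([.base (.wall x 5)] ++ if g x then [] else [.base (.claw x 6)]) ++
      (if x < μ x then [.link x] else []) ++
      [.base (.wall x 6)] ++ if g x then [.base (.claw x 6)] else [])
  inhabitant : ∀ x, 1 ≤ x → x ≤ K → CycChain (dartRel D (.inhabitant x))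
    (if g x then [.base (.claw x 2), .base (.claw x 4), .base (.claw x 6)]
      else [.base (.claw x 6), .base (.claw x 4), .base (.claw x 2)])

/-- Without coupling edges, and with `link i` present only for `i < μ i`, the filtered lists are
those that appear in the conditions on `D`. -/
theorem IsRegion.isFaceSet (hμ : IsNoncrossing K μ) (hK : K ≤ s) {D : XEdge → Bool → Prop}
    (h : IsRegion s K μ g D) : (ringSystem s K hμ.invol linkedEdges g).IsFaceSet (dartSet D) := by
  refine ringSystem_isFaceSet hμ.invol fun v hv p hp => ?_
  have hb : ∀ e, p (.base e) = true ↔ e ∈ villageEdges s (Finset.Icc 1 K) := by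
    intro e
    rw [hp]
    exact ⟨fun h => h.2, fun h => ⟨by simp [linkedEdges], h⟩⟩
  have hc : ∀ i, p (.couple i) = false := by
    intro i
    rw [← Bool.not_eq_true, hp]
    simp [linkedEdges]
  have hl : ∀ i, p (.link i) = true ↔ i < μ i := by
    intro i
    rw [hp]
    refine ⟨fun h => h.2.2.1, fun h => ⟨by simp [linkedEdges], ?_⟩⟩
    have h1 := hμ.mem i (by omega)
    have h2 := hμ.mem' (i := i) (by omega)
    simp
    omega
  cases v with
  | centre =>
    have h1 : (ring s μ g .centre).filter p = ring s μ g .centre := by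
      rw [List.filter_eq_self]
      intro e he
      simp only [ring, List.mem_map, List.mem_range] at he
      obtain ⟨k, hk, rfl⟩ := he
      rw [hb]
      simp
      omega
    rw [h1]
    refine cycChain_map_range fun k hk => ?_
    have h2 := h.centre (k + 1) (by omega) (by omega)
    split_ifs at h2 ⊢ <;> simpa [dartRel, dirAt] using h2
  | surface k =>
    rw [surface_mem] at hv
    have h1 := h.prev k hv.1 hv.2
    have h2 := h.next k hv.1 hv.2
    have hpr : 1 ≤ predSurface s k ∧ predSurface s k ≤ 4 * s ∧ predSurface s k ≠ k := by
      unfold predSurface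
      split_ifs <;> omega
    obtain ⟨hp1, hp2, hp3⟩ := hpr
    replace hp3 := beq_false_of_ne hp3
    obtain ⟨x, hx, hk⟩ := surface_cases k hv.1
    have h3 := h.plain k hv.1 hv.2
    by_cases hxK : x ≤ K
    · have hxs := hxK.trans hK
      rcases hk with ⟨hk, h'⟩ | ⟨hk, h'⟩ | ⟨hk, h'⟩ | ⟨hk, h'⟩
      · have h3 := h.first x hx hxK
        rw [← hk] at h3
        simp [ring, h', hb, CycChain, dartRel, dirAt, hv, hp1, hp2, hp3, h1, h2, h3, hx, hxK, hxs]
      · have h3 := h3 (by omega)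
        simp [ring, h', hb, CycChain, dartRel, dirAt, hv, hp1, hp2, hp3, h1, h2, h3]
      · have h3 := h.last x hx hxK
        have h4 : predSurface s k = 4 * x - 2 := by
          unfold predSurface
          split_ifs <;> omega
        rw [← hk, ← h4] at h3
        simp [ring, h', hb, CycChain, dartRel, dirAt, hv, hp1, hp2, hp3, h1, h2, h3, hx, hxK, hxs]
      · have h3 := h3 (by omega)
        simp [ring, h', hb, CycChain, dartRel, dirAt, hv, hp1, hp2, hp3, h1, h2, h3]
    · have h3 := h3 (by omega)
      rcases hk with ⟨hk, h'⟩ | ⟨hk, h'⟩ | ⟨hk, h'⟩ | ⟨hk, h'⟩ <;>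
        simp [ring, h', hb, CycChain, dartRel, dirAt, hv, hp1, hp2, hp3, h1, h2, h3, hxK]
  | wall x k =>
    rw [wall_vertex_mem] at hv
    obtain ⟨hv1, hv2, hk1, hk2⟩ := hv
    have hx : x ≤ s := (Finset.mem_Icc.1 hv2).2
    rw [Finset.mem_Icc] at hv1
    have h2 := h.wall_two x hv1.1 hv1.2
    have h4 := h.wall_four x hv1.1 hv1.2
    have h6 := h.wall_six x hv1.1 hv1.2
    have hw := h.wall x hv1.1 hv1.2
    interval_cases k
    · convert h2 using 1
      simp only [ring]
      cases g x <;> by_cases hc : μ x < x <;> simp [hb, hl, hμ.invol, hv1, hx, hc]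
    · simp [ring, hb, hv1, hx, CycChain, dartRel, dirAt, hw 2]
    · convert h4 using 1
      cases hg : g x <;> simp [ring, hb, hc, hv1, hx, hg]
    · simp [ring, hb, hv1, hx, CycChain, dartRel, dirAt, hw 4]
    · convert h6 using 1
      cases hg : g x <;> by_cases hc : x < μ x <;>
        simp [ring, hb, hl, hv1, hx, hg, hc]
  | inhabitant x =>
    rw [inhabitant_mem] at hv
    have hx : x ≤ s := (Finset.mem_Icc.1 hv.2).2
    have hv1 := Finset.mem_Icc.1 hv.1
    convert h.inhabitant x hv1.1 hv1.2 using 1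
    cases hg : g x <;> simp [ring, hb, hc, hv1, hx, hg]

end

/-! ### Regions bounded by triangles, rooms and links -/

section

variable {s K : ℕ} {μ : ℕ → ℕ} {F : Set XEdge} {g : ℕ → Bool}

/-- Describing darts by edges with a marked end reduces the hypotheses on boundaries to a case
distinction over the kinds of edges. -/
theorem RotationSystem.HasPotentialsOn.union_dartSet
    {σ : RotationSystem (coupledVillage s K μ F)} {S : Set XEdge} (h : σ.HasPotentialsOn S)
    (N : Set XEdge) (D : XEdge → XEdge → Bool → Prop)
    (hD : ∀ e ∈ N, e ∈ F → e ∈ xEdges s K μ → σ.IsFaceSet (dartSet (D e)))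
    (hbd : ∀ e ∈ N, e ∈ F → e ∈ xEdges s K μ → ∀ f ∈ F ∩ xEdges s K μ, f ∉ S → f ≠ e →
      (D e f true ↔ D e f false))
    (hsep : ∀ e ∈ N, e ∈ F → e ∈ xEdges s K μ → ¬ (D e e true ↔ D e e false)) :
    σ.HasPotentialsOn (S ∪ N) := by
  refine h.union N (fun e => dartSet (D e)) (fun e h1 h2 => hD e h1 h2.1 h2.2)
    (fun e h1 h2 d hd hne => ?_) fun e h1 h2 => ?_
  · rw [mem_dartSet, rev_mem_dartSet]
    have := hbd e h1 h2.1 h2.2 d.edge d.inc.edge_mem hd hne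
    cases dirAt d.vertex d.edge
    · exact this.symm
    · exact this
  · have h3 := hsep e h1 h2.1 h2.2
    obtain ⟨b, hb⟩ : ∃ b, D e e b ∧ ¬ D e e (!b) := by
      by_cases h4 : D e e true
      · exact ⟨true, h4, fun h5 => h3 ⟨fun _ => h5, fun _ => h4⟩⟩
      · refine ⟨false, by_contra fun h5 => h3 ⟨fun h => absurd h h4, fun h => absurd h h5⟩, h4⟩
    obtain ⟨d, hd, hdb⟩ := exists_dart_dirAt h2 b
    refine ⟨d, hd, ?_, ?_⟩
    · rw [mem_dartSet, hd, ← hd, hdb, hd]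
      exact hb.1
    · rw [rev_mem_dartSet, hdb, hd]
      exact hb.2

theorem coupledVillage_pendant {σ : RotationSystem (coupledVillage s K μ F)} {S : Set XEdge}
    (h : σ.HasPotentialsOn S) (N : Set XEdge)
    (hN : ∀ e ∈ N, e ∈ xEdges s K μ → ∃ v, (v = (e.ends s μ).1 ∨ v = (e.ends s μ).2) ∧
      ∀ f ∈ xEdges s K μ, f ∈ S ∪ N → (v = (f.ends s μ).1 ∨ v = (f.ends s μ).2) → f = e) :
    σ.HasPotentialsOn (S ∪ N) := by
  refine h.pendant N fun e he d hd => ?_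
  have he' := d.inc.edge_mem
  rw [hd] at he'
  obtain ⟨v, hv, h1⟩ := hN e he he'.2
  refine ⟨⟨v, e, coupledVillage_inc.2 ⟨he', hv⟩⟩, rfl, fun d' hd' hS => ?_⟩
  refine h1 _ d'.inc.edge_mem.2 hS ?_
  have h2 := (coupledVillage_inc.1 d'.inc).2
  rwa [hd'] at h2

/-- The face at the centre and the `k`-th edge of the surface. -/
def triangle (s k : ℕ) : XEdge → Bool → Prop
  | .base (.spoke l), true => l = if k = 4 * s then 1 else k + 1
  | .base (.spoke l), false => l = k
  | .base (.rim l), false => l = k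
  | _, _ => False

/-- The first face of a house at its inhabitant. -/
def firstRoom (g : ℕ → Bool) (i : ℕ) : XEdge → Bool → Prop
  | .base (.claw x k), b => x = i ∧ (k = 2 ∧ b = !g i ∨ k = 4 ∧ b = g i)
  | .base (.wall x k), b => x = i ∧ (k = 2 ∨ k = 3) ∧ b = !g i
  | _, _ => False

/-- The second face of a house at its inhabitant. -/
def secondRoom (g : ℕ → Bool) (i : ℕ) : XEdge → Bool → Prop
  | .base (.claw x k), b => x = i ∧ (k = 6 ∧ b = g i ∨ k = 4 ∧ b = !g i)
  | .base (.wall x k), b => x = i ∧ (k = 4 ∨ k = 5) ∧ b = !g i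
  | _, _ => False

/-- The face of a house at the surface. -/
def groundFloor (g : ℕ → Bool) (i : ℕ) : XEdge → Bool → Prop
  | .base (.claw x k), b => x = i ∧ g i = true ∧ (k = 2 ∧ b = true ∨ k = 6 ∧ b = false)
  | .base (.wall x k), b => x = i ∧ (k = 1 ∨ k = 6 ∨ g i = false ∧ 1 ≤ k ∧ k ≤ 6) ∧ b = false
  | .base (.rim k), b => (k = 4 * i - 3 ∨ k = 4 * i - 2) ∧ b = true
  | _, _ => False

/-- The region below a link. -/
def linkRegion (μ : ℕ → ℕ) (i : ℕ) : XEdge → Bool → Prop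
  | .base (.claw x _), _ => i < x ∧ x < μ i
  | .base (.wall x k), b => i < x ∧ x < μ i ∨ b = true ∧ (x = i ∧ k = 6 ∨ x = μ i ∧ k = 1)
  | .base (.rim k), b => 4 * i - 1 ≤ k ∧ k + 4 ≤ 4 * μ i ∧ b = true
  | .link x, b => i < x ∧ x < μ i ∨ x = i ∧ b = false
  | _, _ => False

theorem isRegion_triangle {k₀ : ℕ} (h1 : 1 ≤ k₀) :
    IsRegion s K μ g (triangle s k₀) where
  centre k _ _ := by simp only [triangle]; grind
  prev k _ _ := by simp only [triangle, predSurface]; grind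
  next k _ _ := by simp only [triangle]
  plain k _ _ _ := by simp only [triangle]
  first x _ _ := by simp [triangle]
  last x _ _ := by simp [triangle]
  wall x _ _ k _ := by simp [triangle]
  wall_two x _ _ := by
    cases g x <;> by_cases h : μ x < x <;> simp [h, CycChain, dartRel, triangle]
  wall_four x _ _ := by cases g x <;> simp [CycChain, dartRel, triangle]
  wall_six x _ _ := by
    cases g x <;> by_cases h : x < μ x <;> simp [h, CycChain, dartRel, triangle]
  inhabitant x _ _ := by cases g x <;> simp [CycChain, dartRel, triangle]

theorem isRegion_firstRoom (i : ℕ) : IsRegion s K μ g (firstRoom g i) where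
  centre k _ _ := by simp only [firstRoom]
  prev k _ _ := by simp only [firstRoom]
  next k _ _ := by simp only [firstRoom]
  plain k _ _ _ := by simp only [firstRoom]
  first x _ _ := by simp [firstRoom]
  last x _ _ := by simp [firstRoom]
  wall x _ _ k _ := by simp only [firstRoom]; grind
  wall_two x _ _ := by
    by_cases hx : x = i
    · subst hx
      cases hg : g x <;> by_cases h : μ x < x <;> simp [h, hg, CycChain, dartRel, dirAt, firstRoom]
    · cases hg : g x <;> by_cases h : μ x < x <;> simp [h, hx, CycChain, dartRel, dirAt, firstRoom]
  wall_four x _ _ := by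
    by_cases hx : x = i
    · subst hx
      cases hg : g x <;> simp [hg, CycChain, dartRel, dirAt, firstRoom]
    · cases hg : g x <;> simp [hx, CycChain, dartRel, dirAt, firstRoom]
  wall_six x _ _ := by
    cases g x <;> by_cases h : x < μ x <;> simp [h, CycChain, dartRel, dirAt, firstRoom]
  inhabitant x _ _ := by
    by_cases hx : x = i
    · subst hx
      cases hg : g x <;> simp [hg, CycChain, dartRel, dirAt, firstRoom]
    · cases hg : g x <;> simp [hx, CycChain, dartRel, dirAt, firstRoom]

theorem isRegion_secondRoom (i : ℕ) : IsRegion s K μ g (secondRoom g i) where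
  centre k _ _ := by simp only [secondRoom]
  prev k _ _ := by simp only [secondRoom]
  next k _ _ := by simp only [secondRoom]
  plain k _ _ _ := by simp only [secondRoom]
  first x _ _ := by simp [secondRoom]
  last x _ _ := by simp [secondRoom]
  wall x _ _ k _ := by simp only [secondRoom]; grind
  wall_two x _ _ := by
    cases g x <;> by_cases h : μ x < x <;> simp [h, CycChain, dartRel, dirAt, secondRoom]
  wall_four x _ _ := by
    by_cases hx : x = i
    · subst hx
      cases hg : g x <;> simp [hg, CycChain, dartRel, dirAt, secondRoom]
    · cases hg : g x <;> simp [hx, CycChain, dartRel, dirAt, secondRoom]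
  wall_six x _ _ := by
    by_cases hx : x = i
    · subst hx
      cases hg : g x <;> by_cases h : x < μ x <;>
        simp [h, hg, CycChain, dartRel, dirAt, secondRoom]
    · cases hg : g x <;> by_cases h : x < μ x <;>
        simp [h, hx, CycChain, dartRel, dirAt, secondRoom]
  inhabitant x _ _ := by
    by_cases hx : x = i
    · subst hx
      cases hg : g x <;> simp [hg, CycChain, dartRel, dirAt, secondRoom]
    · cases hg : g x <;> simp [hx, CycChain, dartRel, dirAt, secondRoom]

theorem isRegion_groundFloor {i : ℕ} (h1 : 1 ≤ i) (h2 : i ≤ K) :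
    IsRegion s K μ g (groundFloor g i) where
  centre k _ _ := by simp only [groundFloor]
  prev k _ _ := by simp [groundFloor]
  next k _ _ := by simp [groundFloor]
  plain k _ _ h := by
    have := h i h1 h2
    simp only [groundFloor, predSurface]
    grind
  first x _ _ := by simp only [groundFloor, predSurface]; grind
  last x _ _ := by simp only [groundFloor]; grind
  wall x _ _ k _ := by simp only [groundFloor]; grind
  wall_two x _ _ := by
    by_cases hx : x = i
    · subst hx
      cases hg : g x <;> by_cases h : μ x < x <;>
        simp [h, hg, CycChain, dartRel, dirAt, groundFloor]
    · cases hg : g x <;> by_cases h : μ x < x <;>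
        simp [h, hx, CycChain, dartRel, dirAt, groundFloor]
  wall_four x _ _ := by
    by_cases hx : x = i
    · subst hx
      cases hg : g x <;> simp [hg, CycChain, dartRel, dirAt, groundFloor]
    · cases hg : g x <;> simp [hx, CycChain, dartRel, dirAt, groundFloor]
  wall_six x _ _ := by
    by_cases hx : x = i
    · subst hx
      cases hg : g x <;> by_cases h : x < μ x <;>
        simp [h, hg, CycChain, dartRel, dirAt, groundFloor]
    · cases hg : g x <;> by_cases h : x < μ x <;>
        simp [h, hx, CycChain, dartRel, dirAt, groundFloor]
  inhabitant x _ _ := by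
    by_cases hx : x = i
    · subst hx
      cases hg : g x <;> simp [hg, CycChain, dartRel, dirAt, groundFloor]
    · cases hg : g x <;> simp [hx, CycChain, dartRel, dirAt, groundFloor]

/-- The region lies between the two linked houses, above the surface and below the link, and it
contains all houses in between together with everything at them. As matched pairs do not cross, a
link at one of these houses ends at another of them, so both of its sides are in the region. -/
theorem isRegion_linkRegion (hμ : IsNoncrossing K μ) (hK : K ≤ s) {i : ℕ} (hi : i < μ i) :
    IsRegion s K μ g (linkRegion μ i) := by
  have h1 := hμ.mem i (by omega)
  have h2 := hμ.mem' (i := i) (by omega)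
  have hnc := hμ.noncrossing i
  have hinv := hμ.invol
  constructor
  case centre => intro k _ _; simp only [linkRegion]
  case prev => intro k _ _; simp [linkRegion]
  case next => intro k _ _; simp [linkRegion]
  case plain =>
    intro k _ _ h
    have := h i h1.1 h1.2
    have := h (μ i) h2.1 h2.2
    simp only [linkRegion, predSurface]
    grind
  case first => intro x _ _; simp only [linkRegion, predSurface]; grind
  case last => intro x _ _; simp only [linkRegion]; grind
  case wall => intro x _ _ k _; simp only [linkRegion]; grind
  case wall_two =>
    intro x _ _
    have := hinv x
    have := hinv i
    have := hnc x
    have := hnc (μ x)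
    cases hg : g x <;> by_cases h : μ x < x <;>
      simp [h, CycChain, dartRel, dirAt, linkRegion] <;> grind
  case wall_four =>
    intro x _ _
    cases hg : g x <;> simp [CycChain, dartRel, dirAt, linkRegion]
  case wall_six =>
    intro x _ _
    have := hinv x
    have := hinv i
    have := hnc x
    cases hg : g x <;> by_cases h : x < μ x <;>
      simp [h, CycChain, dartRel, dirAt, linkRegion] <;> grind
  case inhabitant =>
    intro x _ _
    cases hg : g x <;> simp [CycChain, dartRel, linkRegion]

end

/-! ### Genus zero of villages with links -/

section

variable {s K : ℕ} {μ : ℕ → ℕ} {F : Set XEdge} {g : ℕ → Bool}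

/-- The embedding of a village with links has genus zero. -/
theorem hasPotentialsOn_linked (hμ : IsNoncrossing K μ) (hK : K ≤ s) :
    (ringSystem s K hμ.invol linkedEdges g).HasPotentialsOn Set.univ := by
  set σ := ringSystem s K hμ.invol linkedEdges g
  have h0 : σ.HasPotentialsOn ∅ := RotationSystem.hasPotentialsOn_empty σ
  -- The spokes, the first five walls of each house and the edges from the inhabitants to `v_4` form
  -- a spanning tree. They are admitted as pendant edges; every other edge is admitted with a
  -- region.
  have h1 := coupledVillage_pendant h0 {e | ∃ k, e = .base (.spoke k)} (by
    rintro _ ⟨k, rfl⟩ -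
    refine ⟨.surface k, .inr rfl, ?_⟩
    rintro _ - (h | ⟨l, rfl⟩) h'
    · exact absurd h (Set.notMem_empty _)
    · simpa [XEdge.ends, villageEnds, eq_comm] using h')
  have h2 := h1.union_dartSet {e | ∃ k, e = .base (.rim k)}
    (fun e f b => ∃ k, e = .base (.rim k) ∧ triangle s k f b) (by
      rintro _ ⟨k, rfl⟩ - he
      rw [base_mem_xEdges, rim_mem] at he
      simpa using (isRegion_triangle he.1).isFaceSet hμ hK) (by
      rintro _ ⟨k, rfl⟩ - - f - hf hne
      rcases f with (l | l | ⟨x, l⟩ | ⟨x, l⟩) | l | l <;> simp [triangle] at * <;> tauto) (by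
      rintro _ ⟨k, rfl⟩ - -
      simp [triangle])
  have h3 : ∀ k ≤ 5, σ.HasPotentialsOn {e | (∃ l, e = .base (.spoke l)) ∨
      (∃ l, e = .base (.rim l)) ∨ ∃ x l, 1 ≤ l ∧ l ≤ k ∧ e = .base (.wall x l)} := by
    intro k
    induction k with
    | zero =>
      intro _
      refine h2.mono ?_
      rintro e (h | h | ⟨x, l, h1, h2, -⟩) -
      · exact .inl (.inr h)
      · exact .inr h
      · omega
    | succ k ih =>
      intro hk
      refine (coupledVillage_pendant (ih (by omega)) {e | ∃ x, e = .base (.wall x (k + 1))} ?_).mono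
        ?_
      · rintro _ ⟨x, rfl⟩ -
        refine ⟨.wall x (k + 2), .inr ?_, ?_⟩
        · simp [XEdge.ends, villageEnds, houseVertex]
          omega
        rintro f - ((⟨l, rfl⟩ | ⟨l, rfl⟩ | ⟨y, l, hl1, hl2, rfl⟩) | ⟨y, rfl⟩) h
        · simp [XEdge.ends, villageEnds] at h
        · simp [XEdge.ends, villageEnds] at h
        · simp [XEdge.ends, villageEnds, houseVertex] at h
          grind
        · simp [XEdge.ends, villageEnds, houseVertex] at h ⊢
          grind
      · rintro e (h | h | ⟨x, l, h1, h2, rfl⟩) -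
        · exact .inl (.inl h)
        · exact .inl (.inr (.inl h))
        · by_cases hl : l = k + 1
          · exact .inr ⟨x, by rw [hl]⟩
          · exact .inl (.inr (.inr ⟨x, l, h1, by omega, rfl⟩))
  have h4 := coupledVillage_pendant (h3 5 le_rfl) {e | ∃ x, e = .base (.claw x 4)} (by
    rintro _ ⟨k, rfl⟩ -
    refine ⟨.inhabitant k, .inl rfl, ?_⟩
    rintro _ - ((⟨l, rfl⟩ | ⟨l, rfl⟩ | ⟨y, l, hl1, hl2, rfl⟩) | ⟨l, rfl⟩) h'
    · simp [XEdge.ends, villageEnds] at h'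
    · simp [XEdge.ends, villageEnds] at h'
    · simp [XEdge.ends, villageEnds, houseVertex] at h'
      grind
    · simp [XEdge.ends, villageEnds, houseVertex] at h'
      rw [h'])
  -- The two remaining edges at the inhabitant close the two rooms, then the last wall closes the
  -- ground floor, and finally each link closes the region below it. In each case, the other
  -- boundary edges of the region have been admitted before.
  have h5 := h4.union_dartSet {e | ∃ k, e = .base (.claw k 2)}
    (fun e f b => ∃ k, e = .base (.claw k 2) ∧ firstRoom g k f b) (by
      rintro _ ⟨k, rfl⟩ - he
      simpa using (isRegion_firstRoom k).isFaceSet hμ hK) (by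
      rintro _ ⟨k, rfl⟩ - - f - hf hne
      rcases f with (l | l | ⟨x, l⟩ | ⟨x, l⟩) | l | l <;> simp [firstRoom] at * <;> grind) (by
      rintro _ ⟨k, rfl⟩ - -
      simp [firstRoom])
  have h6 := h5.union_dartSet {e | ∃ k, e = .base (.claw k 6)}
    (fun e f b => ∃ k, e = .base (.claw k 6) ∧ secondRoom g k f b) (by
      rintro _ ⟨k, rfl⟩ - he
      simpa using (isRegion_secondRoom k).isFaceSet hμ hK) (by
      rintro _ ⟨k, rfl⟩ - - f - hf hne
      rcases f with (l | l | ⟨x, l⟩ | ⟨x, l⟩) | l | l <;> simp [secondRoom] at * <;> grind) (by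
      rintro _ ⟨k, rfl⟩ - -
      simp [secondRoom])
  have h7 := h6.union_dartSet {e | ∃ k, e = .base (.wall k 6)}
    (fun e f b => ∃ k, e = .base (.wall k 6) ∧ groundFloor g k f b) (by
      rintro _ ⟨k, rfl⟩ - he
      simp at he
      simpa using (isRegion_groundFloor he.1.1 he.1.2).isFaceSet hμ hK) (by
      rintro _ ⟨k, rfl⟩ - - f hfE hf hne
      rcases f with (l | l | ⟨x, l⟩ | ⟨x, l⟩) | l | l <;> simp [groundFloor] at * <;> grind) (by
      rintro _ ⟨k, rfl⟩ - -
      simp [groundFloor])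
  have h8 := h7.union_dartSet {e | ∃ k, e = .link k}
    (fun e f b => ∃ k, e = .link k ∧ linkRegion μ k f b) (by
      rintro _ ⟨k, rfl⟩ - he
      rw [link_mem_xEdges] at he
      simpa using (isRegion_linkRegion hμ hK he.2.1).isFaceSet hμ hK) (by
      rintro _ ⟨k, rfl⟩ - - f hfE hf hne
      rcases f with (l | l | ⟨x, l⟩ | ⟨x, l⟩) | l | l <;> simp [linkRegion] at * <;> grind) (by
      rintro _ ⟨k, rfl⟩ - -
      simp [linkRegion])
  refine h8.mono ?_
  rintro e - ⟨he, he'⟩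
  rcases e with (l | l | ⟨x, l⟩ | ⟨x, l⟩) | l | l <;> simp [linkedEdges] at * <;> grind

end

/-! ### Genus zero of coupled villages -/

section

variable {s K : ℕ} {μ : ℕ → ℕ} {F : Set XEdge} {g : ℕ → Bool}

/-- The edges of villages except those joining the houses to the surface. -/
def coreEdges : Set XEdge := {e | (∃ b, e = .base b) ∧ ∀ i, e ≠ .base (.wall i 1) ∧
  e ≠ .base (.wall i 6)}

/-- All edges, except for the last wall of the houses that have a partner to their right, and the
first wall of those that have a partner to their left. -/
def coupledEdges (μ : ℕ → ℕ) : Set XEdge := {e | ∀ i, (i < μ i → e ≠ .base (.wall i 6)) ∧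
  (μ i < i → e ≠ .base (.wall i 1))}

/-- The edges in `coupledEdges μ` other than those to inhabitants of other houses. -/
def detachedEdges (μ : ℕ → ℕ) : Set XEdge := coupledEdges μ ∩ linkedEdges

theorem coreEdges_subset_detachedEdges : coreEdges ⊆ detachedEdges μ := by
  rintro _ ⟨⟨b, rfl⟩, h⟩
  exact ⟨fun i => ⟨fun _ => (h i).2, fun _ => (h i).1⟩, fun i => by simp⟩

theorem exists_dart_coupledVillage (hs : 0 < s) (hF : coreEdges ⊆ F) {v : VillageVertex}
    (hv : v ∈ villageVertices s (Finset.Icc 1 K)) :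
    ∃ d : Dart (coupledVillage s K μ F), d.vertex = v := by
  suffices h : ∃ e, e ∈ coreEdges ∩ xEdges s K μ ∧ (v = (e.ends s μ).1 ∨ v = (e.ends s μ).2) by
    obtain ⟨e, he, h⟩ := h
    exact ⟨⟨v, e, coupledVillage_inc.2 ⟨⟨hF he.1, he.2⟩, h⟩⟩, rfl⟩
  cases v with
  | centre =>
    exact ⟨.base (.spoke 1), ⟨⟨⟨_, rfl⟩, by simp⟩, by simp; omega⟩, .inl rfl⟩
  | surface k =>
    exact ⟨.base (.spoke k), ⟨⟨⟨_, rfl⟩, by simp⟩, by simpa using hv⟩, .inr rfl⟩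
  | wall x k =>
    rw [wall_vertex_mem] at hv
    by_cases hk : k = 6
    · exact ⟨.base (.wall x 5), ⟨⟨⟨_, rfl⟩, by simp⟩, ⟨hv.1, hv.2.1, by omega, by omega⟩⟩, .inr
        (by simp [hk, XEdge.ends, villageEnds, houseVertex])⟩
    · refine ⟨.base (.wall x k), ⟨⟨⟨_, rfl⟩, by simp; omega⟩, ?_⟩, .inl ?_⟩
      · exact ⟨hv.1, hv.2.1, by omega, by omega⟩
      · change VillageVertex.wall x k = houseVertex x k
        unfold houseVertex
        rw [if_neg (by omega), if_neg (by omega)]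
  | inhabitant x =>
    rw [inhabitant_mem] at hv
    exact ⟨.base (.claw x 2), ⟨⟨⟨_, rfl⟩, by simp⟩, ⟨hv.1, hv.2, .inl rfl⟩⟩, .inl rfl⟩

theorem cycChain_of_forall {β : Type*} {R : β → β → Prop} {l : List β}
    (h : ∀ a ∈ l, ∀ b ∈ l, R a b) : CycChain R l := by
  cases l with
  | nil => trivial
  | cons a l =>
    refine List.isChain_iff_getElem.2 fun i hi => h _ ?_ _ ?_
    · have : ∀ x ∈ a :: (l ++ [a]), x ∈ a :: l := by simp [or_comm]
      exact this _ (List.getElem_mem _)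
    · have : ∀ x ∈ a :: (l ++ [a]), x ∈ a :: l := by simp [or_comm]
      exact this _ (List.getElem_mem _)

/-- A face at the edges between two coupled houses. -/
def coupleRoom (μ : ℕ → ℕ) (g : ℕ → Bool) (i : ℕ) : XEdge → Bool → Prop
  | .base (.wall x k), b => x = i ∧ (k = 4 ∨ k = 5) ∧ b = g i
  | .base (.claw x k), b => x = μ i ∧ k = 2 ∧ b = !g i
  | .link x, b => x = i ∧ b = g i
  | .couple x, b => x = i ∧ b = !g i
  | _, _ => False

/-- The face is bounded by the walls from `v_4` to `v_6` of `H_i`, the link, the edge from `v_2` of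
the partner to its inhabitant, and the coupling edge. It exists because the inhabitant of `H_i`,
being on the other side of the long wall, is not in the way. -/
theorem isFaceSet_coupleRoom (hμ : IsNoncrossing K μ) (hK : K ≤ s) {i : ℕ} (hi : i < μ i)
    (hg : g (μ i) = !g i) :
    (ringSystem s K hμ.invol (coupledEdges μ) g).IsFaceSet (dartSet (coupleRoom μ g i)) := by
  refine ringSystem_isFaceSet hμ.invol fun v hv p hp => ?_
  have hmem : ∀ i, i < μ i → 1 ≤ i ∧ μ i ≤ K := fun i h =>
    ⟨(hμ.mem i (by omega)).1, (hμ.mem' (i := i) (by omega)).2⟩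
  have hw : ∀ x k, p (.base (.wall x k)) = true ↔ (1 ≤ x ∧ x ≤ K) ∧ (1 ≤ x ∧ x ≤ s) ∧
      (1 ≤ k ∧ k ≤ 6) ∧ (k = 6 → ¬ x < μ x) ∧ (k = 1 → ¬ μ x < x) := by
    intro x k
    rw [hp]
    simp [coupledEdges]
    grind
  have hc : ∀ x k, p (.base (.claw x k)) = true ↔
      (1 ≤ x ∧ x ≤ K) ∧ (1 ≤ x ∧ x ≤ s) ∧ (k = 2 ∨ k = 4 ∨ k = 6) := by
    intro x k
    rw [hp]
    simp [coupledEdges]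
  have hcp : ∀ i, p (.couple i) = true ↔ i < μ i := by
    intro x
    rw [hp]
    have := hmem x
    simp [coupledEdges]
    omega
  have hl : ∀ i, p (.link i) = true ↔ i < μ i := by
    intro x
    rw [hp]
    have := hmem x
    simp [coupledEdges]
    omega
  have hinv := hμ.invol
  cases v with
  | centre =>
    refine cycChain_of_forall fun a ha b hb => ?_
    simp only [ring, List.mem_filter, List.mem_map] at ha hb
    obtain ⟨⟨k, -, rfl⟩, -⟩ := ha
    obtain ⟨⟨l, -, rfl⟩, -⟩ := hb
    simp [dartRel, coupleRoom]
  | surface k =>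
    have h1 : ∀ a ∈ (ring s μ g (.surface k)).filter p, ∀ b, ¬ coupleRoom μ g i a b := by
      intro a ha b
      simp only [ring, List.mem_filter, List.mem_append, surfaceWalls] at ha
      grind [coupleRoom]
    refine cycChain_of_forall fun a ha b hb => ?_
    simp [dartRel, h1 a ha, h1 b hb]
  | wall x k =>
    rw [wall_vertex_mem] at hv
    obtain ⟨hv1, hv2, hk1, hk2⟩ := hv
    rw [Finset.mem_Icc] at hv1 hv2
    interval_cases k
    · by_cases hx : x = μ i
      · subst hx
        have hn : ¬ μ i < i := by omega
        cases hgi : g i <;>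
          simp [ring, hw, hc, hl, hg, hgi, hinv, hi, hn, hv1, hv2, CycChain, dartRel, dirAt, coupleRoom]
      · have hx' : μ x ≠ i := by rintro rfl; exact hx (hinv x).symm
        cases hgx : g x <;> by_cases hc1 : μ x < x <;>
          simp [ring, hw, hc, hl, hgx, hinv, hx, hx', hc1, hv1, hv2, CycChain, dartRel, dirAt, coupleRoom]
    · simp [ring, hw, hv1, hv2, CycChain, dartRel, dirAt, coupleRoom]
    · by_cases hx : x = i
      · subst hx
        cases hgi : g x <;>
          simp [ring, hw, hc, hcp, hgi, hi, hv1, hv2, CycChain, dartRel, dirAt, coupleRoom]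
      · cases hgx : g x <;> by_cases hc1 : x < μ x <;>
        simp [ring, hw, hc, hcp, hgx, hx, hc1, hv1, hv2, CycChain, dartRel, dirAt, coupleRoom]
    · simp [ring, hw, hv1, hv2, CycChain, dartRel, dirAt, coupleRoom]
    · by_cases hx : x = i
      · subst hx
        cases hgi : g x <;>
          simp [ring, hw, hc, hl, hgi, hi, hv1, hv2, CycChain, dartRel, dirAt, coupleRoom]
      · cases hgx : g x <;> by_cases hc1 : x < μ x <;>
        simp [ring, hw, hc, hl, hgx, hx, hc1, hv1, hv2, CycChain, dartRel, dirAt, coupleRoom]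
  | inhabitant x =>
    rw [inhabitant_mem] at hv
    obtain ⟨hv1, hv2⟩ := hv
    rw [Finset.mem_Icc] at hv1 hv2
    by_cases hx : x = μ i
    · subst hx
      have hn : ¬ μ i < i := by omega
      cases hgi : g i <;>
        simp [ring, hc, hcp, hg, hgi, hinv, hi, hv1, hv2, CycChain, dartRel, dirAt, coupleRoom]
    · have hx' : μ x ≠ i := by rintro rfl; exact hx (hinv x).symm
      cases hgx : g x <;> by_cases hc1 : μ x < x <;>
        simp [ring, hc, hcp, hgx, hinv, hx, hx', hc1, hv1, hv2, CycChain, dartRel, dirAt, coupleRoom]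

theorem hasPotentialsOn_of_subset_linked (hμ : IsNoncrossing K μ) (hK : K ≤ s) {M : ℕ} (hM : M ≤ K)
    (hF : F ⊆ linkedEdges) : (ringSystem s M hμ.invol F g).HasPotentialsOn Set.univ :=
  (hasPotentialsOn_linked hμ hK).of_induces (coupledVillage_mono hM hF)
    (ringSystem_inducesRot hμ.invol hM hF)

/-- Without its coupling edges, the graph is a subgraph of the village with links and so has
potentials. Each coupling edge is on the boundary of a face that is bounded by no other coupling
edge, so potentials extend past these edges, and then the edges themselves can be admitted. -/
theorem hasPotentialsOn_coupled (hμ : IsNoncrossing K μ) (hK : K ≤ s) (hs : 0 < s)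
    (hg : ∀ i, i < μ i → g (μ i) = !g i) :
    (ringSystem s K hμ.invol (coupledEdges μ) g).HasPotentialsOn Set.univ := by
  have hsub : detachedEdges μ ⊆ coupledEdges μ := Set.inter_subset_left
  have hce : ∀ e, e ∈ coupledEdges μ ∩ xEdges s K μ → e ∉ detachedEdges μ ∩ xEdges s K μ →
      ∃ i, i < μ i ∧ e = .couple i := by
    intro e he he'
    have h1 : e ∉ linkedEdges := fun h => he' ⟨⟨he.1, h⟩, he.2⟩
    simp only [linkedEdges, Set.mem_ofPred_eq, not_forall, not_not] at h1
    obtain ⟨i, rfl⟩ := h1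
    exact ⟨i, (couple_mem_xEdges.1 he.2).2.1, rfl⟩
  have hdet := hasPotentialsOn_of_subset_linked (g := g) hμ hK le_rfl
    (Set.inter_subset_right : detachedEdges μ ⊆ linkedEdges)
  let D : XEdge → XEdge → Bool → Prop := fun e f b => ∃ i, e = .couple i ∧ coupleRoom μ g i f b
  have hDc : ∀ i, D (.couple i) = coupleRoom μ g i := by
    intro i
    funext f b
    simp [D]
  have hbd : ∀ e ∈ E(coupledVillage s K μ (coupledEdges μ)),
      e ∉ E(coupledVillage s K μ (detachedEdges μ)) →
      ∀ d : Dart (coupledVillage s K μ (coupledEdges μ)),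
        d.edge ∉ E(coupledVillage s K μ (detachedEdges μ)) → d.edge ≠ e →
      (d ∈ dartSet (D e) ↔ d.rev ∈ dartSet (D e)) := by
    intro e he he' d hd hne
    obtain ⟨i, -, rfl⟩ := hce e he he'
    obtain ⟨j, -, hj⟩ := hce _ d.inc.edge_mem hd
    rw [mem_dartSet, rev_mem_dartSet, hDc, hj]
    have : j ≠ i := by
      rintro rfl
      exact hne hj
    simp [coupleRoom, this]
  have hsep : ∀ e ∈ E(coupledVillage s K μ (coupledEdges μ)),
      e ∉ E(coupledVillage s K μ (detachedEdges μ)) →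
      ∃ d : Dart (coupledVillage s K μ (coupledEdges μ)), d.edge = e ∧ d ∈ dartSet (D e) ∧
        d.rev ∉ dartSet (D e) := by
    intro e he he'
    obtain ⟨i, -, rfl⟩ := hce e he he'
    obtain ⟨d, h1, h2⟩ := exists_dart_dirAt he (!g i)
    refine ⟨d, h1, ?_, ?_⟩
    · rw [mem_dartSet, hDc, h1, ← h1, h2, h1]
      simp [coupleRoom]
    · rw [rev_mem_dartSet, hDc, h2, h1]
      simp [coupleRoom]
  have hD : ∀ e ∈ E(coupledVillage s K μ (coupledEdges μ)),
      e ∉ E(coupledVillage s K μ (detachedEdges μ)) →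
      (ringSystem s K hμ.invol (coupledEdges μ) g).IsFaceSet (dartSet (D e)) := by
    intro e he he'
    obtain ⟨i, hi, rfl⟩ := hce e he he'
    rw [hDc]
    exact isFaceSet_coupleRoom hμ hK hi (hg i hi)
  have h1 := hdet.of_subgraph (coupledVillage_mono le_rfl hsub)
    (ringSystem_inducesRot hμ.invol le_rfl hsub)
    (fun d => exists_dart_coupledVillage hs coreEdges_subset_detachedEdges d.inc.vertex_mem)
    (fun e => dartSet (D e)) hD hbd hsep
  refine (h1.union {e | e ∉ E(coupledVillage s K μ (detachedEdges μ))} (fun e => dartSet (D e))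
    (fun e h h' => hD e h' h) (fun e h h' => hbd e h' h) (fun e h h' => hsep e h' h)).mono ?_
  intro e _ _
  exact em _

end

/-! ### Cut vertices and 2-connectedness -/

section

section Connectivity

variable {α β α' β' : Type*} {G : Graph α β}

/-- No vertex separates two other vertices. -/
def HasNoCutVertex (G : Graph α β) : Prop :=
  ∀ (v : α) (P : α → Prop), (∀ e x y, G.IsLink e x y → x ≠ v → y ≠ v → (P x ↔ P y)) →
    ∀ x ∈ V(G), x ≠ v → ∀ y ∈ V(G), y ≠ v → P x → P y

theorem connected_of_forall (h : V(G).Nonempty)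
    (hG : ∀ P : α → Prop, (∀ e x y, G.IsLink e x y → (P x ↔ P y)) →
      ∀ x ∈ V(G), ∀ y ∈ V(G), P x → P y) : G.toSimpleGraph.Connected := by
  have : Nonempty V(G) := h.to_subtype
  refine ⟨fun x y => ?_⟩
  have h1 := hG (fun z => ∃ hz : z ∈ V(G), G.toSimpleGraph.Reachable x ⟨z, hz⟩) ?_ x x.2 y y.2
    ⟨x.2, .refl _⟩
  · exact h1.2
  · intro e a b hab
    have key : ∀ a b, G.IsLink e a b →
        (∃ hz : a ∈ V(G), G.toSimpleGraph.Reachable x ⟨a, hz⟩) →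
        ∃ hz : b ∈ V(G), G.toSimpleGraph.Reachable x ⟨b, hz⟩ := by
      rintro a b hab ⟨ha, hr⟩
      refine ⟨hab.right_mem, hr.trans ?_⟩
      by_cases hne : a = b
      · subst hne
        exact .refl _
      · exact SimpleGraph.Adj.reachable ⟨fun h => hne (congrArg Subtype.val h), ⟨e, hab⟩⟩
    exact ⟨key _ _ hab, key _ _ hab.symm⟩

/-- Removing a vertex that is not in the graph removes nothing. -/
theorem HasNoCutVertex.connected (h : HasNoCutVertex G) (hne : V(G).Nonempty)
    (hout : ∃ v, v ∉ V(G)) : G.toSimpleGraph.Connected := by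
  obtain ⟨v, hv⟩ := hout
  have hv' : ∀ x ∈ V(G), x ≠ v := fun x hx h => hv (h ▸ hx)
  exact connected_of_forall hne fun P hP x hx y hy =>
    h v P (fun e a b hab _ _ => hP e a b hab) x hx (hv' x hx) y hy (hv' y hy)

theorem HasNoCutVertex.twoConnected (h : HasNoCutVertex G) (h3 : 3 ≤ V(G).ncard)
    (hout : ∃ v, v ∉ V(G)) : TwoConnected G := by
  have hfin : V(G).Finite := Set.finite_of_ncard_pos (by omega)
  refine ⟨h3, h.connected (Set.nonempty_of_ncard_ne_zero (by omega)) hout, fun v hv => ?_⟩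
  refine connected_of_forall ?_ fun P hP x hx y hy => ?_
  · rw [Graph.vertexSet_deleteVerts]
    refine Set.nonempty_of_ncard_ne_zero ?_
    rw [Set.ncard_sdiff_singleton_of_mem hv]
    omega
  · rw [Graph.vertexSet_deleteVerts] at hx hy
    refine h v P (fun e a b hab ha hb => hP e a b ?_) x hx.1 hx.2 y hy.1 hy.2
    rw [Graph.deleteVerts_isLink]
    exact ⟨hab, ha, hb⟩

theorem HasNoCutVertex.mono {H : Graph α β} (h : HasNoCutVertex H) (hle : H ≤ G)
    (hV : V(H) = V(G)) : HasNoCutVertex G := by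
  intro v P hP
  rw [← hV]
  exact h v P fun e x y hxy => hP e x y (hxy.mono hle)

/-- The same graph with other names for the vertices and the edges. -/
def relabel (a : α ≃ α') (b : β ≃ β') (G : Graph α β) : Graph α' β' where
  vertexSet := {x | a.symm x ∈ V(G)}
  edgeSet := {e | b.symm e ∈ E(G)}
  IsLink e x y := G.IsLink (b.symm e) (a.symm x) (a.symm y)
  isLink_symm _ _ := ⟨fun _ _ h => h.symm⟩
  eq_or_eq_of_isLink_of_isLink e x y v w h h' := by
    rcases h.left_eq_or_eq h' with h | h
    · exact .inl (a.symm.injective h)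
    · exact .inr (a.symm.injective h)
  edge_mem_iff_exists_isLink e := by
    constructor
    · intro he
      obtain ⟨x, y, h⟩ := Graph.exists_isLink_of_mem_edgeSet he
      exact ⟨a x, a y, by simpa using h⟩
    · rintro ⟨x, y, h⟩
      exact h.edge_mem
  left_mem_of_isLink e x y h := h.left_mem

theorem HasNoCutVertex.relabel (h : HasNoCutVertex G) (a : α ≃ α') (b : β ≃ β') :
    HasNoCutVertex (relabel a b G) := by
  intro v P hP x hx hxv y hy hyv
  have := h (a.symm v) (fun z => P (a z)) (fun e u w huw hu hw => ?_) (a.symm x) hx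
    (by simpa using hxv) (a.symm y) hy (by simpa using hyv)
  · simpa using this
  · refine hP (b e) _ _ ?_ (fun h => hu (by rw [← h]; simp)) (fun h => hw (by rw [← h]; simp))
    change G.IsLink _ _ _
    simpa using huw

/-- If the ends of a path are not separated from `c`, then neither are its other vertices. -/
theorem iff_of_path {v : α} {P : α → Prop} {c : Prop} (u : ℕ → α) (n : ℕ)
    (hinj : ∀ a ≤ n, ∀ b ≤ n, u a = u b → a = b)
    (hstep : ∀ k < n, u k ≠ v → u (k + 1) ≠ v → (P (u k) ↔ P (u (k + 1))))
    (h0 : u 0 ≠ v → (P (u 0) ↔ c)) (hn : u n ≠ v → (P (u n) ↔ c)) {k : ℕ} (hk : k ≤ n)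
    (hkv : u k ≠ v) : P (u k) ↔ c := by
  -- The vertex `v` occurs at most once on the path. If it comes before `u k`, then the far end is
  -- reached from `u k` without meeting `v`, and otherwise the beginning is.
  by_cases h : ∃ l < k, u l = v
  · obtain ⟨l, hl, hlv⟩ := h
    have hne : ∀ m, l < m → m ≤ n → u m ≠ v := fun m h1 h2 h3 => by
      have := hinj m h2 l (by omega) (h3.trans hlv.symm)
      omega
    have : ∀ d ≤ n - k, P (u (n - d)) ↔ c := by
      intro d hd
      induction d with
      | zero => exact hn (hne n (by omega) le_rfl)
      | succ d ih =>
        rw [← ih (by omega)]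
        have := hstep (n - (d + 1)) (by omega) (hne _ (by omega) (by omega))
          (hne _ (by omega) (by omega))
        rwa [show n - (d + 1) + 1 = n - d by omega] at this
    have := this (n - k) le_rfl
    rwa [show n - (n - k) = k by omega] at this
  · push Not at h
    induction k with
    | zero => exact h0 hkv
    | succ k ih =>
      have h1 := h k (by omega)
      rw [← hstep k (by omega) h1 hkv]
      exact ih (by omega) h1 fun l hl => h l (by omega)

end Connectivity

variable {s K : ℕ} {μ : ℕ → ℕ} {F : Set XEdge} {g : ℕ → Bool}

/-- The planet stays connected when any vertex is deleted. Each house without a partner, and each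
pair of linked houses, has its wall vertices on a path with both ends on the planet, and every
inhabitant has several neighbours on such a path. -/
theorem hasNoCutVertex_detached (hμ : IsNoncrossing K μ) (hK : K ≤ s) :
    HasNoCutVertex (coupledVillage s K μ (detachedEdges μ)) := by
  intro v P hP
  have hP' : ∀ e ∈ xEdges s K μ, e ∈ detachedEdges μ → (e.ends s μ).1 ≠ v → (e.ends s μ).2 ≠ v →
      (P (e.ends s μ).1 ↔ P (e.ends s μ).2) := fun e h1 h2 => hP e _ _ ⟨⟨h2, h1⟩, .inl rfl⟩
  have hbase : ∀ b ∈ villageEdges s (Finset.Icc 1 K), (∀ i, b ≠ .wall i 1 ∧ b ≠ .wall i 6) →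
      (villageEnds s b).1 ≠ v → (villageEnds s b).2 ≠ v →
      (P (villageEnds s b).1 ↔ P (villageEnds s b).2) := fun b h1 h2 =>
    hP' (.base b) h1 (coreEdges_subset_detachedEdges ⟨⟨b, rfl⟩, by simpa using h2⟩)
  -- the planet
  obtain ⟨c, hc0, hc⟩ : ∃ c : Prop, (.centre ≠ v → (P .centre ↔ c)) ∧
      ∀ k, 1 ≤ k → k ≤ 4 * s → .surface k ≠ v → (P (.surface k) ↔ c) := by
    by_cases hv : VillageVertex.centre = v
    · subst hv
      refine ⟨P (.surface 1), by simp, fun k hk1 hk2 _ => ?_⟩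
      induction k, hk1 using Nat.le_induction with
      | base => rfl
      | succ k hk1 ih =>
        rw [← ih (by omega) (by simp)]
        have h1 : k ≠ 4 * s := by omega
        have := hbase (.rim k) ⟨hk1, by omega⟩ (by simp) (by simp [villageEnds])
          (by simp [villageEnds])
        simp only [villageEnds, h1, if_false] at this
        exact this.symm
    · refine ⟨P .centre, fun _ => Iff.rfl, fun k hk1 hk2 hk => ?_⟩
      exact (hbase (.spoke k) ⟨hk1, hk2⟩ (by simp) hv hk).symm
  have hwall : ∀ x, 1 ≤ x → x ≤ K → ∀ k, 1 ≤ k → k ≤ 6 → (k = 6 → μ x ≤ x) → (k = 1 → x ≤ μ x) →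
      houseVertex x k ≠ v → houseVertex x (k + 1) ≠ v →
      (P (houseVertex x k) ↔ P (houseVertex x (k + 1))) := by
    intro x hx hxK k hk1 hk2 h6 h1
    refine hP' (.base (.wall x k)) ?_ ⟨fun i => ?_, by simp [linkedEdges]⟩
    · simp
      omega
    · constructor
      · rintro h ⟨⟩
        omega
      · rintro h ⟨⟩
        omega
  -- the houses
  have house : ∀ x, 1 ≤ x → x ≤ K → ∀ k, 1 ≤ k → k ≤ 7 → houseVertex x k ≠ v →
      (P (houseVertex x k) ↔ c) := by
    have hfirst : ∀ x, 1 ≤ x → x ≤ K → houseVertex x 1 ≠ v → (P (houseVertex x 1) ↔ c) :=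
      fun x h1 h2 h => hc (4 * x - 3) (by omega) (by omega) h
    have hlast : ∀ x, 1 ≤ x → x ≤ K → houseVertex x 7 ≠ v → (P (houseVertex x 7) ↔ c) :=
      fun x h1 h2 h => hc (4 * x - 1) (by omega) (by omega) h
    have hsingle : ∀ x, 1 ≤ x → x ≤ K → μ x = x → ∀ k, 1 ≤ k → k ≤ 7 → houseVertex x k ≠ v →
        (P (houseVertex x k) ↔ c) := by
      intro x hx hxK hxx k hk1 hk2 hkv
      have := iff_of_path (v := v) (P := P) (c := c) (fun k => houseVertex x (k + 1)) 6 ?_ ?_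
        (hfirst x hx hxK) (hlast x hx hxK) (k := k - 1) (by omega)
      · simp only [show k - 1 + 1 = k by omega] at this
        exact this hkv
      · intro a ha b hb h
        simp only [houseVertex] at h
        grind
      · intro k hk
        exact hwall x hx hxK (k + 1) (by omega) (by omega) (by omega) (by omega)
    -- The path has twelve vertices: `v_1, …, v_6` of `H_i`, then `v_2, …, v_7` of its partner,
    -- joined by the link. The index `k - 4` lets the second half begin at `v_2` for `k = 6`.
    have hpair : ∀ i, i < μ i → ∀ k, k ≤ 11 →
        (if k < 6 then houseVertex i (k + 1) else houseVertex (μ i) (k - 4)) ≠ v →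
        (P (if k < 6 then houseVertex i (k + 1) else houseVertex (μ i) (k - 4)) ↔ c) := by
      intro i hi k hk hkv
      have h1 := hμ.mem i (by omega)
      have h2 := hμ.mem' (i := i) (by omega)
      have h3 := hμ.invol i
      refine iff_of_path (v := v) (P := P) (c := c)
        (fun k => if k < 6 then houseVertex i (k + 1) else houseVertex (μ i) (k - 4)) 11 ?_ ?_
        (hfirst i h1.1 h1.2) (hlast (μ i) h2.1 h2.2) hk hkv
      · intro a ha b hb h
        simp only [houseVertex] at h
        grind
      · intro k hk
        rcases lt_trichotomy k 5 with h5 | rfl | h5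
        · simp only [show k < 6 by omega, show k + 1 < 6 by omega, if_true]
          exact hwall i h1.1 h1.2 (k + 1) (by omega) (by omega) (by omega) (by omega)
        · exact hP' (.link i) (by simp; omega)
            ⟨fun _ => by simp, fun _ => by simp⟩
        · simp only [show ¬ k < 6 by omega, show ¬ k + 1 < 6 by omega, if_false]
          have := hwall (μ i) h2.1 h2.2 (k - 4) (by omega) (by omega) (by omega) (by omega)
          rwa [show k - 4 + 1 = k + 1 - 4 by omega] at this
    intro x hx hxK k hk1 hk2 hkv
    rcases lt_trichotomy (μ x) x with h | h | h
    · have h3 := hμ.invol x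
      by_cases hk : k = 1
      · subst hk
        exact hfirst x hx hxK hkv
      · have := hpair (μ x) (by omega) (k + 4) (by omega)
        simp only [show ¬ k + 4 < 6 by omega, if_false, h3, Nat.add_sub_cancel] at this
        exact this hkv
    · exact hsingle x hx hxK h k hk1 hk2 hkv
    · by_cases hk : k = 7
      · subst hk
        exact hlast x hx hxK hkv
      · have := hpair x h (k - 1) (by omega)
        simp only [show k - 1 < 6 by omega, if_true, show k - 1 + 1 = k by omega] at this
        exact this hkv
  have all : ∀ x ∈ villageVertices s (Finset.Icc 1 K), x ≠ v → (P x ↔ c) := by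
    intro x hx hxv
    cases x with
    | centre => exact hc0 hxv
    | surface k => exact hc k hx.1 hx.2 hxv
    | wall x k =>
      rw [wall_vertex_mem, Finset.mem_Icc] at hx
      have h1 : houseVertex x k = .wall x k := by
        unfold houseVertex
        rw [if_neg (by omega), if_neg (by omega)]
      rw [← h1]
      exact house x hx.1.1 hx.1.2 k (by omega) (by omega) (by rwa [h1])
    | inhabitant x =>
      rw [inhabitant_mem] at hx
      have hxK := Finset.mem_Icc.1 hx.1
      obtain ⟨k, hk, hkv⟩ : ∃ k, (k = 2 ∨ k = 4) ∧ houseVertex x k ≠ v := by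
        by_cases h2 : houseVertex x 2 = v
        · refine ⟨4, .inr rfl, fun h4 => ?_⟩
          have := h2.trans h4.symm
          simp [houseVertex] at this
        · exact ⟨2, .inl rfl, h2⟩
      rw [← house x hxK.1 hxK.2 k (by omega) (by omega) hkv]
      exact hbase (.claw x k) ⟨hx.1, hx.2, by omega⟩ (by simp) hxv hkv
  intro x hx hxv y hy hyv hPx
  exact (all y hy hyv).2 ((all x hx hxv).1 hPx)

theorem isNoncrossing_id : IsNoncrossing K id := ⟨by simp, by simp, fun i x h h' => by simp at *; omega⟩

/-- Further edges on the same vertices create no cut vertex. A village contains the detached graph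
for the trivial matching, in which no wall is deleted. -/
theorem hasNoCutVertex_coupledVillage (hμ : IsNoncrossing K μ) (hK : K ≤ s) {M : ℕ} (hM : M ≤ K)
    (hF : detachedEdges μ ⊆ F ∧ M = K ∨ baseEdges ⊆ F) :
    HasNoCutVertex (coupledVillage s M μ F) := by
  rcases hF with ⟨hF, rfl⟩ | hF
  · exact (hasNoCutVertex_detached hμ hK).mono (coupledVillage_mono le_rfl hF) rfl
  · refine (hasNoCutVertex_detached (μ := id) isNoncrossing_id (hM.trans hK)).mono ?_ rfl
    refine ⟨subset_rfl, ?_⟩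
    rintro e x y ⟨⟨he, he'⟩, h⟩
    rcases e with b | i | i
    · exact ⟨⟨hF ⟨b, rfl⟩, he'⟩, h⟩
    · simp at he'
    · simp at he'

theorem three_le_ncard_villageVertices (hs : 0 < s) :
    3 ≤ (villageVertices s (Finset.Icc 1 K)).ncard := by
  have h1 : ({.centre, .surface 1, .surface 2} : Set VillageVertex) ⊆
      villageVertices s (Finset.Icc 1 K) := by
    rintro x (rfl | rfl | rfl) <;> simp <;> omega
  have h2 : ({.centre, .surface 1, .surface 2} : Set VillageVertex).ncard = 3 := by
    rw [Set.ncard_eq_three]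
    exact ⟨.centre, .surface 1, .surface 2, by simp, by simp, by simp, rfl⟩
  rw [← h2]
  exact Set.ncard_le_ncard h1 (villageVertices_bound s K).1

theorem isFiniteConnected_coupledVillage (hs : 0 < s) (hF : coreEdges ⊆ F)
    (h : HasNoCutVertex (coupledVillage s K μ F)) :
    IsFiniteConnected (coupledVillage s K μ F) where
  finite_vertexSet := finite_vertexSet_coupledVillage
  finite_edgeSet := finite_edgeSet_coupledVillage
  loopless := inferInstance
  connected := h.connected ⟨.centre, trivial⟩ ⟨.surface 0, by simp⟩
  exists_dart v hv := exists_dart_coupledVillage hs hF hv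

/-! ### Degrees -/

/-- The bound is the length of the list at the vertex. The better bound in the absence of houses is
needed for `s = 1`, when the centre has degree four only. -/
theorem ncard_incidenceSet_le (hμ : ∀ i, μ (μ i) = i) {v : VillageVertex}
    (hv : v ∈ villageVertices s (Finset.Icc 1 K)) (hvc : v ≠ .centre) :
    ((coupledVillage s K μ F).incidenceSet v).ncard ≤ if K = 0 then 3 else 4 := by
  classical
  have h1 : (coupledVillage s K μ F).incidenceSet v ⊆
      ((ring s μ (fun _ => true) v).filter (· ∈ xEdges s K μ)).toFinset := by
    intro e he
    have he' := coupledVillage_inc.1 he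
    simp only [List.coe_toFinset, List.mem_filter, decide_eq_true_eq]
    exact ⟨(mem_ring hμ hv he'.1.2).2 he'.2, he'.1.2⟩
  refine (Set.ncard_le_ncard h1 (Finset.finite_toSet _)).trans ?_
  rw [Set.ncard_coe_finset]
  refine (List.toFinset_card_le _).trans ?_
  have h2 : ((ring s μ (fun _ => true) v).filter (· ∈ xEdges s K μ)).length ≤ 4 := by
    refine (List.length_filter_le _ _).trans ?_
    cases v with
    | centre => exact absurd rfl hvc
    | surface k => simp only [ring, surfaceWalls]; split_ifs <;> simp
    | wall i k => simp only [ring]; split_ifs <;> simp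
    | inhabitant i => simp [ring]
  split_ifs with hK
  · subst hK
    cases v with
    | centre => exact absurd rfl hvc
    | surface k =>
      have : (surfaceWalls k).filter (· ∈ xEdges s 0 μ) = [] := by
        simp only [surfaceWalls]
        split_ifs <;> simp
      simp only [ring, List.filter_append, this, List.length_append, List.length_nil]
      have h3 := List.length_filter_le (· ∈ xEdges s 0 μ)
        [XEdge.base (.spoke k), .base (.rim (predSurface s k))]
      have h4 := List.length_filter_le (· ∈ xEdges s 0 μ) [XEdge.base (.rim k)]
      simp only [List.length_cons, List.length_nil] at h3 h4
      omega
    | wall i k => simp at hv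
    | inhabitant i => simp at hv
  · exact h2

theorem le_ncard_incidenceSet_centre (hF : coreEdges ⊆ F) :
    4 * s ≤ ((coupledVillage s K μ F).incidenceSet .centre).ncard := by
  classical
  have h1 : (((Finset.Icc 1 (4 * s)).image fun k => XEdge.base (.spoke k) : Finset XEdge) :
      Set XEdge) ⊆ (coupledVillage s K μ F).incidenceSet .centre := by
    intro e he
    simp only [Finset.coe_image, Finset.coe_Icc, Set.mem_image, Set.mem_Icc] at he
    obtain ⟨k, hk, rfl⟩ := he
    exact coupledVillage_inc.2 ⟨⟨hF ⟨⟨_, rfl⟩, by simp⟩, hk⟩, .inl rfl⟩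
  have h2 := Set.ncard_le_ncard h1
    (finite_edgeSet_coupledVillage.subset fun e he => he.edge_mem)
  rw [Set.ncard_coe_finset, Finset.card_image_of_injective _ (by
    intro a b h
    simpa using h), Nat.card_Icc] at h2
  omega

/-! ### The effect of the coupling -/

theorem wall_mem_coupledEdges {x k : ℕ} : XEdge.base (.wall x k) ∈ coupledEdges μ ↔
    (x < μ x → k ≠ 6) ∧ (μ x < x → k ≠ 1) := by
  simp only [coupledEdges, Set.mem_ofPred_eq]
  constructor
  · intro h
    exact ⟨fun h1 h2 => (h x).1 h1 (by rw [h2]), fun h1 h2 => (h x).2 h1 (by rw [h2])⟩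
  · intro h i
    constructor
    · rintro h1 ⟨⟩
      exact h.1 h1 rfl
    · rintro h1 ⟨⟩
      exact h.2 h1 rfl

theorem mem_coupledEdges_of_ne {e : XEdge} (h : ∀ x k, e ≠ .base (.wall x k)) :
    e ∈ coupledEdges μ := fun _ => ⟨fun _ => h _ _, fun _ => h _ _⟩

/-- The three edges at the inhabitant of `H_i` continue to disjoint paths to `v_4` of the partner:
over the planet and the last walls, over the coupling edge and the inhabitant of the partner, and
over the link. Inside the partner, the edges at its own inhabitant also continue to three paths to
`v_4`. The two triples of paths arrive there with the two walls at `v_4` exchanged, so the orders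
are opposite. -/
theorem cycAt_coupled (hμ : IsNoncrossing K μ) (hK : K ≤ s)
    {σ : RotationSystem (coupledVillage s K μ (coupledEdges μ))}
    (hσ : σ.HasPotentialsOn Set.univ) {i : ℕ} (hi : i < μ i) :
    σ.CycAt (.inhabitant i) (.base (.claw i 2)) (.base (.claw i 4)) (.base (.claw i 6)) ↔
      ¬ σ.CycAt (.inhabitant (μ i)) (.base (.claw (μ i) 2)) (.base (.claw (μ i) 4))
        (.base (.claw (μ i) 6)) := by
  have h1 := hμ.mem i (by omega)
  have h2 := hμ.mem' (i := i) (by omega)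
  have h3 := hμ.invol i
  generalize hj : μ i = j at *
  have hij : i ≠ j := by omega
  have hji : ¬ j < i := by omega
  have hm := fun e => mem_coupledEdges_of_ne (μ := μ) (e := e)
  have t1 : σ.CycAt (.inhabitant i) (.base (.claw i 2)) (.base (.claw i 4)) (.base (.claw i 6)) ↔
      σ.CycAt (.wall j 4) (.base (.wall j 4)) (.base (.wall j 3)) (.base (.claw j 4)) := by
    refine RotationSystem.cycAt_theta hσ
      (P := [(.base (.claw i 2), .wall i 2), (.base (.wall i 1), .surface (4 * i - 3)),
        (.base (.spoke (4 * i - 3)), .centre), (.base (.spoke (4 * j - 1)), .surface (4 * j - 1)),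
        (.base (.wall j 6), .wall j 6), (.base (.wall j 5), .wall j 5),
        (.base (.wall j 4), .wall j 4)])
      (Q := [(.base (.claw i 4), .wall i 4), (.couple i, .inhabitant j),
        (.base (.claw j 4), .wall j 4)])
      (R := [(.base (.claw i 6), .wall i 6), (.link i, .wall j 2), (.base (.wall j 2), .wall j 3),
        (.base (.wall j 3), .wall j 4)])
      ?_ ?_ ?_ ?_ ?_ ?_ ?_ ?_ rfl rfl rfl rfl rfl rfl ?_ ?_ ?_ ?_ ?_ ?_
    all_goals simp [IsWalk, inner, coupledVillage_isLink, XEdge.ends, villageEnds, houseVertex,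
      wall_mem_coupledEdges, hm, hj, h3, hij, hij.symm, hi, hji]
    all_goals grind
  have t2 : σ.CycAt (.inhabitant j) (.base (.claw j 2)) (.base (.claw j 4)) (.base (.claw j 6)) ↔
      σ.CycAt (.wall j 4) (.base (.wall j 3)) (.base (.wall j 4)) (.base (.claw j 4)) := by
    refine RotationSystem.cycAt_theta hσ
      (P := [(.base (.claw j 2), .wall j 2), (.base (.wall j 2), .wall j 3),
        (.base (.wall j 3), .wall j 4)])
      (Q := [(.base (.claw j 4), .wall j 4)])
      (R := [(.base (.claw j 6), .wall j 6), (.base (.wall j 5), .wall j 5),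
        (.base (.wall j 4), .wall j 4)])
      ?_ ?_ ?_ ?_ ?_ ?_ ?_ ?_ rfl rfl rfl rfl rfl rfl ?_ ?_ ?_ ?_ ?_ ?_
    all_goals simp [IsWalk, inner, coupledVillage_isLink, XEdge.ends, villageEnds, houseVertex,
      wall_mem_coupledEdges, hm, h3, hi, hji]
    all_goals grind
  rw [t1, t2, RotationSystem.not_cycAt_iff, RotationSystem.cycAt_rotate]
  all_goals simp [coupledVillage_inc, XEdge.ends, villageEnds, houseVertex,
    wall_mem_coupledEdges, hm]
  all_goals grind

end

section

/-! ### Blocks of houses -/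

/-- The position of the variable `v` in the block `q`; in odd blocks the order is reversed. -/
def blockPos (m q v : ℕ) : ℕ := q * m + if q % 2 = 0 then v else m + 1 - v

/-- The block of a position. -/
def blockOf (m x : ℕ) : ℕ := (x - 1) / m

/-- The variable at a position. -/
def varOf (m x : ℕ) : ℕ :=
  if blockOf m x % 2 = 0 then (x - 1) % m + 1 else m - (x - 1) % m

variable {m q v x : ℕ}

theorem blockPos_bounds (h1 : 1 ≤ v) (h2 : v ≤ m) :
    q * m + 1 ≤ blockPos m q v ∧ blockPos m q v ≤ q * m + m := by
  unfold blockPos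
  split_ifs <;> omega

theorem blockOf_blockPos (h1 : 1 ≤ v) (h2 : v ≤ m) : blockOf m (blockPos m q v) = q := by
  have h := blockPos_bounds (q := q) h1 h2
  unfold blockOf
  rw [Nat.div_eq_iff (by omega)]
  constructor <;> omega

theorem varOf_blockPos (h1 : 1 ≤ v) (h2 : v ≤ m) : varOf m (blockPos m q v) = v := by
  unfold varOf
  rw [blockOf_blockPos h1 h2]
  unfold blockPos
  split_ifs with h
  · rw [show q * m + v - 1 = v - 1 + m * q by rw [mul_comm m]; omega, Nat.add_mul_mod_self_left,
      Nat.mod_eq_of_lt (by omega)]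
    omega
  · rw [show q * m + (m + 1 - v) - 1 = m - v + m * q by rw [mul_comm m]; omega,
      Nat.add_mul_mod_self_left, Nat.mod_eq_of_lt (by omega)]
    omega

theorem varOf_bounds (hm : 0 < m) : 1 ≤ varOf m x ∧ varOf m x ≤ m := by
  have := Nat.mod_lt (x - 1) hm
  unfold varOf
  split_ifs <;> omega

theorem blockPos_varOf (hm : 0 < m) (hx : 1 ≤ x) : blockPos m (blockOf m x) (varOf m x) = x := by
  have h1 := Nat.mod_lt (x - 1) hm
  have h2 := Nat.div_add_mod (x - 1) m
  have h3 : blockOf m x * m = m * ((x - 1) / m) := mul_comm _ _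
  unfold blockPos varOf
  split_ifs <;> omega

theorem blockOf_lt_iff {B : ℕ} (hm : 0 < m) (hx : 1 ≤ x) : blockOf m x < B ↔ x ≤ m * B := by
  unfold blockOf
  rw [Nat.div_lt_iff_lt_mul hm, mul_comm B]
  omega

/-- Reversing every other block makes the copies of a variable in adjacent blocks symmetric about
the common boundary of the blocks; the sum does not depend on `v`. -/
theorem blockPos_add_succ (h2 : v ≤ m) :
    blockPos m q v + blockPos m (q + 1) v = 2 * (q * m) + 2 * m + 1 := by
  unfold blockPos
  rw [Nat.add_mul]
  split_ifs <;> omega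

theorem blockPos_zero : blockPos m 0 v = v := by simp [blockPos]

/-- The mirror images of adjacent blocks, the left one of parity `t`. -/
def mirror (m B t x : ℕ) : ℕ :=
  if 1 ≤ x ∧ x ≤ m * B then
    if blockOf m x % 2 = t then
      if blockOf m x + 1 < B then blockPos m (blockOf m x + 1) (varOf m x) else x
    else if 1 ≤ blockOf m x then blockPos m (blockOf m x - 1) (varOf m x) else x
  else x

theorem mirror_blockPos {B t : ℕ} (h1 : 1 ≤ v) (h2 : v ≤ m) (hq : q < B) :
    mirror m B t (blockPos m q v) = if q % 2 = t then
      if q + 1 < B then blockPos m (q + 1) v else blockPos m q v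
    else if 1 ≤ q then blockPos m (q - 1) v else blockPos m q v := by
  have h3 := blockPos_bounds (q := q) h1 h2
  have h4 := (blockOf_lt_iff (B := B) (m := m) (x := blockPos m q v) (by omega) (by omega)).1
    (by rwa [blockOf_blockPos h1 h2])
  unfold mirror
  rw [if_pos ⟨by omega, h4⟩, blockOf_blockPos h1 h2, varOf_blockPos h1 h2]

theorem exists_blockPos {B : ℕ} (h : 1 ≤ x ∧ x ≤ m * B) :
    ∃ q v, q < B ∧ 1 ≤ v ∧ v ≤ m ∧ x = blockPos m q v := by
  have hm : 0 < m := by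
    rcases Nat.eq_zero_or_pos m with rfl | h'
    · omega
    · exact h'
  exact ⟨blockOf m x, varOf m x, (blockOf_lt_iff hm h.1).2 h.2, (varOf_bounds hm).1,
    (varOf_bounds hm).2, (blockPos_varOf hm h.1).symm⟩

theorem mirror_of_not {B t : ℕ} (h : ¬ (1 ≤ x ∧ x ≤ m * B)) : mirror m B t x = x := if_neg h

theorem block_eq_of_between {a b : ℕ} (h1 : 1 ≤ v) (h2 : v ≤ m)
    (ha : a * m + 1 ≤ blockPos m q v) (hb : blockPos m q v ≤ b * m + m) :
    a ≤ q ∧ q ≤ b := by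
  have h3 := blockPos_bounds (q := q) h1 h2
  constructor
  · by_contra h
    have := Nat.mul_le_mul_right m (show q + 1 ≤ a by omega)
    rw [Nat.add_mul] at this
    omega
  · by_contra h
    have := Nat.mul_le_mul_right m (show b + 1 ≤ q by omega)
    rw [Nat.add_mul] at this
    omega

/-- Arcs over the same block boundary have the same sum of ends and hence are nested. Arcs over
different boundaries are in disjoint pairs of blocks, as only boundaries of one parity are used. -/
theorem isNoncrossing_mirror {B t : ℕ} (ht : t < 2) : IsNoncrossing (m * B) (mirror m B t) where
  invol i := by
    by_cases hi : 1 ≤ i ∧ i ≤ m * B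
    · obtain ⟨q, v, hq, h1, h2, rfl⟩ := exists_blockPos hi
      rw [mirror_blockPos h1 h2 hq]
      split_ifs with h3 h4 h5
      · rw [mirror_blockPos h1 h2 h4, if_neg (by omega), if_pos (by omega), Nat.add_sub_cancel]
      · rw [mirror_blockPos h1 h2 hq, if_pos h3, if_neg h4]
      · rw [mirror_blockPos h1 h2 (by omega), if_pos (by omega), if_pos (by omega),
          Nat.sub_add_cancel h5]
      · rw [mirror_blockPos h1 h2 hq, if_neg h3, if_neg h5]
    · rw [mirror_of_not hi, mirror_of_not hi]
  mem i hi := by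
    by_contra h
    exact hi (mirror_of_not h)
  noncrossing i x hix hxi := by
    have hi : 1 ≤ i ∧ i ≤ m * B := by
      by_contra h
      rw [mirror_of_not h] at hxi
      omega
    obtain ⟨q, v, hq, h1, h2, rfl⟩ := exists_blockPos hi
    rw [mirror_blockPos h1 h2 hq] at hxi ⊢
    have b0 := blockPos_bounds (q := q) h1 h2
    split_ifs at hxi ⊢ with h3 h4 h5
    · have b1 := blockPos_bounds (q := q + 1) h1 h2
      have hsum := blockPos_add_succ (q := q) h2
      have hx : 1 ≤ x ∧ x ≤ m * B := by
        refine ⟨by omega, ?_⟩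
        have := Nat.mul_le_mul_left m (show q + 1 + 1 ≤ B by omega)
        rw [Nat.mul_add, mul_comm m] at this
        omega
      obtain ⟨q', v', hq', h1', h2', rfl⟩ := exists_blockPos hx
      have hsum' := blockPos_add_succ (q := q) h2'
      have hbe := block_eq_of_between (q := q') (a := q) (b := q + 1) h1' h2' (by omega) (by omega)
      rw [mirror_blockPos h1' h2' hq']
      obtain rfl | rfl : q' = q ∨ q' = q + 1 := by omega
      · rw [if_pos h3, if_pos h4]
        omega
      · rw [if_neg (by omega), if_pos (by omega), Nat.add_sub_cancel]
        omega
    · omega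
    · have b1 := blockPos_bounds (q := q - 1) h1 h2
      have : (q - 1) * m + m = q * m := by
        rw [← Nat.succ_mul]
        congr 1
        omega
      omega
    · omega

/-- In block `q`, the positions of `a q` and `b q` are exchanged. -/
def blockSwap (m n : ℕ) (a b : ℕ → ℕ) (x : ℕ) : ℕ :=
  if 1 ≤ x ∧ x ≤ m * n then
    blockPos m (blockOf m x) (Equiv.swap (a (blockOf m x)) (b (blockOf m x)) (varOf m x))
  else x

theorem blockSwap_blockPos {n : ℕ} {a b : ℕ → ℕ} (h1 : 1 ≤ v) (h2 : v ≤ m) (hq : q < n) :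
    blockSwap m n a b (blockPos m q v) = blockPos m q (Equiv.swap (a q) (b q) v) := by
  have h3 := blockPos_bounds (q := q) h1 h2
  have h4 := (blockOf_lt_iff (B := n) (m := m) (x := blockPos m q v) (by omega) (by omega)).1
    (by rwa [blockOf_blockPos h1 h2])
  unfold blockSwap
  rw [if_pos ⟨by omega, h4⟩, blockOf_blockPos h1 h2, varOf_blockPos h1 h2]

theorem swap_bounds {a b : ℕ} (ha : 1 ≤ a ∧ a ≤ m) (hb : 1 ≤ b ∧ b ≤ m) (hv : 1 ≤ v ∧ v ≤ m) :
    1 ≤ Equiv.swap a b v ∧ Equiv.swap a b v ≤ m := by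
  rw [Equiv.swap_apply_def]
  split_ifs <;> assumption

/-- There is at most one arc in each block, and the blocks are disjoint intervals. -/
theorem isNoncrossing_blockSwap {n B : ℕ} {a b : ℕ → ℕ} (hn : n ≤ B)
    (ha : ∀ q < n, 1 ≤ a q ∧ a q ≤ m) (hb : ∀ q < n, 1 ≤ b q ∧ b q ≤ m) :
    IsNoncrossing (m * B) (blockSwap m n a b) where
  invol i := by
    by_cases hi : 1 ≤ i ∧ i ≤ m * n
    · obtain ⟨q, v, hq, h1, h2, rfl⟩ := exists_blockPos hi
      have h3 := swap_bounds (ha q hq) (hb q hq) ⟨h1, h2⟩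
      rw [blockSwap_blockPos h1 h2 hq, blockSwap_blockPos h3.1 h3.2 hq, Equiv.swap_apply_self]
    · unfold blockSwap
      rw [if_neg hi, if_neg hi]
  mem i hi := by
    by_contra h
    refine hi (if_neg fun h' => h ⟨h'.1, h'.2.trans (Nat.mul_le_mul_left m hn)⟩)
  noncrossing i x hix hxi := by
    have hi : 1 ≤ i ∧ i ≤ m * n := by
      by_contra h
      rw [blockSwap, if_neg h] at hxi
      omega
    obtain ⟨q, v, hq, h1, h2, rfl⟩ := exists_blockPos hi
    have h3 := swap_bounds (ha q hq) (hb q hq) ⟨h1, h2⟩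
    rw [blockSwap_blockPos h1 h2 hq] at hxi ⊢
    have b0 := blockPos_bounds (q := q) h1 h2
    have b1 := blockPos_bounds (q := q) h3.1 h3.2
    have hx : 1 ≤ x ∧ x ≤ m * n := by
      refine ⟨by omega, ?_⟩
      have := Nat.mul_le_mul_left m (show q + 1 ≤ n by omega)
      rw [Nat.mul_add, mul_comm m] at this
      omega
    obtain ⟨q', v', hq', h1', h2', rfl⟩ := exists_blockPos hx
    have hbe := block_eq_of_between (q := q') (a := q) (b := q) h1' h2' (by omega) (by omega)
    obtain rfl : q' = q := by omega
    rw [blockSwap_blockPos h1' h2' hq]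
    have hv : v' ≠ v := by
      rintro rfl
      omega
    have hv' : v' ≠ Equiv.swap (a q') (b q') v := by
      rintro h
      rw [← h] at hxi
      omega
    have : Equiv.swap (a q') (b q') v' = v' := by
      rw [Equiv.swap_apply_def] at hv' hxi ⊢
      split_ifs at hv' hxi ⊢ with c1 c2 c3 c4 c5 <;> grind
    rw [this]
    exact ⟨hix, hxi⟩

theorem exists_enumeration {J : Finset (Finset ℕ)} (hJ : J ⊆ (Finset.Icc 1 m).powersetCard 2) :
    ∃ a b : ℕ → ℕ, (∀ q < J.card, 1 ≤ a q ∧ a q ≤ m ∧ 1 ≤ b q ∧ b q ≤ m ∧ a q ≠ b q ∧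
        ({a q, b q} : Finset ℕ) ∈ J) ∧
      ∀ i j, ({i, j} : Finset ℕ) ∈ J → ∃ q < J.card, a q = i ∧ b q = j ∨ a q = j ∧ b q = i := by
  have h1 : ∀ q : Fin J.card, ∃ p : ℕ × ℕ, p.1 ≠ p.2 ∧
      ((J.equivFin.symm q : J) : Finset ℕ) = {p.1, p.2} := by
    intro q
    have := (Finset.mem_powersetCard.1 (hJ (J.equivFin.symm q).2)).2
    obtain ⟨x, y, hxy, h⟩ := Finset.card_eq_two.1 this
    exact ⟨(x, y), hxy, h⟩
  choose p hp1 hp2 using h1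
  refine ⟨fun q => if h : q < J.card then (p ⟨q, h⟩).1 else 0,
    fun q => if h : q < J.card then (p ⟨q, h⟩).2 else 0, fun q hq => ?_, fun i j hij => ?_⟩
  · simp only [hq, dif_pos]
    have h2 := (J.equivFin.symm ⟨q, hq⟩).2
    have h3 := (Finset.mem_powersetCard.1 (hJ h2)).1
    rw [hp2] at h2 h3
    have h4 := Finset.mem_Icc.1 (h3 (show (p ⟨q, hq⟩).1 ∈ _ by simp))
    have h5 := Finset.mem_Icc.1 (h3 (show (p ⟨q, hq⟩).2 ∈ _ by simp))
    exact ⟨h4.1, h4.2, h5.1, h5.2, hp1 _, h2⟩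
  · set q := J.equivFin ⟨_, hij⟩ with hq
    have h2 := hp2 q
    rw [hq, Equiv.symm_apply_apply, ← hq] at h2
    refine ⟨q, q.2, ?_⟩
    simp only [q.2, dif_pos, Fin.eta]
    have h3 : i ∈ ({(p q).1, (p q).2} : Finset ℕ) := h2 ▸ (by simp)
    have h4 : j ∈ ({(p q).1, (p q).2} : Finset ℕ) := h2 ▸ (by simp)
    have h5 : (p q).1 ∈ ({i, j} : Finset ℕ) := by
      change _ = _ at h2
      simp only at h2
      rw [h2]
      simp
    have h6 : (p q).2 ∈ ({i, j} : Finset ℕ) := by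
      simp only at h2
      rw [h2]
      simp
    simp only [Finset.mem_insert, Finset.mem_singleton] at h3 h4 h5 h6
    have := hp1 q
    grind

/-- Three matchings such that coupling the partners in each of them amounts to `NEQ J`. -/
theorem exists_matchings (m : ℕ) (J : Finset (Finset ℕ))
    (hJ : J ⊆ (Finset.Icc 1 m).powersetCard 2) :
    ∃ (K : ℕ) (μ : ℕ → ℕ → ℕ), m ≤ K ∧ K ≤ m ^ 3 ∧ (∀ t, IsNoncrossing K (μ t)) ∧
      (∀ h : ℕ → Prop, (∀ t < 3, ∀ i, i < μ t i → (h i ↔ ¬ h (μ t i))) →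
        ∀ i j, ({i, j} : Finset ℕ) ∈ J → ¬ (h i ↔ h j)) ∧
      ∀ f : ℕ → Bool, (∀ i j, ({i, j} : Finset ℕ) ∈ J → f i ≠ f j) →
        ∃ g : ℕ → Bool, (∀ i, 1 ≤ i → i ≤ m → g i = f i) ∧
          ∀ t < 3, ∀ i, i < μ t i → g (μ t i) = !g i := by
  obtain ⟨a, b, hab, henum⟩ := exists_enumeration hJ
  set n := J.card with hn
  -- There is at least one block even if `J` is empty, because block 0 consists of the original
  -- houses `H_1, …, H_m`.
  set B := max n 1 with hB
  let μ : ℕ → ℕ → ℕ := fun t => if t < 2 then mirror m B t else blockSwap m n a b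
  have hnB : n ≤ B := le_max_left _ _
  have hμ : ∀ t, IsNoncrossing (m * B) (μ t) := by
    intro t
    by_cases ht : t < 2
    · simp only [μ, ht, if_true]
      exact isNoncrossing_mirror ht
    · simp only [μ, ht, if_false]
      exact isNoncrossing_blockSwap hnB (fun q hq => ⟨(hab q hq).1, (hab q hq).2.1⟩)
        (fun q hq => ⟨(hab q hq).2.2.1, (hab q hq).2.2.2.1⟩)
  refine ⟨m * B, μ, Nat.le_mul_of_pos_right m (by omega), ?_, hμ, ?_, ?_⟩
  · have h1 : n ≤ m.choose 2 := by
      have := Finset.card_le_card hJ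
      rwa [Finset.card_powersetCard, Nat.card_Icc, Nat.add_sub_cancel] at this
    have h2 : m.choose 2 ≤ m ^ 2 := Nat.choose_le_pow m 2
    rcases Nat.eq_zero_or_pos m with rfl | hm
    · simp
    · rw [pow_succ' m 2]
      refine Nat.mul_le_mul_left m (max_le (h1.trans h2) (Nat.one_le_pow _ _ hm))
  · intro h hh i j hij
    have hne : ∀ t < 3, ∀ i, μ t i ≠ i → (h i ↔ ¬ h (μ t i)) := by
      intro t ht i hi
      rcases lt_or_gt_of_ne hi with h1 | h1
      · have h2 := hh t ht (μ t i)
        rw [(hμ t).invol] at h2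
        have := h2 h1
        tauto
      · exact hh t ht i h1
    -- Passing to the next block negates the value, so the copies in even blocks agree with the
    -- original and those in odd blocks are opposite to it.
    have hblock : ∀ q < B, ∀ v, 1 ≤ v → v ≤ m →
        (h (blockPos m q v) ↔ (h v ↔ q % 2 = 0)) := by
      intro q
      induction q with
      | zero => intro _ v _ _; simp [blockPos_zero]
      | succ q ih =>
        intro hq v h1 h2
        have h3 := ih (by omega) v h1 h2
        have h4 : μ (q % 2) (blockPos m q v) = blockPos m (q + 1) v := by
          simp only [μ, Nat.mod_lt q two_pos, if_true]
          rw [mirror_blockPos h1 h2 (by omega), if_pos rfl, if_pos hq]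
        have b0 := blockPos_bounds (q := q) h1 h2
        have b1 := blockPos_bounds (q := q + 1) h1 h2
        rw [Nat.add_mul] at b1
        have h5 := hh (q % 2) (by omega) (blockPos m q v) (by omega)
        rw [h4] at h5
        have h6 : (q + 1) % 2 = 0 ↔ ¬ q % 2 = 0 := by omega
        tauto
    obtain ⟨q, hq, hqq⟩ := henum i j hij
    obtain ⟨h1, h2, h3, h4, h5, -⟩ := hab q hq
    -- Both partners are in block `q`, so they are negated equally often relative to the original
    -- variables.
    have h6 : μ 2 (blockPos m q (a q)) = blockPos m q (b q) := by
      simp only [μ, lt_irrefl, if_false]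
      rw [blockSwap_blockPos h1 h2 hq, Equiv.swap_apply_left]
    have h7 := hne 2 (by omega) (blockPos m q (a q)) (by
      rw [h6]
      intro h8
      have := congrArg (varOf m) h8
      rw [varOf_blockPos h1 h2, varOf_blockPos h3 h4] at this
      exact h5 this.symm)
    rw [h6, hblock q (by omega) _ h1 h2, hblock q (by omega) _ h3 h4] at h7
    rcases hqq with ⟨rfl, rfl⟩ | ⟨rfl, rfl⟩ <;> tauto
  · intro f hf
    -- The values are copied to all blocks and negated in the odd ones.
    let g : ℕ → Bool := fun x => f (varOf m x) ^^ decide (blockOf m x % 2 = 1)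
    have hg : ∀ q v, 1 ≤ v → v ≤ m → g (blockPos m q v) = (f v ^^ decide (q % 2 = 1)) := by
      intro q v h1 h2
      simp only [g, varOf_blockPos h1 h2, blockOf_blockPos h1 h2]
    refine ⟨g, fun i h1 h2 => ?_, fun t ht i hi => ?_⟩
    · have := hg 0 i h1 h2
      rw [blockPos_zero] at this
      simp [this]
    · have hi' := (hμ t).mem i (by omega)
      obtain ⟨q, v, hq, h1, h2, rfl⟩ := exists_blockPos hi'
      by_cases ht2 : t < 2
      · simp only [μ, ht2, if_true] at hi ⊢
        rw [mirror_blockPos h1 h2 hq] at hi ⊢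
        split_ifs at hi ⊢ with h3 h4 h5
        · rw [hg _ _ h1 h2, hg _ _ h1 h2]
          rcases Nat.mod_two_eq_zero_or_one q with h | h
          · simp [h, Nat.add_mod]
          · simp [h, Nat.add_mod]
        · omega
        · have b0 := blockPos_bounds (q := q) h1 h2
          have b1 := blockPos_bounds (q := q - 1) h1 h2
          have : (q - 1) * m + m = q * m := by
            rw [← Nat.succ_mul]
            congr 1
            omega
          omega
        · omega
      · simp only [μ, ht2, if_false] at hi ⊢
        have hqn : q < n := by
          by_contra h
          have h3 : blockSwap m n a b (blockPos m q v) = blockPos m q v := by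
            refine if_neg fun h4 => h ?_
            have := (blockOf_lt_iff (m := m) (by omega) h4.1).2 h4.2
            rwa [blockOf_blockPos h1 h2] at this
          omega
        obtain ⟨a1, a2, b1, b2, hne, hJq⟩ := hab q hqn
        rw [blockSwap_blockPos h1 h2 hqn] at hi ⊢
        have h3 := swap_bounds ⟨a1, a2⟩ ⟨b1, b2⟩ ⟨h1, h2⟩
        rw [hg _ _ h1 h2, hg _ _ h3.1 h3.2]
        have h4 := hf _ _ hJq
        rw [Equiv.swap_apply_def] at hi ⊢
        split_ifs at hi ⊢ with c1 c2
        · rw [c1]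
          revert h4
          cases f (a q) <;> cases f (b q) <;> simp
        · rw [c2]
          revert h4
          cases f (a q) <;> cases f (b q) <;> simp
        · omega

end

section

variable {α β α' β' : Type*} {H : Graph α β} {G : Graph α' β'}

/-! ### Transport of embeddings along isomorphisms -/

/-- An isomorphism is bijective on darts. -/
theorem Mono.IsIso.bijective_onDart {f : Mono H G} (hf : f.IsIso) :
    Function.Bijective f.onDart := by
  refine ⟨f.onDart_injective, fun d => ?_⟩
  obtain ⟨e, he, h1⟩ : d.edge ∈ f.onE '' E(H) := hf.2 ▸ d.inc.edge_mem
  obtain ⟨x, y, hxy⟩ := Graph.exists_isLink_of_mem_edgeSet he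
  have h2 := f.isLink _ _ _ hxy
  rw [h1] at h2
  rcases d.isLink.left_eq_or_eq h2 with h | h
  · exact ⟨dartOf hxy, Dart.ext h.symm h1⟩
  · exact ⟨dartOf hxy.symm, Dart.ext h.symm h1⟩

theorem zpow_apply_of_semiconj {D D' : Type*} {ρ : Equiv.Perm D} {π : Equiv.Perm D'} {e : D → D'}
    (h : ∀ d, e (ρ d) = π (e d)) (n : ℤ) (d : D) : e ((ρ ^ n) d) = (π ^ n) (e d) := by
  have hpow : ∀ (n : ℕ) d, e ((ρ ^ n) d) = (π ^ n) (e d) := by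
    intro n d
    induction n with
    | zero => rfl
    | succ n ih => rw [pow_succ', Equiv.Perm.mul_apply, h, ih, pow_succ', Equiv.Perm.mul_apply]
  cases n with
  | ofNat n => simpa using hpow n d
  | negSucc n =>
    rw [zpow_negSucc, zpow_negSucc, Equiv.Perm.eq_inv_iff_eq, ← hpow, ← Equiv.Perm.mul_apply,
      mul_inv_cancel, Equiv.Perm.one_apply]

theorem sameCycle_iff_of_semiconj {D D' : Type*} {ρ : Equiv.Perm D} {π : Equiv.Perm D'}
    {e : D → D'} (he : Function.Injective e) (h : ∀ d, e (ρ d) = π (e d)) (a b : D) :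
    π.SameCycle (e a) (e b) ↔ ρ.SameCycle a b :=
  exists_congr fun n => by rw [← zpow_apply_of_semiconj h, he.eq_iff]

/-- The map takes the rotations of `τ` to those of `σ`. -/
def Mono.Intertwines (f : Mono H G) (σ : RotationSystem G) (τ : RotationSystem H) : Prop :=
  ∀ d, f.onDart (τ.rot d) = σ.rot (f.onDart d)

theorem Mono.IsIso.exists_pull {f : Mono H G} (hf : f.IsIso) (σ : RotationSystem G) :
    ∃ τ : RotationSystem H, f.Intertwines σ τ := by
  let e := Equiv.ofBijective f.onDart hf.bijective_onDart
  have he : ∀ d, f.onDart ((e.trans (σ.rot.trans e.symm)) d) = σ.rot (f.onDart d) :=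
    fun d => e.apply_symm_apply _
  refine ⟨⟨e.trans (σ.rot.trans e.symm), fun d => ?_, fun d d' h => ?_⟩, he⟩
  · exact f.onV_inj (Dart.inc _).vertex_mem d.inc.vertex_mem
      ((congrArg Dart.vertex (he d)).trans (σ.vertex_rot _))
  · exact (sameCycle_iff_of_semiconj f.onDart_injective he d d').1
      (σ.sameCycle _ _ (congrArg f.onV h))

theorem Mono.IsIso.exists_push {f : Mono H G} (hf : f.IsIso) (τ : RotationSystem H) :
    ∃ σ : RotationSystem G, f.Intertwines σ τ := by
  let e := Equiv.ofBijective f.onDart hf.bijective_onDart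
  have he : ∀ d, f.onDart (τ.rot d) = (e.symm.trans (τ.rot.trans e)) (f.onDart d) := by
    intro d
    change _ = e (τ.rot (e.symm (e d)))
    rw [Equiv.symm_apply_apply]
    rfl
  refine ⟨⟨e.symm.trans (τ.rot.trans e), fun d => ?_, fun d d' h => ?_⟩, he⟩
  · obtain ⟨d, rfl⟩ := hf.bijective_onDart.2 d
    rw [← he]
    exact congrArg f.onV (τ.vertex_rot d)
  · obtain ⟨d, rfl⟩ := hf.bijective_onDart.2 d
    obtain ⟨d', rfl⟩ := hf.bijective_onDart.2 d'
    exact (sameCycle_iff_of_semiconj f.onDart_injective he d d').2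
      (τ.sameCycle _ _ (f.onV_inj d.inc.vertex_mem d'.inc.vertex_mem h))

namespace Mono.Intertwines

variable {f : Mono H G} {σ : RotationSystem G} {τ : RotationSystem H}

theorem pow (h : f.Intertwines σ τ) (n : ℕ) (d : Dart H) :
    f.onDart ((τ.rot ^ n) d) = (σ.rot ^ n) (f.onDart d) := by
  induction n with
  | zero => rfl
  | succ n ih => rw [pow_succ', Equiv.Perm.mul_apply, h, ih, pow_succ', Equiv.Perm.mul_apply]

theorem face (h : f.Intertwines σ τ) (d : Dart H) :
    f.onDart (τ.face d) = σ.face (f.onDart d) := by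
  rw [RotationSystem.face_apply, RotationSystem.face_apply, h, f.onDart_rev]

theorem numFaces (h : f.Intertwines σ τ) (hf : f.IsIso) : τ.numFaces = σ.numFaces :=
  Nat.card_congr (Quotient.congr (Equiv.ofBijective f.onDart hf.bijective_onDart)
    fun a b => (sameCycle_iff_of_semiconj f.onDart_injective h.face a b).symm)

theorem euler_iff (h : f.Intertwines σ τ) (hf : f.IsIso) :
    (V(H).ncard : ℤ) - (E(H).ncard : ℤ) + (τ.numFaces : ℤ) = 2 ↔
      (V(G).ncard : ℤ) - (E(G).ncard : ℤ) + (σ.numFaces : ℤ) = 2 := by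
  rw [h.numFaces hf, ← hf.1, ← hf.2, f.onV_inj.ncard_image, f.onE_inj.ncard_image]

theorem cyclicOrd_iff [Finite (Dart G)] (h : f.Intertwines σ τ) {a b c : Dart H}
    (hb : b.vertex = a.vertex) (hc : c.vertex = a.vertex) :
    CyclicOrd σ.rot (f.onDart a) (f.onDart b) (f.onDart c) ↔ CyclicOrd τ.rot a b c := by
  have := Finite.of_injective _ f.onDart_injective
  exact cyclicOrd_iff_of_firstReturn f.onDart_injective (fun d => ⟨0, by simpa using h d, by simp⟩)
    _ _ _ (τ.sameCycle _ _ hb.symm) (τ.sameCycle _ _ hc.symm)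

theorem cycAt_iff [Finite (Dart G)] (h : f.Intertwines σ τ) {v : α} {e₁ e₂ e₃ : β}
    (h₁ : H.Inc e₁ v) (h₂ : H.Inc e₂ v) (h₃ : H.Inc e₃ v) :
    σ.CycAt (f.onV v) (f.onE e₁) (f.onE e₂) (f.onE e₃) ↔ τ.CycAt v e₁ e₂ e₃ := by
  let a : Dart H := ⟨v, e₁, h₁⟩
  let b : Dart H := ⟨v, e₂, h₂⟩
  let c : Dart H := ⟨v, e₃, h₃⟩
  have h4 : CyclicOrd σ.rot (f.onDart a) (f.onDart b) (f.onDart c) ↔ CyclicOrd τ.rot a b c :=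
    h.cyclicOrd_iff rfl rfl
  exact (RotationSystem.cycAt_iff (σ := σ) (a := f.onDart a) (b := f.onDart b) (c := f.onDart c)
    rfl rfl).trans (h4.trans
      (RotationSystem.cycAt_iff (σ := τ) (a := a) (b := b) (c := c) rfl rfl).symm)

theorem sameSide_iff {σ : PlanarEmbedding G} {τ : PlanarEmbedding H}
    (h : f.Intertwines σ.toRotationSystem τ.toRotationSystem) (hf : f.IsIso) {C : Set β}
    (hC : C ⊆ E(H)) {x y : α} (hx : x ∈ V(H)) (hy : y ∈ V(H)) :
    σ.SameSide (f.onE '' C) (f.onV x) (f.onV y) ↔ τ.SameSide C x y := by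
  have key : ∀ a b : Dart H,
      (f.onDart b = σ.face (f.onDart a) ∨
        ((f.onDart a).edge ∉ f.onE '' C ∧ f.onDart b = (f.onDart a).rev)) ↔
      (b = τ.face a ∨ (a.edge ∉ C ∧ b = a.rev)) := by
    intro a b
    rw [← h.face, ← f.onDart_rev, f.onDart_injective.eq_iff, f.onDart_injective.eq_iff,
      show (f.onDart a).edge = f.onE a.edge from rfl,
      f.onE_inj.mem_image_iff hC a.inc.edge_mem]
  constructor
  · rintro ⟨d, d', h1, h2, h3⟩
    have h4 : ∀ a b : Dart H, Relation.EqvGen (fun a b => b = σ.face a ∨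
        (a.edge ∉ f.onE '' C ∧ b = a.rev)) (f.onDart a) (f.onDart b) →
        Relation.EqvGen (fun a b => b = τ.face a ∨ (a.edge ∉ C ∧ b = a.rev)) a b := by
      intro a b hab
      generalize ha : f.onDart a = a' at hab
      generalize hb : f.onDart b = b' at hab
      induction hab generalizing a b with
      | rel _ _ hr =>
        subst ha hb
        exact .rel _ _ ((key a b).1 hr)
      | refl _ =>
        obtain rfl := f.onDart_injective (ha.trans hb.symm)
        exact .refl _
      | symm _ _ _ ih => exact .symm _ _ (ih b a hb ha)
      | trans _ c' _ _ _ ih1 ih2 =>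
        obtain ⟨c, rfl⟩ := hf.bijective_onDart.2 c'
        exact .trans _ c _ (ih1 a c ha rfl) (ih2 c b rfl hb)
    obtain ⟨d, rfl⟩ := hf.bijective_onDart.2 d
    obtain ⟨d', rfl⟩ := hf.bijective_onDart.2 d'
    exact ⟨d, d', f.onV_inj d.inc.vertex_mem hx h1, f.onV_inj d'.inc.vertex_mem hy h2, h4 _ _ h3⟩
  · rintro ⟨d, d', rfl, rfl, h3⟩
    refine ⟨f.onDart d, f.onDart d', rfl, rfl, ?_⟩
    clear hx hy
    induction h3 with
    | rel a b hr => exact .rel _ _ ((key a b).2 hr)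
    | refl _ => exact .refl _
    | symm _ _ _ ih => exact .symm _ _ ih
    | trans _ _ _ _ _ ih1 ih2 => exact .trans _ _ _ ih1 ih2

end Mono.Intertwines

/-! ### Relabelling -/

theorem relabel_mono {H G : Graph α β} (h : H ≤ G) (a : α ≃ α') (b : β ≃ β') :
    relabel a b H ≤ relabel a b G :=
  ⟨fun _ hx => h.1 hx, fun e _ _ hl => Graph.IsLink.mono h (e := b.symm e) hl⟩

/-- The isomorphism that changes the names. -/
def relabelMono (a : α ≃ α') (b : β ≃ β') (G : Graph α β) : Mono G (relabel a b G) where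
  onV := a
  onE := b
  onV_mem x hx := by simpa [relabel] using hx
  onV_inj := a.injective.injOn
  onE_inj := b.injective.injOn
  isLink e x y h := by simpa [relabel] using h

theorem vertexSet_relabel (a : α ≃ α') (b : β ≃ β') (G : Graph α β) :
    V(relabel a b G) = a '' V(G) := (a.image_eq_preimage_symm _).symm

theorem edgeSet_relabel (a : α ≃ α') (b : β ≃ β') (G : Graph α β) :
    E(relabel a b G) = b '' E(G) := (b.image_eq_preimage_symm _).symm

theorem relabelMono_isIso (a : α ≃ α') (b : β ≃ β') (G : Graph α β) : (relabelMono a b G).IsIso :=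
  ⟨(vertexSet_relabel a b G).symm, (edgeSet_relabel a b G).symm⟩

theorem incidenceSet_relabel (a : α ≃ α') (b : β ≃ β') (G : Graph α β) (v : α) :
    (relabel a b G).incidenceSet (a v) = b '' G.incidenceSet v := by
  rw [b.image_eq_preimage_symm]
  ext e
  change (∃ y, G.IsLink (b.symm e) (a.symm (a v)) (a.symm y)) ↔ ∃ y, G.IsLink (b.symm e) v y
  rw [a.symm_apply_apply, a.symm.surjective.exists]

theorem simple_relabel (a : α ≃ α') (b : β ≃ β') (G : Graph α β) [G.Simple] :
    (relabel a b G).Simple where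
  not_isLoopAt e x h := by
    have h1 : G.IsLink (b.symm e) (a.symm x) (a.symm x) := h
    exact h1.ne rfl
  eq_of_isLink e f x y h h' := by
    have h1 : G.IsLink (b.symm e) (a.symm x) (a.symm y) := h
    have h2 : G.IsLink (b.symm f) (a.symm x) (a.symm y) := h'
    exact b.symm.injective (Graph.Simple.eq_of_isLink h1 h2)

theorem inducesRot_relabel {H G : Graph α β} (h : H ≤ G) (a : α ≃ α') (b : β ≃ β')
    {σ : RotationSystem G} {τ : RotationSystem H} (hind : (Mono.ofLE h).InducesRot σ τ)
    {σ' : RotationSystem (relabel a b G)} {τ' : RotationSystem (relabel a b H)}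
    (hσ : (relabelMono a b G).Intertwines σ' σ) (hτ : (relabelMono a b H).Intertwines τ' τ) :
    (Mono.ofLE (relabel_mono h a b)).InducesRot σ' τ' := by
  intro d
  obtain ⟨d, rfl⟩ := (relabelMono_isIso a b H).bijective_onDart.2 d
  have hcomm : ∀ d : Dart H, (Mono.ofLE (relabel_mono h a b)).onDart
      ((relabelMono a b H).onDart d) = (relabelMono a b G).onDart ((Mono.ofLE h).onDart d) :=
    fun d => rfl
  obtain ⟨k, h1, h2⟩ := hind d
  refine ⟨k, ?_, fun j hj => ?_⟩
  · rw [← hτ, hcomm, h1, hσ.pow, hcomm]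
  · rintro ⟨d', hd'⟩
    obtain ⟨d', rfl⟩ := (relabelMono_isIso a b H).bijective_onDart.2 d'
    rw [hcomm, hcomm, ← hσ.pow] at hd'
    exact h2 j hj ⟨d', (relabelMono a b G).onDart_injective hd'⟩

end

section

/-! ### Sequences in which all edges are strict -/

variable {α β : Type*}

/-- If all edges are strict, then the cyclic orders in the induced embedding are those of the
larger graph. -/
theorem InducesUpTo.cycAt_iff {H G : Graph α β} [G.Simple] [Finite (Dart G)]
    (hle : ∀ e x y, H.IsLink e x y → G.IsLink e x y) {σ : PlanarEmbedding G}
    {τ : PlanarEmbedding H} (h : InducesUpTo E(H) σ τ) {v : α} {e₁ e₂ e₃ : β}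
    (h₁ : H.Inc e₁ v) (h₂ : H.Inc e₂ v) (h₃ : H.Inc e₃ v) :
    σ.CycAt v e₁ e₂ e₃ ↔ τ.CycAt v e₁ e₂ e₃ := by
  by_cases hne : e₁ = e₂
  · exact ⟨fun h => absurd hne h.ne.1, fun h => absurd hne h.ne.1⟩
  obtain ⟨f, hfix, hind⟩ := h
  have hfin := Finite.of_injective _ f.onDart_injective
  have hE : ∀ e v, H.Inc e v → f.onE e = e := fun e v h => hfix e h.edge_mem
  -- In a simple graph, two distinct edges have at most one common end. So a map that fixes the
  -- edges also fixes the vertices of degree at least two.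
  have hv : f.onV v = v := by
    have hend : ∀ e x, H.IsLink e v x → f.onV v = v ∨ f.onV v = x := by
      intro e x hx
      have h1 := f.isLink _ _ _ hx
      rw [hE _ _ hx.inc_left] at h1
      exact h1.left_eq_or_eq (hle _ _ _ hx)
    obtain ⟨x, hx⟩ := h₁
    obtain ⟨y, hy⟩ := h₂
    rcases hend _ _ hx with h | h
    · exact h
    rcases hend _ _ hy with h' | h'
    · exact h'
    · obtain rfl : x = y := h.symm.trans h'
      exact absurd ((hle _ _ _ hx).eq (hle _ _ _ hy)) hne
  let a : Dart H := ⟨v, e₁, h₁⟩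
  let b : Dart H := ⟨v, e₂, h₂⟩
  let c : Dart H := ⟨v, e₃, h₃⟩
  have h4 : CyclicOrd σ.rot (f.onDart a) (f.onDart b) (f.onDart c) ↔ CyclicOrd τ.rot a b c :=
    cyclicOrd_iff_of_firstReturn f.onDart_injective hind _ _ _ (τ.sameCycle _ _ rfl)
      (τ.sameCycle _ _ rfl)
  have h5 := (RotationSystem.cycAt_iff (σ := σ.toRotationSystem) (a := f.onDart a)
    (b := f.onDart b) (c := f.onDart c) rfl rfl).trans
      (h4.trans (RotationSystem.cycAt_iff (a := a) (b := b) (c := c) rfl rfl).symm)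
  have h6 : f.onE e₁ = e₁ := hE _ _ h₁
  have h7 : f.onE e₂ = e₂ := hE _ _ h₂
  have h8 : f.onE e₃ = e₃ := hE _ _ h₃
  change σ.CycAt (f.onV v) (f.onE e₁) (f.onE e₂) (f.onE e₃) ↔ _ at h5
  rwa [hv, h6, h7, h8] at h5

theorem isHybridSubgraph_of_le {H G : Graph α β} (h : H ≤ G) : IsHybridSubgraph E(H) H G :=
  ⟨subset_rfl, Mono.ofLE h, fun _ _ => rfl⟩

theorem inducesUpTo_of_le {H G : Graph α β} (h : H ≤ G) {σ : PlanarEmbedding G}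
    {τ : PlanarEmbedding H} (hind : (Mono.ofLE h).InducesRot σ.toRotationSystem τ.toRotationSystem) :
    InducesUpTo E(H) σ τ :=
  ⟨Mono.ofLE h, fun _ _ => rfl, hind⟩

theorem IsHybridSubgraph.edgeSet_subset {H G : Graph α β} (h : IsHybridSubgraph E(H) H G) :
    E(H) ⊆ E(G) := by
  obtain ⟨-, f, hf⟩ := h
  intro e he
  obtain ⟨x, y, hxy⟩ := Graph.exists_isLink_of_mem_edgeSet he
  have := (f.isLink _ _ _ hxy).edge_mem
  rwa [hf e he] at this

/-- A simultaneous embedding uses the first direction of a step whenever it is available, even if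
the second graph is given as the subgraph. In that case the two graphs have the same edges, hence
are equal in the absence of isolated vertices, and the embeddings coincide. -/
theorem inducesUpTo_swap {H G : Graph α β} (h : H ≤ G) (hG : ∀ v ∈ V(G), ∃ e, G.Inc e v)
    (hE : E(G) ⊆ E(H)) {σ : PlanarEmbedding G}
    {τ : PlanarEmbedding H} (hind : (Mono.ofLE h).InducesRot σ.toRotationSystem τ.toRotationSystem) :
    InducesUpTo E(G) τ σ := by
  have hlink : ∀ e x y, G.IsLink e x y → H.IsLink e x y :=
    fun e x y he => (h.isLink_iff (hE he.edge_mem)).2 he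
  obtain rfl : H = G := by
    refine le_antisymm h ⟨fun v hv => ?_, hlink⟩
    obtain ⟨e, y, he⟩ := hG v hv
    exact (hlink _ _ _ he).left_mem
  refine ⟨Mono.ofLE le_rfl, fun _ _ => rfl, fun d => ⟨0, ?_, by simp⟩⟩
  obtain ⟨k, h1, h2⟩ := hind d
  cases k with
  | zero => exact h1.symm
  | succ k => exact absurd ⟨_, rfl⟩ (h2 0 (by omega))

namespace HybridDeletionSequence

variable {𝒢 : HybridDeletionSequence}

theorem IsSimultaneousEmbedding.cycAt_iff (hS : 𝒢.strict = Set.univ)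
    {φ : ∀ i, PlanarEmbedding (𝒢.graph i)} (hφ : 𝒢.IsSimultaneousEmbedding φ) (i : Fin 𝒢.n)
    (hle : 𝒢.graph i.castSucc ≤ 𝒢.graph i.succ ∨ 𝒢.graph i.succ ≤ 𝒢.graph i.castSucc)
    {v e₁ e₂ e₃ : ℕ}
    (h₁ : (𝒢.graph i.castSucc).Inc e₁ v) (h₂ : (𝒢.graph i.castSucc).Inc e₂ v)
    (h₃ : (𝒢.graph i.castSucc).Inc e₃ v) (h₁' : (𝒢.graph i.succ).Inc e₁ v)
    (h₂' : (𝒢.graph i.succ).Inc e₂ v) (h₃' : (𝒢.graph i.succ).Inc e₃ v) :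
    (φ i.castSucc).CycAt v e₁ e₂ e₃ ↔ (φ i.succ).CycAt v e₁ e₂ e₃ := by
  have hsimple := 𝒢.simple
  have hfin := fun i => Dart.finite (𝒢.finite_vertexSet i) (𝒢.finite_edgeSet i)
  obtain ⟨hφ1, hφ2⟩ := hφ i
  rw [hS, Set.univ_inter] at hφ1 hφ2
  rw [Set.univ_inter] at hφ2
  by_cases h : IsHybridSubgraph E(𝒢.graph i.castSucc) (𝒢.graph i.castSucc) (𝒢.graph i.succ)
  · refine ((hφ1 h).cycAt_iff (fun e x y he => ?_) h₁ h₂ h₃).symm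
    rcases hle with hle | hle
    · exact he.mono hle
    · exact (hle.isLink_iff (h.edgeSet_subset he.edge_mem)).2 he
  · refine (hφ2 h).cycAt_iff (fun e x y he => ?_) h₁' h₂' h₃'
    rcases hle with hle | hle
    · exact absurd (isHybridSubgraph_of_le hle) h
    · exact he.mono hle

theorem isSimultaneousEmbedding_of_inducesRot (hS : 𝒢.strict = Set.univ)
    (hinc : ∀ i, ∀ v ∈ V(𝒢.graph i), ∃ e, (𝒢.graph i).Inc e v)
    {φ : ∀ i, PlanarEmbedding (𝒢.graph i)}
    (h : ∀ i : Fin 𝒢.n, (∃ hle : 𝒢.graph i.castSucc ≤ 𝒢.graph i.succ,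
        (Mono.ofLE hle).InducesRot (φ i.succ).toRotationSystem (φ i.castSucc).toRotationSystem) ∨
      ∃ hle : 𝒢.graph i.succ ≤ 𝒢.graph i.castSucc,
        (Mono.ofLE hle).InducesRot (φ i.castSucc).toRotationSystem (φ i.succ).toRotationSystem) :
    𝒢.IsSimultaneousEmbedding φ := by
  intro i
  rw [hS, Set.univ_inter, Set.univ_inter]
  rcases h i with ⟨hle, hind⟩ | ⟨hle, hind⟩
  · exact ⟨fun _ => inducesUpTo_of_le hle hind, fun h' => absurd (isHybridSubgraph_of_le hle) h'⟩
  · exact ⟨fun h' => inducesUpTo_swap hle (hinc _) h'.edgeSet_subset hind,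
      fun _ => inducesUpTo_of_le hle hind⟩

end HybridDeletionSequence

end

section

/-! ### The stages of the construction -/

theorem IsListing.cycAt {α β : Type*} {G : Graph α β} [Finite (Dart G)] {L : α → List β}
    (hL : IsListing L G) {v : α} (hv : v ∈ V(G)) {e₁ e₂ e₃ : β} {l : List β}
    (h : L v = e₁ :: e₂ :: l) (h₃ : e₃ ∈ l) : hL.rotationSystem.CycAt v e₁ e₂ e₃ := by
  classical
  have hn := hL.nodup v hv
  have hinc : ∀ e ∈ L v, G.Inc e v := fun e he => (hL.mem_iff v hv e).1 he
  rw [h] at hn hinc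
  have hne : e₁ ≠ e₂ ∧ e₁ ≠ e₃ ∧ e₂ ≠ e₃ := by
    simp only [List.nodup_cons, List.mem_cons, not_or] at hn
    exact ⟨hn.1.1, fun h => hn.1.2 (h ▸ h₃), fun h => hn.2.1 (h ▸ h₃)⟩
  let a : Dart G := ⟨v, e₁, hinc _ (by simp)⟩
  let c : Dart G := ⟨v, e₃, hinc _ (by simp [h₃])⟩
  have hb : (hL.rotationSystem.rot a).edge = e₂ := by
    rw [hL.rot_edge]
    change (L v).formPerm e₁ = e₂
    rw [h, List.formPerm_apply_head _ _ _ hn]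
  refine ⟨a, _, c, rfl, rfl, hb, rfl, CyclicOrd.apply (hL.rotationSystem.sameCycle _ _ rfl) ?_ ?_ ?_⟩
  · intro h
    exact hne.1 ((congrArg Dart.edge h).trans hb)
  · intro h
    exact hne.2.1 (congrArg Dart.edge h)
  · intro h
    exact hne.2.2 (hb.symm.trans (congrArg Dart.edge h))

section Rings

variable {s K M : ℕ} {μ μ' : ℕ → ℕ} {F F' : Set XEdge} {g : ℕ → Bool}

/-- The lists for different matchings differ only in links and coupling edges. Hence the matching
can be changed while only the edges of the village are present. -/
theorem exists_le_inducesRot (hμ : ∀ i, μ (μ i) = i) (hμ' : ∀ i, μ' (μ' i) = i) (h : M ≤ K)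
    (hF : F ⊆ F') (heq : μ = μ' ∨ F = baseEdges) :
    ∃ hle : coupledVillage s M μ F ≤ coupledVillage s K μ' F',
      (Mono.ofLE hle).InducesRot (ringSystem s K hμ' F' g) (ringSystem s M hμ F g) := by
  classical
  rcases heq with rfl | rfl
  · exact ⟨_, ringSystem_inducesRot hμ h hF⟩
  have hle : coupledVillage s M μ baseEdges ≤ coupledVillage s K μ' F' := by
    refine ⟨(coupledVillage_mono h hF (μ := μ)).1, ?_⟩
    rintro e x y ⟨⟨⟨e, rfl⟩, he⟩, hxy⟩
    exact ⟨⟨hF ⟨e, rfl⟩, xEdges_mono h he⟩, hxy⟩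
  refine ⟨hle, IsListing.inducesRot _ _ hle
    (fun e => decide (e ∈ E(coupledVillage s M μ baseEdges))) (by simp) fun v _ => ?_⟩
  have hlink : ∀ i, XEdge.link i ∉ baseEdges := by simp [baseEdges]
  have hcouple : ∀ i, XEdge.couple i ∉ baseEdges := by simp [baseEdges]
  have hring : (ring s μ g v).filter (· ∈ E(coupledVillage s M μ baseEdges)) =
      (ring s μ' g v).filter (· ∈ E(coupledVillage s M μ baseEdges)) := by
    cases v with
    | centre => rfl
    | surface k => rfl
    | wall i k =>
      simp only [ring]
      split_ifs <;> simp [List.filter_cons, hlink, hcouple]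
    | inhabitant i =>
      simp only [ring]
      split_ifs <;> simp [List.filter_cons, hcouple]
  rw [hring, List.filter_filter]
  refine List.filter_congr fun e _ => ?_
  have := hle.edgeSet_mono
  by_cases he : e ∈ E(coupledVillage s M μ baseEdges)
  · rw [decide_eq_true he, decide_eq_true (this he), Bool.and_true]
  · rw [decide_eq_false he, Bool.false_and]

theorem cycAt_ringSystem_inhabitant (hμ : ∀ i, μ (μ i) = i) {i : ℕ} (h1 : 1 ≤ i) (h2 : i ≤ M)
    (h3 : i ≤ s) :
    (ringSystem s M hμ baseEdges g).CycAt (.inhabitant i) (.base (.claw i 2)) (.base (.claw i 4))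
      (.base (.claw i 6)) ↔ g i = true := by
  classical
  have hv : VillageVertex.inhabitant i ∈ V(coupledVillage s M μ baseEdges) := by
    simp [h1, h2, h3]
  have hc : ∀ e, XEdge.base e ∈ baseEdges := fun e => ⟨e, rfl⟩
  have hcouple : ∀ i, XEdge.couple i ∉ baseEdges := by simp [baseEdges]
  have key := fun e₁ e₂ e₃ l h h₃ => IsListing.cycAt (e₁ := e₁) (e₂ := e₂) (e₃ := e₃) (l := l)
    (isListing_ring (F := baseEdges) (g := g) hμ) hv h h₃
  cases hg : g i
  · have h4 := key (.base (.claw i 6)) (.base (.claw i 4)) (.base (.claw i 2))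
      [.base (.claw i 2)] (by simp [ring, hg, hc, hcouple, h1, h2, h3]) (by simp)
    have h5 : (ringSystem s M hμ baseEdges g).CycAt _ _ _ _ := h4
    simp only [Bool.false_eq_true, iff_false]
    exact fun h => h.asymm h5.rotate.rotate
  · have h4 := key (.base (.claw i 2)) (.base (.claw i 4)) (.base (.claw i 6))
      [.base (.claw i 6)] (by simp [ring, hg, hc, hcouple, h1, h2, h3]) (by simp)
    exact iff_of_true h4 rfl

theorem cycAt_ringSystem_surface (hμ : ∀ i, μ (μ i) = i) (hs : 0 < s) :
    (ringSystem s M hμ baseEdges g).CycAt (.surface 2) (.base (.spoke 2)) (.base (.rim 1))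
      (.base (.rim 2)) := by
  classical
  have hc : ∀ e, XEdge.base e ∈ baseEdges := fun e => ⟨e, rfl⟩
  refine IsListing.cycAt (isListing_ring (F := baseEdges) (g := g) hμ) (l := [.base (.rim 2)])
    (by simp; omega) ?_ (by simp)
  have h1 : 1 ≤ 4 * s := by omega
  have h2 : 2 ≤ 4 * s := by omega
  simp [ring, surfaceWalls, predSurface, hc, h1, h2]

end Rings

/-- In one round the links are added, the houses are opened, the inhabitants are coupled, and then
all this is undone. -/
def stageEdges (μ : ℕ → ℕ) (r : ℕ) : Set XEdge :=
  if r = 0 then baseEdges else if r = 1 ∨ r = 5 then linkedEdges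
  else if r = 3 then coupledEdges μ else detachedEdges μ

/-- The number of houses. -/
def stageCount (m K i : ℕ) : ℕ := if i = 0 ∨ i = 18 then m else K

/-- The graphs of three rounds, one for each of the matchings `μ 0`, `μ 1`, `μ 2`. -/
def stage (s m K : ℕ) (μ : ℕ → ℕ → ℕ) (i : ℕ) : Graph VillageVertex XEdge :=
  coupledVillage s (stageCount m K i) (μ (i / 6)) (stageEdges (μ (i / 6)) (i % 6))

section Stages

variable {s m K : ℕ} {μ : ℕ → ℕ → ℕ} {i : ℕ} {g : ℕ → Bool}

/-- The embeddings of the stages with inhabitants inside according to `g`. -/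
noncomputable def stageSystem (s m K : ℕ) {μ : ℕ → ℕ → ℕ} (hμ : ∀ t, IsNoncrossing K (μ t))
    (g : ℕ → Bool) (i : ℕ) : RotationSystem (stage s m K μ i) :=
  ringSystem s (stageCount m K i) (hμ (i / 6)).invol (stageEdges (μ (i / 6)) (i % 6)) g

theorem baseEdges_subset_linkedEdges : baseEdges ⊆ linkedEdges := by
  rintro _ ⟨e, rfl⟩ i
  simp

/-- Adding the links, deleting walls and adding the coupling edges are separate steps, so
consecutive graphs are nested. The drawings for a fixed `g` restrict to each other, since they come
from the same lists. -/
theorem stage_step (hm : m ≤ K) (hμ : ∀ t, IsNoncrossing K (μ t)) (g : ℕ → Bool) (hi : i < 18) :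
    (∃ hle : stage s m K μ i ≤ stage s m K μ (i + 1), (Mono.ofLE hle).InducesRot
        (stageSystem s m K hμ g (i + 1)) (stageSystem s m K hμ g i)) ∨
      ∃ hle : stage s m K μ (i + 1) ≤ stage s m K μ i, (Mono.ofLE hle).InducesRot
        (stageSystem s m K hμ g i) (stageSystem s m K hμ g (i + 1)) := by
  have h1 := baseEdges_subset_linkedEdges
  have h2 : ∀ t, detachedEdges (μ t) ⊆ linkedEdges := fun t => Set.inter_subset_right
  have h3 : ∀ t, detachedEdges (μ t) ⊆ coupledEdges (μ t) := fun t => Set.inter_subset_left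
  interval_cases i
  all_goals first
    | refine .inl (exists_le_inducesRot _ _ ?_ ?_ ?_) <;>
        (simp [stageCount, stageEdges, hm, h1, h2, h3]; done)
    | refine .inr (exists_le_inducesRot _ _ ?_ ?_ ?_) <;> simp [stageCount, stageEdges, hm, h1, h2, h3]

theorem coreEdges_subset_stageEdges {μ : ℕ → ℕ} (r : ℕ) : coreEdges ⊆ stageEdges μ r := by
  have h1 : coreEdges ⊆ detachedEdges μ := coreEdges_subset_detachedEdges
  have h2 : coreEdges ⊆ baseEdges := fun e he => he.1
  unfold stageEdges
  split_ifs
  · exact h2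
  · exact h2.trans baseEdges_subset_linkedEdges
  · exact h1.trans Set.inter_subset_left
  · exact h1

theorem stageCount_le (hm : m ≤ K) : stageCount m K i ≤ K := by
  unfold stageCount
  split_ifs <;> omega

theorem le_stageCount (hm : m ≤ K) : m ≤ stageCount m K i := by
  unfold stageCount
  split_ifs <;> omega

theorem stageCount_eq (h : i % 6 ≠ 0) : stageCount m K i = K := by
  unfold stageCount
  rw [if_neg]
  omega

theorem hasNoCutVertex_stage (hm : m ≤ K) (hK : K ≤ s) (hμ : ∀ t, IsNoncrossing K (μ t)) :
    HasNoCutVertex (stage s m K μ i) := by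
  refine hasNoCutVertex_coupledVillage (hμ _) hK (stageCount_le hm) ?_
  unfold stageEdges
  split_ifs with h1
  · exact .inr subset_rfl
  · exact .inr baseEdges_subset_linkedEdges
  · exact .inl ⟨Set.inter_subset_left, stageCount_eq h1⟩
  · exact .inl ⟨subset_rfl, stageCount_eq h1⟩

theorem isFiniteConnected_stage (hs : 0 < s) (hm : m ≤ K) (hK : K ≤ s)
    (hμ : ∀ t, IsNoncrossing K (μ t)) : IsFiniteConnected (stage s m K μ i) :=
  isFiniteConnected_coupledVillage hs (coreEdges_subset_stageEdges _) (hasNoCutVertex_stage hm hK hμ)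

theorem hasPotentialsOn_stageSystem (hs : 0 < s) (hm : m ≤ K) (hK : K ≤ s)
    (hμ : ∀ t, IsNoncrossing K (μ t)) (hg : ∀ t < 3, ∀ i, i < μ t i → g (μ t i) = !g i)
    (hi : i ≤ 18) : (stageSystem s m K hμ g i).HasPotentialsOn Set.univ := by
  by_cases h3 : i % 6 = 3
  · have h := hasPotentialsOn_coupled (hμ (i / 6)) hK hs (hg (i / 6) (by omega))
    have h4 : stageCount m K i = K := stageCount_eq (by omega)
    have h5 : stageEdges (μ (i / 6)) (i % 6) = coupledEdges (μ (i / 6)) := by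
      rw [h3]
      simp [stageEdges]
    unfold stageSystem stage
    rw [h4, h5]
    exact h
  · refine hasPotentialsOn_of_subset_linked (hμ _) hK (stageCount_le hm) ?_
    unfold stageEdges
    split_ifs
    · exact baseEdges_subset_linkedEdges
    · exact subset_rfl
    · exact Set.inter_subset_right

theorem cycAt_stage (hK : K ≤ s) (hμ : ∀ t, IsNoncrossing K (μ t)) {t : ℕ}
    {σ : RotationSystem (stage s m K μ (6 * t + 3))} (hσ : σ.HasPotentialsOn Set.univ) {x : ℕ}
    (hx : x < μ t x) :
    σ.CycAt (.inhabitant x) (.base (.claw x 2)) (.base (.claw x 4)) (.base (.claw x 6)) ↔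
      ¬ σ.CycAt (.inhabitant (μ t x)) (.base (.claw (μ t x) 2)) (.base (.claw (μ t x) 4))
        (.base (.claw (μ t x) 6)) := by
  have h : stage s m K μ (6 * t + 3) = coupledVillage s K (μ t) (coupledEdges (μ t)) := by
    have h1 : (6 * t + 3) / 6 = t := by omega
    have h2 : (6 * t + 3) % 6 = 3 := by omega
    rw [stage, stageCount_eq (by omega), h1, h2]
    simp [stageEdges]
  revert σ
  rw [h]
  intro σ hσ
  exact cycAt_coupled (hμ t) hK hσ hx

instance : (stage s m K μ i).Simple := inferInstanceAs (coupledVillage _ _ _ _).Simple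

instance : Finite (Dart (stage s m K μ i)) := inferInstanceAs (Finite (Dart (coupledVillage _ _ _ _)))

theorem stage_inc_of_core {e : VillageEdge} (he : XEdge.base e ∈ coreEdges)
    (he' : e ∈ villageEdges s (Finset.Icc 1 (stageCount m K i))) {v : VillageVertex}
    (hv : v = (villageEnds s e).1 ∨ v = (villageEnds s e).2) :
    (stage s m K μ i).Inc (.base e) v :=
  coupledVillage_inc.2 ⟨⟨coreEdges_subset_stageEdges _ he, he'⟩, hv⟩

end Stages

end

section

/-! ### The housing sequence -/

variable {s m K M : ℕ} {μ : ℕ → ℕ → ℕ} {F : Set XEdge}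

theorem coupledVillage_isLink_of_village {ν : ℕ → ℕ} (hM : m ≤ M) {e : VillageEdge}
    {x y : VillageVertex} (he : XEdge.base e ∈ F)
    (h : (village s (Finset.Icc 1 m)).IsLink e x y) :
    (coupledVillage s M ν F).IsLink (.base e) x y := by
  refine ⟨⟨he, ?_⟩, h.2⟩
  exact xEdges_mono (μ := ν) hM (show XEdge.base e ∈ xEdges s m ν from h.1)

/-- The map from the village to a stage with all the edges of the village. -/
def villageMono (a : VillageVertex ≃ ℕ) (b : XEdge ≃ ℕ) {ν : ℕ → ℕ} (hM : m ≤ M)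
    (hF : baseEdges ⊆ F) :
    Mono (village s (Finset.Icc 1 m)) (relabel a b (coupledVillage s M ν F)) where
  onV := a
  onE e := b (.base e)
  onV_mem x hx := by
    refine (relabelMono a b _).onV_mem x ?_
    exact (coupledVillage_mono hM subset_rfl (μ := ν) (F := F)).1 hx
  onV_inj := a.injective.injOn
  onE_inj := Function.Injective.injOn fun e f h => by simpa using h
  isLink e x y h := (relabelMono a b _).isLink _ _ _
    (coupledVillage_isLink_of_village hM (hF ⟨e, rfl⟩) h)

theorem villageMono_isIso (a : VillageVertex ≃ ℕ) (b : XEdge ≃ ℕ) {ν : ℕ → ℕ}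
    (hM : m = M) (hF : baseEdges = F) :
    (villageMono (s := s) (ν := ν) a b hM.le hF.le).IsIso := by
  subst hM hF
  refine ⟨(vertexSet_relabel a b (coupledVillage s m ν baseEdges)).symm, ?_⟩
  rw [edgeSet_relabel]
  change (fun e => b (.base e)) '' villageEdges s (Finset.Icc 1 m) = b '' (baseEdges ∩ xEdges s m ν)
  rw [← Set.image_image b XEdge.base]
  congr 1
  ext e
  constructor
  · rintro ⟨e, he, rfl⟩
    exact ⟨⟨e, rfl⟩, he⟩
  · rintro ⟨⟨e, rfl⟩, he⟩
    exact ⟨e, he, rfl⟩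

theorem isFiniteConnected_village (hs : 0 < s) (hm : m ≤ s) :
    IsFiniteConnected (village s (Finset.Icc 1 m)) where
  finite_vertexSet := (villageVertices_bound s m).1
  finite_edgeSet := by
    refine Set.Finite.of_finite_image (f := XEdge.base) ((xEdges_bound s m id).1.subset ?_)
      (fun e _ f _ h => by simpa using h)
    rintro _ ⟨e, he, rfl⟩
    exact he
  loopless := ⟨fun e x h => by
    have h1 := coupledVillage_isLink_of_village (F := Set.univ) (ν := id) le_rfl trivial h
    exact h1.ne rfl⟩
  connected := by
    have h1 : HasNoCutVertex (coupledVillage s m id baseEdges) :=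
      hasNoCutVertex_coupledVillage isNoncrossing_id hm le_rfl (.inr subset_rfl)
    have h2 : HasNoCutVertex (village s (Finset.Icc 1 m)) := by
      intro v P hP x hx hxv y hy hyv
      refine h1 v P (fun e x y hl hx hy => ?_) x hx hxv y hy hyv
      obtain ⟨⟨⟨e, rfl⟩, he⟩, hl⟩ := hl
      exact hP e x y ⟨he, hl⟩ hx hy
    exact h2.connected ⟨.centre, trivial⟩ ⟨.surface 0, fun h => absurd h.1 (by omega)⟩
  exists_dart v hv := by
    obtain ⟨⟨v, e, he⟩, rfl⟩ := exists_dart_coupledVillage (μ := id) (K := m) hs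
      (show coreEdges ⊆ baseEdges from fun e he => he.1) hv
    obtain ⟨⟨⟨e, rfl⟩, he⟩, hl⟩ := coupledVillage_inc.1 he
    exact ⟨⟨v, e, village_inc.2 ⟨he, hl⟩⟩, rfl⟩

/-- The hybrid deletion sequence of the stages, with natural numbers as labels. -/
def stageSequence (a : VillageVertex ≃ ℕ) (b : XEdge ≃ ℕ) (s : ℕ) (hm : m ≤ K)
    (hμ : ∀ t, IsNoncrossing K (μ t)) : HybridDeletionSequence where
  n := 18
  graph i := relabel a b (stage s m K μ i)
  finite_vertexSet i := by
    rw [vertexSet_relabel]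
    exact finite_vertexSet_coupledVillage.image _
  finite_edgeSet i := by
    rw [edgeSet_relabel]
    exact finite_edgeSet_coupledVillage.image _
  simple i := simple_relabel a b _
  strict := Set.univ
  step i := by
    rw [Set.univ_inter, Set.univ_inter]
    refine (stage_step (s := s) hm hμ (fun _ => true) i.2).imp ?_ ?_
    · rintro ⟨h, -⟩
      exact isHybridSubgraph_of_le (relabel_mono h a b)
    · rintro ⟨h, -⟩
      exact isHybridSubgraph_of_le (relabel_mono h a b)

section Forced

variable {a : VillageVertex ≃ ℕ} {b : XEdge ≃ ℕ} {hm : m ≤ K} {hμ : ∀ t, IsNoncrossing K (μ t)}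

/-- The cyclic order of three edges of the village, in an embedding of a stage. -/
def stageCycAt {i : ℕ} (σ : PlanarEmbedding (relabel a b (stage s m K μ i))) (v : VillageVertex)
    (e₁ e₂ e₃ : VillageEdge) : Prop :=
  σ.CycAt (a v) (b (.base e₁)) (b (.base e₂)) (b (.base e₃))

instance {i : ℕ} : Finite (Dart (relabel a b (stage s m K μ i))) :=
  Finite.of_surjective _ (relabelMono_isIso a b (stage s m K μ i)).bijective_onDart.2

/-- The edge `e` is at the vertex `v` in all stages with at least `N` houses. -/
def AtCore (s N : ℕ) (v : VillageVertex) (e : VillageEdge) : Prop :=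
  XEdge.base e ∈ coreEdges ∧ e ∈ villageEdges s (Finset.Icc 1 N) ∧
    (v = (villageEnds s e).1 ∨ v = (villageEnds s e).2)

theorem AtCore.inc {N i : ℕ} {v : VillageVertex} {e : VillageEdge} (h : AtCore s N v e)
    (hN : N ≤ stageCount m K i) : (stage s m K μ i).Inc (.base e) v :=
  stage_inc_of_core h.1 (xEdges_mono (μ := id) hN
    (show XEdge.base e ∈ xEdges s N id from h.2.1)) h.2.2

/-- Edges of the planet, and those of the other houses that are not at the surface, are never
deleted, except with a whole house. So strictness transports their cyclic orders through the
sequence. -/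
theorem stageCycAt_step {φ : ∀ i, PlanarEmbedding ((stageSequence a b s hm hμ).graph i)}
    (hφ : (stageSequence a b s hm hμ).IsSimultaneousEmbedding φ) {N : ℕ} {v : VillageVertex}
    {e₁ e₂ e₃ : VillageEdge} (h₁ : AtCore s N v e₁) (h₂ : AtCore s N v e₂) (h₃ : AtCore s N v e₃)
    {i : ℕ} (hi : i < 18) (hN : N ≤ stageCount m K i) (hN' : N ≤ stageCount m K (i + 1)) :
    stageCycAt (φ ⟨i, by exact Nat.lt_succ_of_lt hi⟩) v e₁ e₂ e₃ ↔
      stageCycAt (φ ⟨i + 1, by exact Nat.succ_lt_succ hi⟩) v e₁ e₂ e₃ := by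
  have hinc : ∀ {j e}, (stage s m K μ j).Inc (.base e) v →
      (relabel a b (stage s m K μ j)).Inc (b (.base e)) (a v) := by
    rintro j e ⟨y, hy⟩
    exact ⟨_, (relabelMono a b _).isLink _ _ _ hy⟩
  refine hφ.cycAt_iff rfl ⟨i, hi⟩ ?_ (hinc (h₁.inc hN)) (hinc (h₂.inc hN)) (hinc (h₃.inc hN))
    (hinc (h₁.inc hN')) (hinc (h₂.inc hN')) (hinc (h₃.inc hN'))
  refine (stage_step (s := s) hm hμ (fun _ => true) hi).imp ?_ ?_
  · rintro ⟨h, -⟩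
    exact relabel_mono h a b
  · rintro ⟨h, -⟩
    exact relabel_mono h a b

theorem stageCycAt_iff {φ : ∀ i, PlanarEmbedding ((stageSequence a b s hm hμ).graph i)}
    (hφ : (stageSequence a b s hm hμ).IsSimultaneousEmbedding φ) {N : ℕ} {v : VillageVertex}
    {e₁ e₂ e₃ : VillageEdge} (h₁ : AtCore s N v e₁) (h₂ : AtCore s N v e₂) (h₃ : AtCore s N v e₃)
    {i j : ℕ} (hij : i ≤ j) (hj : j < 19) (hN : ∀ k, i ≤ k → k ≤ j → N ≤ stageCount m K k) :
    stageCycAt (φ ⟨i, by exact hij.trans_lt hj⟩) v e₁ e₂ e₃ ↔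
      stageCycAt (φ ⟨j, by exact hj⟩) v e₁ e₂ e₃ := by
  induction j, hij using Nat.le_induction with
  | base => rfl
  | succ j hij ih =>
    exact (ih (by omega) fun k h1 h2 => hN k h1 (by omega)).trans
      (stageCycAt_step hφ h₁ h₂ h₃ (by omega) (hN _ hij (by omega)) (hN _ (by omega) le_rfl))

theorem atCore_claw {N x k : ℕ} (hx : 1 ≤ x) (hxN : x ≤ N) (hN : N ≤ s)
    (hk : k = 2 ∨ k = 4 ∨ k = 6) : AtCore s N (.inhabitant x) (.claw x k) :=
  ⟨⟨⟨_, rfl⟩, by simp⟩, ⟨Finset.mem_Icc.2 ⟨hx, hxN⟩, Finset.mem_Icc.2 ⟨hx, hxN.trans hN⟩, hk⟩,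
    .inl rfl⟩

theorem atCore_planet {N : ℕ} {v : VillageVertex} {e : VillageEdge} (he : e ∈ E(planet s))
    (hv : v = (villageEnds s e).1 ∨ v = (villageEnds s e).2) : AtCore s N v e := by
  have he' : e ∈ villageEdges s ∅ := he
  cases e with
  | spoke k => exact ⟨⟨⟨_, rfl⟩, by simp⟩, he', hv⟩
  | rim k => exact ⟨⟨⟨_, rfl⟩, by simp⟩, he', hv⟩
  | wall i k => exact absurd he'.1 (by simp)
  | claw i k => exact absurd he'.1 (by simp)

/-- In an embedding of a stage, the rotations at the inhabitants of coupled houses are opposite. -/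
theorem stageCycAt_coupled (hs : 0 < s) (hK : K ≤ s) (hm : m ≤ K)
    (hμ : ∀ t, IsNoncrossing K (μ t)) {t : ℕ}
    (σ : PlanarEmbedding (relabel a b (stage s m K μ (6 * t + 3)))) {x : ℕ} (hx : x < μ t x) :
    stageCycAt σ (.inhabitant x) (.claw x 2) (.claw x 4) (.claw x 6) ↔
      ¬ stageCycAt σ (.inhabitant (μ t x)) (.claw (μ t x) 2) (.claw (μ t x) 4)
        (.claw (μ t x) 6) := by
  have hiso := relabelMono_isIso a b (stage s m K μ (6 * t + 3))
  obtain ⟨τ, hτ⟩ := hiso.exists_pull σ.toRotationSystem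
  have hpot := (τ.euler_iff (isFiniteConnected_stage hs hm hK hμ)).1
    ((hτ.euler_iff hiso).2 σ.euler)
  have h1 := (hμ t).mem x (by omega)
  have h2 := (hμ t).mem' (i := x) (by omega)
  have hcount : stageCount m K (6 * t + 3) = K := stageCount_eq (by omega)
  have key : ∀ y, 1 ≤ y → y ≤ K →
      (stageCycAt σ (.inhabitant y) (.claw y 2) (.claw y 4) (.claw y 6) ↔
        τ.CycAt (.inhabitant y) (.base (.claw y 2)) (.base (.claw y 4)) (.base (.claw y 6))) := by
    intro y hy hy'
    exact hτ.cycAt_iff ((atCore_claw hy hy' hK (by simp)).inc hcount.ge)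
      ((atCore_claw hy hy' hK (by simp)).inc hcount.ge)
      ((atCore_claw hy hy' hK (by simp)).inc hcount.ge)
  rw [key x h1.1 h1.2, key _ h2.1 h2.2]
  exact cycAt_stage hK hμ hpot hx

end Forced

end

/-! ### The housing sequence, its allocation set and its size -/

section

variable {s m K : ℕ} {μ : ℕ → ℕ → ℕ}

section

variable {a : VillageVertex ≃ ℕ} {b : XEdge ≃ ℕ} {i : ℕ}

/-- The isomorphism from the village to the first and to the last stage. -/
def stageMono (a : VillageVertex ≃ ℕ) (b : XEdge ≃ ℕ) (s m K : ℕ) (μ : ℕ → ℕ → ℕ) {i : ℕ}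
    (hi : i = 0 ∨ i = 18) :
    Mono (village s (Finset.Icc 1 m)) (relabel a b (stage s m K μ i)) :=
  villageMono a b (by rw [stageCount, if_pos hi]) (by rcases hi with rfl | rfl <;> exact subset_rfl)

theorem stageMono_isIso (hi : i = 0 ∨ i = 18) : (stageMono a b s m K μ hi).IsIso :=
  villageMono_isIso a b (by rw [stageCount, if_pos hi]) (by rcases hi with rfl | rfl <;> rfl)

/-- An embedding of the first or of the last stage is an embedding of the village. -/
theorem exists_villageEmbedding (hs : 0 < s) (hm : m ≤ s) (hi : i = 0 ∨ i = 18)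
    (σ : PlanarEmbedding (relabel a b (stage s m K μ i))) :
    ∃ τ : PlanarEmbedding (village s (Finset.Icc 1 m)),
      (stageMono a b s m K μ hi).Intertwines σ.toRotationSystem τ.toRotationSystem ∧
      τ.HasPotentialsOn Set.univ ∧
      ∀ v e₁ e₂ e₃, (village s (Finset.Icc 1 m)).Inc e₁ v → (village s (Finset.Icc 1 m)).Inc e₂ v →
        (village s (Finset.Icc 1 m)).Inc e₃ v →
        (τ.CycAt v e₁ e₂ e₃ ↔ stageCycAt σ v e₁ e₂ e₃) := by
  obtain ⟨τ, hτ⟩ := (stageMono_isIso (a := a) (b := b) hi).exists_pull σ.toRotationSystem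
  have heuler := (hτ.euler_iff (stageMono_isIso hi)).2 σ.euler
  exact ⟨⟨τ, heuler⟩, hτ, (τ.euler_iff (isFiniteConnected_village hs hm)).1 heuler,
    fun v e₁ e₂ e₃ h₁ h₂ h₃ => (hτ.cycAt_iff h₁ h₂ h₃).symm⟩

theorem village_inc_claw {x k : ℕ} (hx : 1 ≤ x) (hxm : x ≤ m) (hm : m ≤ s)
    (hk : k = 2 ∨ k = 4 ∨ k = 6) :
    (village s (Finset.Icc 1 m)).Inc (.claw x k) (.inhabitant x) :=
  village_inc.2 ⟨⟨Finset.mem_Icc.2 ⟨hx, hxm⟩, Finset.mem_Icc.2 ⟨hx, hxm.trans hm⟩, hk⟩, .inl rfl⟩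

theorem not_sameSide_stage_iff (hs : 0 < s) (hm : m ≤ s) (hi : i = 0 ∨ i = 18)
    (σ : PlanarEmbedding (relabel a b (stage s m K μ i))) {x : ℕ} (hx : 1 ≤ x) (hxm : x ≤ m) :
    ¬ σ.SameSide ((stageMono a b s m K μ hi).onE '' boundingCycle x)
        ((stageMono a b s m K μ hi).onV .centre) ((stageMono a b s m K μ hi).onV (.inhabitant x)) ↔
      (stageCycAt σ (.inhabitant x) (.claw x 2) (.claw x 4) (.claw x 6) ↔
        stageCycAt σ (.surface 2) (.spoke 2) (.rim 1) (.rim 2)) := by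
  obtain ⟨τ, hτ, hpot, hcyc⟩ := exists_villageEmbedding hs hm hi σ
  have hfc := isFiniteConnected_village hs hm
  have := hfc.finite_dart
  have := hfc.loopless
  have hxI : x ∈ Finset.Icc 1 m := Finset.mem_Icc.2 ⟨hx, hxm⟩
  have hxs : x ∈ Finset.Icc 1 s := Finset.mem_Icc.2 ⟨hx, hxm.trans hm⟩
  have hx4 : x ≤ s := hxm.trans hm
  rw [hτ.sameSide_iff (stageMono_isIso hi), not_sameSide_iff hpot hxI hxs,
    hcyc _ _ _ _ (village_inc_claw hx hxm hm (by simp)) (village_inc_claw hx hxm hm (by simp))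
      (village_inc_claw hx hxm hm (by simp)), hcyc]
  · exact village_inc.2 ⟨⟨by omega, by omega⟩, .inr rfl⟩
  · refine village_inc.2 ⟨⟨by omega, by omega⟩, .inr ?_⟩
    simp only [villageEnds]
    rw [if_neg (by omega)]
  · exact village_inc.2 ⟨⟨by omega, by omega⟩, .inl rfl⟩
  · rintro e (⟨k, h1, h2, rfl⟩ | rfl | rfl)
    · exact ⟨hxI, hxs, h1, h2⟩
    · exact ⟨by omega, by omega⟩
    · exact ⟨by omega, by omega⟩
  · trivial
  · exact ⟨hxI, hxs⟩

theorem twoConnected_stage (hs : 0 < s) (hm : m ≤ K) (hK : K ≤ s) (hμ : ∀ t, IsNoncrossing K (μ t)) :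
    TwoConnected (relabel a b (stage s m K μ i)) := by
  refine ((hasNoCutVertex_stage hm hK hμ).relabel a b).twoConnected ?_ ⟨a (.surface 0), ?_⟩
  · rw [vertexSet_relabel, Set.ncard_image_of_injective _ a.injective]
    exact three_le_ncard_villageVertices hs
  · rw [vertexSet_relabel, a.injective.mem_set_image]
    exact fun h => absurd h.1 (by omega)

/-- The centre has degree at least `4 * s`, and all other degrees are at most four, or at most three
if there are no houses. For `s = 1` this requires that there are no houses. -/
theorem degree_stage_lt (hs : 0 < s) (hm : m ≤ K) (hμ : ∀ t, IsNoncrossing K (μ t))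
    (hsK : K = 0 ∨ 2 ≤ s) {v : ℕ} (hv : v ∈ V(relabel a b (stage s m K μ i)))
    (hvc : v ≠ a .centre) : ((relabel a b (stage s m K μ i)).incidenceSet v).ncard <
      ((relabel a b (stage s m K μ i)).incidenceSet (a .centre)).ncard := by
  obtain ⟨v, rfl⟩ := a.surjective v
  rw [vertexSet_relabel, a.injective.mem_set_image] at hv
  rw [incidenceSet_relabel, incidenceSet_relabel, Set.ncard_image_of_injective _ b.injective,
    Set.ncard_image_of_injective _ b.injective]
  have h1 := ncard_incidenceSet_le (F := stageEdges (μ (i / 6)) (i % 6)) (hμ (i / 6)).invol hv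
    (fun h => hvc (congrArg a h))
  have h2 := le_ncard_incidenceSet_centre (s := s) (K := stageCount m K i) (μ := μ (i / 6))
    (coreEdges_subset_stageEdges (μ := μ (i / 6)) (i % 6))
  refine h1.trans_lt (lt_of_lt_of_le ?_ h2)
  have h3 : stageCount m K i ≤ K := stageCount_le hm
  split_ifs <;> omega

end

/-- The housing sequence of the stages. -/
def stageHousing (a : VillageVertex ≃ ℕ) (b : XEdge ≃ ℕ) (hs : 0 < s) (hm : m ≤ K) (hK : K ≤ s)
    (hsK : K = 0 ∨ 2 ≤ s) (hμ : ∀ t, IsNoncrossing K (μ t)) :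
    HousingSequence s (Finset.Icc 1 m) where
  toHybridDeletionSequence := stageSequence a b s hm hμ
  index_subset := Finset.Icc_subset_Icc_right (hm.trans hK)
  twoConnected _ := twoConnected_stage hs hm hK hμ
  first := stageMono a b s m K μ (.inl rfl)
  first_isIso := stageMono_isIso _
  last := stageMono a b s m K μ (.inr rfl)
  last_isIso := stageMono_isIso _
  planet_onV i x hx := by
    refine (relabelMono a b _).onV_mem x ?_
    cases x with
    | centre => trivial
    | surface k => exact hx
    | wall i k => exact absurd hx.1 (by simp)
    | inhabitant i => exact absurd hx.1 (by simp)
  planet_isLink i e x y h := by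
    refine (relabelMono a b _).isLink _ _ _ ?_
    have h1 : AtCore s 0 (villageEnds s e).1 e := atCore_planet h.1 (.inl rfl)
    exact ⟨⟨coreEdges_subset_stageEdges _ h1.1, xEdges_mono (μ := id) (Nat.zero_le _)
      (show XEdge.base e ∈ xEdges s 0 id from h1.2.1)⟩, h.2⟩
  last_onV _ _ := rfl
  last_onE _ _ := rfl
  degree_lt _ _ hv hvc := degree_stage_lt hs hm hμ hsK hv hvc
  same_embedding φ hφ d d' := by
    have hms := hm.trans hK
    obtain ⟨τ, hτ, hpot, hcyc⟩ := exists_villageEmbedding hs hms (.inl rfl) (φ 0)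
    obtain ⟨τ', hτ', hpot', hcyc'⟩ := exists_villageEmbedding hs hms (.inr rfl) (φ (Fin.last 18))
    have hfc := isFiniteConnected_village hs hms
    have := hfc.finite_dart
    have := hfc.loopless
    have key : ∀ v e₁ e₂ e₃, AtCore s m v e₁ → AtCore s m v e₂ → AtCore s m v e₃ →
        (τ.CycAt v e₁ e₂ e₃ ↔ τ'.CycAt v e₁ e₂ e₃) := by
      intro v e₁ e₂ e₃ h₁ h₂ h₃
      have hinc : ∀ {e}, AtCore s m v e → (village s (Finset.Icc 1 m)).Inc e v :=
        fun h => village_inc.2 h.2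
      rw [hcyc _ _ _ _ (hinc h₁) (hinc h₂) (hinc h₃), hcyc' _ _ _ _ (hinc h₁) (hinc h₂) (hinc h₃)]
      exact stageCycAt_iff hφ h₁ h₂ h₃ (i := 0) (j := 18) (by omega) (by omega)
        fun _ _ _ => le_stageCount hm
    -- The walls at the surface are deleted on the way, so their positions cannot be followed. They
    -- are recovered from the planet and the inhabitants.
    have hrot : τ.rot = τ'.rot := by
      refine village_rot_eq hpot hpot' (fun v e₁ e₂ e₃ h₁ h₂ h₃ => ?_) fun x hx _ => ?_
      · have hplanet : ∀ {e}, e ∈ E(planet s) → (village s (Finset.Icc 1 m)).Inc e v →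
            AtCore s m v e := fun h1 h2 => atCore_planet h1 (village_inc.1 h2).2
        constructor
        · intro h
          exact (key _ _ _ _ (hplanet h₁ h.inc.1) (hplanet h₂ h.inc.2.1)
            (hplanet h₃ h.inc.2.2)).1 h
        · intro h
          exact (key _ _ _ _ (hplanet h₁ h.inc.1) (hplanet h₂ h.inc.2.1)
            (hplanet h₃ h.inc.2.2)).2 h
      · have hx' := Finset.mem_Icc.1 hx
        exact key _ _ _ _ (atCore_claw hx'.1 hx'.2 hms (by simp))
          (atCore_claw hx'.1 hx'.2 hms (by simp)) (atCore_claw hx'.1 hx'.2 hms (by simp))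
    have h1 := (stageMono a b s m K μ (.inl rfl)).onDart_injective.eq_iff (a := τ.rot d) (b := d')
    have h2 := (stageMono a b s m K μ (.inr rfl)).onDart_injective.eq_iff (a := τ'.rot d) (b := d')
    rw [hτ d] at h1
    rw [hτ' d, ← hrot] at h2
    exact h1.trans h2.symm

section Allocation

variable (a : VillageVertex ≃ ℕ) (b : XEdge ≃ ℕ) (hs : 0 < s) (hm : m ≤ K) (hK : K ≤ s)
  (hsK : K = 0 ∨ 2 ≤ s) (hμ : ∀ t, IsNoncrossing K (μ t))

theorem inhabitantInside_iff (σ : PlanarEmbedding ((stageHousing a b hs hm hK hsK hμ).graph 0))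
    {x : ℕ} (hx : 1 ≤ x) (hxm : x ≤ m) :
    (stageHousing a b hs hm hK hsK hμ).InhabitantInside σ x ↔
      (stageCycAt (s := s) (m := m) (K := K) (μ := μ) (i := 0) σ (.inhabitant x)
          (.claw x 2) (.claw x 4) (.claw x 6) ↔
        stageCycAt (s := s) (m := m) (K := K) (μ := μ) (i := 0) σ (.surface 2)
          (.spoke 2) (.rim 1) (.rim 2)) :=
  not_sameSide_stage_iff hs (hm.trans hK) (.inl rfl) σ hx hxm

/-- In a simultaneous embedding, there are rotations at the inhabitants of all houses of which any
two that are coupled are opposite. -/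
theorem exists_rotations {φ : ∀ i, PlanarEmbedding ((stageSequence a b s hm hμ).graph i)}
    (hφ : (stageSequence a b s hm hμ).IsSimultaneousEmbedding φ) (hs : 0 < s) (hK : K ≤ s) :
    ∃ h : ℕ → Prop, (∀ x, 1 ≤ x → x ≤ m →
        (stageCycAt (s := s) (m := m) (K := K) (μ := μ) (i := 0) (φ 0) (.inhabitant x) (.claw x 2)
          (.claw x 4) (.claw x 6) ↔ h x)) ∧
      ∀ t < 3, ∀ x, x < μ t x → (h x ↔ ¬ h (μ t x)) := by
  -- The orders are taken in the graph number 1, the first one that is guaranteed to have all `K`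
  -- houses. All houses stay until after the last coupling.
  refine ⟨fun x => stageCycAt (s := s) (m := m) (K := K) (μ := μ) (i := 1) (φ 1) (.inhabitant x)
    (.claw x 2) (.claw x 4) (.claw x 6), fun x hx hxm => ?_, fun t ht x hx => ?_⟩
  · have hc : ∀ k, k = 2 ∨ k = 4 ∨ k = 6 → AtCore s m (.inhabitant x) (.claw x k) :=
      fun k => atCore_claw hx hxm (hm.trans hK)
    exact stageCycAt_step hφ (hc _ (by simp)) (hc _ (by simp)) (hc _ (by simp)) (i := 0) (by omega)
      (le_stageCount hm) (le_stageCount hm)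
  · have h1 := (hμ t).mem x (by omega)
    have h2 := (hμ t).mem' (i := x) (by omega)
    have key : ∀ y, 1 ≤ y → y ≤ K → (stageCycAt (s := s) (m := m) (K := K) (μ := μ) (i := 1) (φ 1)
        (.inhabitant y) (.claw y 2) (.claw y 4) (.claw y 6) ↔
        stageCycAt (s := s) (m := m) (K := K) (μ := μ) (i := 6 * t + 3)
          (φ ⟨6 * t + 3, by change _ < 19; omega⟩)
          (.inhabitant y) (.claw y 2) (.claw y 4) (.claw y 6)) := by
      intro y hy hyK
      have hc : ∀ k, k = 2 ∨ k = 4 ∨ k = 6 → AtCore s K (.inhabitant y) (.claw y k) :=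
        fun k => atCore_claw hy hyK hK
      refine stageCycAt_iff hφ (hc _ (by simp)) (hc _ (by simp)) (hc _ (by simp)) (i := 1)
        (by omega) (by omega) fun k h1 h2 => ?_
      rw [stageCount, if_neg (by omega)]
    exact (key x h1.1 h1.2).trans ((stageCycAt_coupled hs hK hm hμ _ hx).trans
      (not_congr (key _ h2.1 h2.2)).symm)

/-- Inhabitants can be placed in any way that is compatible with the coupling. -/
theorem exists_simultaneousEmbedding {g : ℕ → Bool}
    (hg : ∀ t < 3, ∀ i, i < μ t i → g (μ t i) = !g i) :
    ∃ φ, (stageHousing a b hs hm hK hsK hμ).IsSimultaneousEmbedding φ ∧ ∀ x, 1 ≤ x → x ≤ m →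
      ((stageHousing a b hs hm hK hsK hμ).InhabitantInside (φ 0) x ↔ g x = true) := by
  have hex : ∀ i : Fin 19, ∃ σ : PlanarEmbedding (relabel a b (stage s m K μ i)),
      (relabelMono a b (stage s m K μ i)).Intertwines σ.toRotationSystem
        (stageSystem s m K hμ g i) := by
    intro i
    have hiso := relabelMono_isIso a b (stage s m K μ i)
    obtain ⟨σ, hσ⟩ := hiso.exists_push (stageSystem s m K hμ g i)
    refine ⟨⟨σ, (hσ.euler_iff hiso).1 ?_⟩, hσ⟩
    exact (RotationSystem.euler_iff (isFiniteConnected_stage hs hm hK hμ) _).2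
      (hasPotentialsOn_stageSystem hs hm hK hμ hg (Nat.lt_succ_iff.1 i.2))
  choose φ hφ using hex
  refine ⟨φ, ?_, fun x hx hxm => ?_⟩
  · refine HybridDeletionSequence.isSimultaneousEmbedding_of_inducesRot rfl (fun i v hv => ?_)
      fun i => ?_
    · obtain ⟨v, rfl⟩ := a.surjective v
      have hv' : v ∈ V(stage s m K μ i) := by
        rwa [← a.injective.mem_set_image, ← vertexSet_relabel a b]
      obtain ⟨d, hd⟩ := exists_dart_coupledVillage (μ := μ (i / 6)) hs
        (coreEdges_subset_stageEdges (μ := μ (i / 6)) (i % 6)) hv'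
      have hinc := ((relabelMono a b (stage s m K μ i)).onDart d).inc
      change Graph.Inc _ _ (a d.vertex) at hinc
      rw [hd] at hinc
      exact ⟨_, hinc⟩
    · refine (stage_step (s := s) hm hμ g i.2).imp ?_ ?_
      · rintro ⟨hle, h⟩
        exact ⟨relabel_mono hle a b, inducesRot_relabel hle a b h (hφ i.succ) (hφ i.castSucc)⟩
      · rintro ⟨hle, h⟩
        exact ⟨relabel_mono hle a b, inducesRot_relabel hle a b h (hφ i.castSucc) (hφ i.succ)⟩
  · have hxs := hxm.trans (hm.trans hK)
    refine (inhabitantInside_iff a b hs hm hK hsK hμ (φ 0) hx hxm).trans ?_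
    have hc : ∀ k, k = 2 ∨ k = 4 ∨ k = 6 →
        (stage s m K μ 0).Inc (.base (.claw x k)) (.inhabitant x) :=
      fun k hk => (atCore_claw hx hxm (hm.trans hK) hk).inc (le_stageCount hm)
    have hp : ∀ e ∈ E(planet s), VillageVertex.surface 2 = (villageEnds s e).1 ∨
        .surface 2 = (villageEnds s e).2 → (stage s m K μ 0).Inc (.base e) (.surface 2) :=
      fun e he h => (atCore_planet he h : AtCore s 0 _ _).inc (Nat.zero_le _)
    have h1 := (hφ 0).cycAt_iff (hc 2 (by simp)) (hc 4 (by simp)) (hc 6 (by simp))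
    have h2 := (hφ 0).cycAt_iff (hp (.spoke 2) ⟨by omega, by omega⟩ (.inr rfl))
      (hp (.rim 1) ⟨by omega, by omega⟩ (.inr (by
        simp only [villageEnds]
        rw [if_neg (by omega)])))
      (hp (.rim 2) ⟨by omega, by omega⟩ (.inl rfl))
    have h3 := cycAt_ringSystem_inhabitant (M := m) (g := g) (hμ 0).invol hx hxm hxs
    have h4 := cycAt_ringSystem_surface (M := m) (g := g) (hμ 0).invol hs
    have h5 : stageCycAt (s := s) (m := m) (K := K) (μ := μ) (i := 0) (φ 0) (.inhabitant x)
        (.claw x 2) (.claw x 4) (.claw x 6) ↔ g x = true := h1.trans h3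
    have h6 : stageCycAt (s := s) (m := m) (K := K) (μ := μ) (i := 0) (φ 0) (.surface 2)
        (.spoke 2) (.rim 1) (.rim 2) := h2.2 h4
    exact ⟨fun h => h5.1 (h.2 h6), fun h => iff_of_true (h5.2 h) h6⟩

/-- The truth value of a house compares the order at its inhabitant with the orientation `ε` of the
planet. As `ε` is common to all houses, two truth values differ exactly if the orders do, whether or
not the embedding is reflected. -/
theorem allocationSet_stageHousing {J : Finset (Finset ℕ)}
    (hJ : J ⊆ (Finset.Icc 1 m).powersetCard 2)
    (h1 : ∀ h : ℕ → Prop, (∀ t < 3, ∀ i, i < μ t i → (h i ↔ ¬ h (μ t i))) →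
      ∀ i j, ({i, j} : Finset ℕ) ∈ J → ¬ (h i ↔ h j))
    (h2 : ∀ f : ℕ → Bool, (∀ i j, ({i, j} : Finset ℕ) ∈ J → f i ≠ f j) →
      ∃ g : ℕ → Bool, (∀ i, 1 ≤ i → i ≤ m → g i = f i) ∧
        ∀ t < 3, ∀ i, i < μ t i → g (μ t i) = !g i) :
    (stageHousing a b hs hm hK hsK hμ).allocationSet = NEQ (Finset.Icc 1 m) J := by
  ext f
  constructor
  · rintro ⟨φ, hφ, hf⟩ i j hij heq
    obtain ⟨h, h3, h4⟩ := exists_rotations a b hm hμ hφ hs hK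
    have hi := Finset.mem_Icc.1 i.2
    have hj := Finset.mem_Icc.1 j.2
    obtain ⟨ε, hε⟩ : ∃ ε : Prop, stageCycAt (s := s) (m := m) (K := K) (μ := μ) (i := 0) (φ 0)
        (.surface 2) (.spoke 2) (.rim 1) (.rim 2) ↔ ε := ⟨_, Iff.rfl⟩
    have h5 : f i = true ↔ (h i ↔ ε) := (hf i).trans
      ((inhabitantInside_iff a b hs hm hK hsK hμ (φ 0) hi.1 hi.2).trans
        (iff_congr (h3 _ hi.1 hi.2) hε))
    have h6 : f j = true ↔ (h j ↔ ε) := (hf j).trans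
      ((inhabitantInside_iff a b hs hm hK hsK hμ (φ 0) hj.1 hj.2).trans
        (iff_congr (h3 _ hj.1 hj.2) hε))
    have h7 := h1 h h4 i j hij
    rw [heq] at h5
    tauto
  · intro hf
    -- The value outside of the index set is arbitrary, as the pairs in `J` consist of indices.
    let f' : ℕ → Bool := fun i => if hi : i ∈ Finset.Icc 1 m then f ⟨i, hi⟩ else true
    have hf' : ∀ i j, ({i, j} : Finset ℕ) ∈ J → f' i ≠ f' j := by
      intro i j hij
      have h3 := (Finset.mem_powersetCard.1 (hJ hij)).1
      have hi : i ∈ Finset.Icc 1 m := h3 (by simp)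
      have hj : j ∈ Finset.Icc 1 m := h3 (by simp)
      simp only [f', hi, hj, dif_pos]
      exact hf ⟨i, hi⟩ ⟨j, hj⟩ hij
    obtain ⟨g, hg1, hg2⟩ := h2 f' hf'
    obtain ⟨φ, hφ, h3⟩ := exists_simultaneousEmbedding a b hs hm hK hsK hμ hg2
    refine ⟨φ, hφ, fun i => ?_⟩
    have hi := Finset.mem_Icc.1 i.2
    rw [h3 i hi.1 hi.2, hg1 i hi.1 hi.2]
    simp only [f', i.2, dif_pos]

theorem size_stageHousing_le :
    (stageHousing a b hs hm hK hsK hμ).size ≤ 19 * (12 * s + 1 + 17 * K) := by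
  have h1 : ∀ i : Fin 19, V(relabel a b (stage s m K μ i)).ncard +
      E(relabel a b (stage s m K μ i)).ncard ≤ 12 * s + 1 + 17 * K := by
    intro i
    rw [vertexSet_relabel, edgeSet_relabel, Set.ncard_image_of_injective _ a.injective,
      Set.ncard_image_of_injective _ b.injective]
    refine size_coupledVillage_le.trans ?_
    have := stageCount_le (i := i) hm
    omega
  have h2 := Finset.sum_le_sum (s := Finset.univ) fun i (_ : i ∈ Finset.univ) => h1 i
  rw [Finset.sum_const, Finset.card_univ, Fintype.card_fin, smul_eq_mul] at h2
  exact h2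

end Allocation

instance : Countable VillageVertex := by
  refine Function.Injective.countable (f := fun v : VillageVertex => match v with
    | .centre => ((0, 0, 0) : ℕ × ℕ × ℕ)
    | .surface k => (1, k, 0)
    | .wall i k => (2, i, k)
    | .inhabitant i => (3, i, 0)) ?_
  rintro (_ | _ | _ | _) (_ | _ | _ | _) h <;> simp_all

instance : Infinite VillageVertex :=
  Infinite.of_injective VillageVertex.surface fun a b h => by simpa using h

instance : Countable XEdge := by
  refine Function.Injective.countable (f := fun e : XEdge => match e with
    | .base (.spoke k) => ((0, k, 0) : ℕ × ℕ × ℕ)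
    | .base (.rim k) => (1, k, 0)
    | .base (.wall i k) => (2, i, k)
    | .base (.claw i k) => (3, i, k)
    | .link i => (4, i, 0)
    | .couple i => (5, i, 0)) ?_
  rintro ((_ | _ | _ | _) | _ | _) ((_ | _ | _ | _) | _ | _) h <;> simp_all

instance : Infinite XEdge := Infinite.of_injective XEdge.link fun a b h => by simpa using h

/-- Since `s ^ (4 / 3)` is `s` times the cube root of `s`, it suffices to replace the root by a
small integer below it: 1 in general, and 2 if `m` is at least 2. -/
theorem size_bound (hs : 0 < s) (hm : m ^ 3 ≤ s) (hms : ¬ (m = 1 ∧ s = 1)) (hK : K ≤ m ^ 3) :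
    ((19 * (12 * s + 1 + 17 * K) : ℕ) : ℝ) ≤ 400 * (s : ℝ) ^ (4 / 3 : ℝ) := by
  have hs' : (1 : ℝ) ≤ s := by exact_mod_cast hs
  have hpow : (s : ℝ) ^ (4 / 3 : ℝ) = s * (s : ℝ) ^ (1 / 3 : ℝ) := by
    rw [show (4 / 3 : ℝ) = 1 + 1 / 3 by norm_num, Real.rpow_add (by positivity), Real.rpow_one]
  have hroot : ∀ c : ℝ, 0 ≤ c → c ^ 3 ≤ s → c ≤ (s : ℝ) ^ (1 / 3 : ℝ) := by
    intro c hc h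
    have h1 := Real.rpow_le_rpow (by positivity) h (show (0 : ℝ) ≤ 1 / 3 by norm_num)
    rwa [← Real.rpow_natCast, ← Real.rpow_mul hc, show ((3 : ℕ) : ℝ) * (1 / 3) = 1 by norm_num,
      Real.rpow_one] at h1
  have key : ∀ c : ℝ, 0 ≤ c → c ^ 3 ≤ s → ((19 * (12 * s + 1 + 17 * K) : ℕ) : ℝ) ≤ 400 * (s * c) →
      ((19 * (12 * s + 1 + 17 * K) : ℕ) : ℝ) ≤ 400 * (s : ℝ) ^ (4 / 3 : ℝ) := by
    intro c hc h h'
    rw [hpow]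
    refine h'.trans ?_
    have := hroot c hc h
    gcongr
  rcases Nat.lt_or_ge m 2 with h | h
  · refine key 1 (by norm_num) (by simpa using hs') ?_
    rw [mul_one]
    -- For `m = 0` there are no houses. For `m = 1` there is at most one and `s` is at least 2, so
    -- the size is at most `228 * s + 342`, which is at most `399 * s`.
    have : 19 * (12 * s + 1 + 17 * K) ≤ 400 * s := by
      interval_cases m <;> omega
    exact_mod_cast this
  · have h8 : 2 ^ 3 ≤ s := (Nat.pow_le_pow_left h 3).trans hm
    refine key 2 (by norm_num) (by exact_mod_cast h8) ?_
    -- Here `K ≤ s`, so the size is at most `551 * s + 19`.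
    have : 19 * (12 * s + 1 + 17 * K) ≤ 400 * (s * 2) := by omega
    exact_mod_cast this

end

end Housing

theorem mainTheorem9 (m s : ℕ) (J : Finset (Finset ℕ))
    (hJ : J ⊆ (Finset.Icc 1 m).powersetCard 2)
    (hs : m ^ 3 ≤ s) (hs_pos : 0 < s) (hms : ¬ (m = 1 ∧ s = 1)) :
    ∃ 𝒢 : Housing.HousingSequence s (Finset.Icc 1 m),
      𝒢.length ≤ 27 ∧
      (𝒢.size : ℝ) ≤ 400 * (s : ℝ) ^ (4 / 3 : ℝ) ∧
      𝒢.allocationSet = Housing.NEQ (Finset.Icc 1 m) J := by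
  obtain ⟨K, μ, hmK, hK, hμ, h1, h2⟩ := Housing.exists_matchings m J hJ
  obtain ⟨a⟩ := nonempty_equiv_of_countable (α := Housing.VillageVertex) (β := ℕ)
  obtain ⟨b⟩ := nonempty_equiv_of_countable (α := Housing.XEdge) (β := ℕ)
  -- For `s = 1` the hypotheses leave only `m = 0`, and then there are no houses.
  have hsK : K = 0 ∨ 2 ≤ s := by
    rcases Nat.lt_or_ge m 2 with h | h
    · interval_cases m <;> omega
    · have := (Nat.pow_le_pow_left h 3).trans hs
      omega
  refine ⟨Housing.stageHousing a b hs_pos hmK (hK.trans hs) hsK hμ, ?_, ?_, ?_⟩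
  · change 18 + 1 ≤ 27
    norm_num
  · exact (Nat.cast_le.2 (Housing.size_stageHousing_le a b hs_pos hmK (hK.trans hs) hsK hμ)).trans
      (Housing.size_bound hs_pos hs hms hK)
  · exact Housing.allocationSet_stageHousing a b hs_pos hmK (hK.trans hs) hsK hμ hJ h1 h2
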